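/- **Notation.** Let $\tau\in\mathbb C$, $\operatorname{Im}\tau>0$; let $\theta_j(\cdot\,|\,\tau)$ be the Jacobi theta functions with nome $e^{\pi i\tau}$, let $k=\theta_2(0)^2/\theta_3(0)^2$, and let $$\mathrm{cd}(u)=\frac{\mathrm{cn}(u,k)}{\mathrm{dn}(u,k)}=\frac{\theta_3(0)\,\theta_2(v)}{\theta_2(0)\,\theta_3(v)},\qquad v=u/\theta_3(0)^2 .$$ Let $c_1,\dots,c_8,\eta,x,y$ be independent complex variables, $c_{1234}=c_1+c_2+c_3+c_4$, and $$\lambda=\tfrac12\sum_{i=1}^8c_i .$$ Write $\langle u,v;w\rangle=\dfrac{1-\mathrm{cd}(u)/\mathrm{cd}(w)}{1-\mathrm{cd}(v)/\mathrm{cd}(w)}$. **Lattice.** On $\mathrm{Pic}=\mathbb ZH_0\oplus\mathbb ZH_1\oplus\bigoplus_{i=1}^8\mathbb ZE_i$ with the form $(H_i|H_j)=1-\delta_{ij}$, $(H_i|E_j)=0$, $(E_i|E_j)=-\delta_{ij}$ let $\delta=2H_0+2H_1-\sum E_i$, $\alpha_0=E_7-E_8$, $\alpha_1=H_1-H_0$,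 $\alpha_2=H_0-E_1-E_2$, $\alpha_i=E_{i-1}-E_i$ $(3\le i\le7)$, $\alpha_8=E_1-E_2$, and let $s_i$ $(0\le i\le 8)$ be the reflection $v\mapsto v-\frac{2(v|\alpha_i)}{(\alpha_i|\alpha_i)}\alpha_i$. **Birational action.** The $s_i$ act as follows on $c_1,\dots,c_8,\eta,x,y$ (variables not listed are fixed): $s_0:c_7\leftrightarrow c_8$; $s_1:\eta\mapsto-\eta,\ x\leftrightarrow y$; $s_k:c_{k-1}\leftrightarrow c_k$ for $k=3,\dots,7$; $s_8:c_1\leftrightarrow c_2$; $s_2(\eta)=\eta-\frac{2\eta+c_1+c_2}4$, $s_2(c_i)=c_i-\frac{3(2\eta+c_1+c_2)}4$ for $i=1,2$, $s_2(c_i)=c_i+\frac{2\eta+c_1+c_2}4$ for $i\ge3$, and $s_2(y)$ is determined by $$\frac{s_2(y)-\mathrm{cd}(2\eta-\frac{c_1-c_2}2)}{s_2(y)-\mathrm{cd}(2\eta+\frac{c_1-c_2}2)}\cdot\frac{x-\mathrm{cd}(\eta+c_1)}{x-\mathrm{cd}(\eta+c_2)}\cdot\frac{y-\mathrm{cd}(\eta-c_2)}{y-\mathrm{cd}(\eta-c_1)}=\langle\eta-c_2,\eta-c_1;\eta\rangle\,\langle\eta+c_1,\eta+c_2;\eta\rangle\,\langle2\eta-\tfrac{c_1-c_2}2,2\eta+\tfrac{c_1-c_2}2;\tfrac{c_1+c_2}2\rangle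 .$$ Elements act on functions by $w.F=F(w.c_i,w.\eta,w.x,w.y)$, and $s_{i_1\cdots i_m}=s_{i_1}\cdots s_{i_m}$. Put $$R=s_{23483256457067348356452348321},\qquad T=R^2 .$$ **Coefficient functions.** With $S=a_1+a_2+a_3+a_4$ and $m=\frac{a_1+a_2}2$, $$G(a_1,a_2,a_3,a_4,b)=\langle a_4+m,a_3+m;a_2+m\rangle\langle b-a_4,b-a_3;b-a_1\rangle\langle b+a_4-\tfrac S2,b+a_3-\tfrac S2;b+a_2+\tfrac S2\rangle\langle a_3+m,a_4+m;2b+a_2-m\rangle .$$ With $p_i=\mathrm{cd}(b+a_i)$, $m_i=\mathrm{cd}(b-a_i)$, $t_i=\mathrm{cd}(b+a_i+\frac{a_5}2)$, $r=\mathrm{cd}(b+a_3-\frac{a_5}2)$, $$Q(a_1,\dots,a_5,b;X)=(r-t_2)(t_1-t_4)(p_4p_1+p_2X)+(r-t_1)(t_4-t_2)(p_4p_2+p_1X)-(r-t_4)(t_1-t_2)(p_1p_2+p_4X),$$ $$\begin{aligned}P(a_1,a_2,a_3,b;X,Y)=&\big[(m_3-m_2)p_1+(m_1-m_3)p_2+(m_2-m_1)p_3\big]XY\\&+\big[(m_2-m_3)m_1p_1+(m_3-m_1)m_2p_2+(m_1-m_2)m_3p_3\big]X\\&+\big[(p_3-p_2)m_1p_1+(p_1-p_3)m_2p_2+(p_2-p_1)m_3p_3\big]Y\\&+(p_2m_3-m_2p_3)m_1p_1+(p_3m_1-m_3p_1)m_2p_2+(p_1m_2-m_1p_2)m_3p_3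 .\end{aligned}$$ Finally, for $d=(d_1,\dots,d_6)$, $$N_d(z,b;X,Y)=\frac{Q(d_5,d_6,d_3,z,c_{1234},b;X)}{P(d_1,d_2,d_4,b;X,Y)}-\frac{X-\mathrm{cd}(b+d_3)}{X-\mathrm{cd}(b+d_4)}\cdot\frac{Q(d_5,d_6,d_4,z,c_{1234},b;X)}{G(d_1,d_2,d_3,d_4,b)\,P(d_1,d_2,d_3,b;X,Y)} .$$ **Theorem.** 1. On the root lattice, $T(\alpha_1)=\alpha_1-2\delta$, $T(\alpha_2)=\alpha_2+\delta$, and $T(\alpha_i)=\alpha_i$ for $i\ne1,2$. On the parameters, $T(c_i)=c_i$ $(1\le i\le 8)$ and $T(\eta)=\eta+\lambda$. 2. $\bar x=T(x)$ and $\bar y=T(y)$ satisfy, with $d=(c_1,\dots,c_6)$, $$\begin{aligned}&\frac{\bar y-\mathrm{cd}(\eta-c_8+\lambda)}{\bar y-\mathrm{cd}(\eta-c_7+\lambda)}\cdot\frac{x-\mathrm{cd}(\eta+c_7)}{x-\mathrm{cd}(\eta+c_8)}\\&=\langle\eta-c_8+\lambda,\eta-c_7+\lambda;3\eta+c_6+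\lambda\rangle\,\langle2\eta+\tfrac{c_7-c_8}2+\lambda,2\eta-\tfrac{c_7-c_8}2+\lambda;c_6+\tfrac{c_7+c_8}2-\lambda\rangle\\&\quad\times\langle2\eta-\tfrac{c_7-c_8}2+\lambda,2\eta+\tfrac{c_7-c_8}2+\lambda;2\eta+c_6-\tfrac{c_7+c_8}2+\lambda\rangle\,\langle\eta+c_8+\tfrac{c_{1234}}2,\eta+c_7+\tfrac{c_{1234}}2;\eta+c_5+\tfrac{c_{1234}}2\rangle\,\frac{N_d(c_7,\eta;x,y)}{N_d(c_8,\eta;x,y)}\end{aligned}$$ and, with $d'=(\frac\lambda2-c_8,\frac\lambda2-c_7,\frac\lambda2-c_6,\frac\lambda2-c_5,\frac\lambda2-c_4,\frac\lambda2-c_3)$, $$\begin{aligned}&\frac{\bar x-\mathrm{cd}(\eta+c_1+\lambda)}{\bar x-\mathrm{cd}(\eta+c_2+\lambda)}\cdot\frac{\bar y-\mathrm{cd}(\eta-c_2+\lambda)}{\bar y-\mathrm{cd}(\eta-c_1+\lambda)}=A\cdot\frac{N_{d'}(\frac\lambda2-c_2,\eta+\frac\lambda2;\bar y,x)}{N_{d'}(\frac\lambda2-c_1,\eta+\frac\lambda2;\bar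 y,x)},\end{aligned}$$ $$\begin{aligned}A=\ &\langle\eta+c_1+\lambda,\eta+c_2+\lambda;3\eta-c_3+3\lambda\rangle\,\langle2\eta+\tfrac{c_1-c_2}2+2\lambda,2\eta-\tfrac{c_1-c_2}2+2\lambda;c_3+\tfrac{c_1+c_2}2\rangle\\&\times\langle2\eta-\tfrac{c_1-c_2}2+2\lambda,2\eta+\tfrac{c_1-c_2}2+2\lambda;2\eta-c_3+\tfrac{c_1+c_2}2+2\lambda\rangle\,\langle\eta-c_1+\tfrac{c_{1234}}2+\lambda,\eta-c_2+\tfrac{c_{1234}}2+\lambda;\eta-c_4+\tfrac{c_{1234}}2+\lambda\rangle .\end{aligned}$$ 3. On the parameter subspace $c_5+c_4=c_6+c_3=c_7+c_2=c_8+c_1=\frac\lambda2$ one has $R:(c_1,\dots,c_8,\eta,x,y)\mapsto(c_1,\dots,c_8,\eta+\frac\lambda2,\tilde x,x)$ where $\tilde x=R(x)$. With $\tilde{\tilde x}=R(R(x))$ and $d''=(c_1,c_2,c_3,c_4,\frac\lambda2-c_4,\frac\lambda2-c_3)$ this gives the scalar second-order equation $$\frac{\tilde{\tilde x}-\mathrm{cd}(\eta+c_1+\lambda)}{\tilde{\tilde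 x}-\mathrm{cd}(\eta+c_2+\lambda)}\cdot\frac{\tilde x-\mathrm{cd}(\eta-c_2+\lambda)}{\tilde x-\mathrm{cd}(\eta-c_1+\lambda)}=A\cdot\frac{N_{d''}(\frac\lambda2-c_2,\eta+\frac\lambda2;\tilde x,x)}{N_{d''}(\frac\lambda2-c_1,\eta+\frac\lambda2;\tilde x,x)} .$$ The equations are identities between meromorphic functions: each holds at every point $(c,\eta,x,y)$ at which all the successive reflections in $T=R^2$ are defined with finite values (no $\mathrm{cd}$ evaluated at a pole, no vanishing denominator, $s_2(y)$ uniquely determined) and all terms of the equation are defined. In 2 the set of points where this is so for both equations is open and dense in $\mathbb C^{11}$; in 3 the corresponding set is relatively open and dense in the set of all points with parameters in the subspace. -/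

import Mathlib

noncomputable section

namespace EllipticPainleve

/-! ### Jacobi theta functions and Jacobian elliptic functions

The period ratio is `τ` with `0 < τ.im`, the nome is `q = exp (π i τ)`, and
`theta₃ τ v` is the classical `θ₃(π v | τ) = ∑ q^(n²) exp (2 i n π v)`, and so on.
In these terms `k = θ₂(0)² / θ₃(0)²`, `K = π θ₃(0)² / 2`, `i K' = K τ`. -/

def theta₃ (τ v : ℂ) : ℂ := jacobiTheta₂ v τ

def theta₄ (τ v : ℂ) : ℂ := jacobiTheta₂ (v + 1 / 2) τ

def theta₂ (τ v : ℂ) : ℂ :=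
  Complex.exp (Real.pi * Complex.I * τ / 4 + Real.pi * Complex.I * v) *
    jacobiTheta₂ (v + τ / 2) τ

/-- The argument `u / (π θ₃(0)²) = u / (2 K)` of the theta functions. -/
def thetaArg (τ u : ℂ) : ℂ := u / (Real.pi * theta₃ τ 0 ^ 2)

def jacobiCn (τ u : ℂ) : ℂ :=
  (theta₄ τ 0 * theta₂ τ (thetaArg τ u)) / (theta₂ τ 0 * theta₄ τ (thetaArg τ u))

def jacobiDn (τ u : ℂ) : ℂ :=
  (theta₄ τ 0 * theta₃ τ (thetaArg τ u)) / (theta₃ τ 0 * theta₄ τ (thetaArg τ u))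

/-- The Jacobian elliptic function `cd = cn / dn`, with the removable singularities of the
quotient at the poles of `cn` and `dn` removed (see `cd_eq_cn_div_dn`). -/
def cd (τ u : ℂ) : ℂ :=
  (theta₃ τ 0 * theta₂ τ (thetaArg τ u)) / (theta₂ τ 0 * theta₃ τ (thetaArg τ u))

theorem cd_eq_cn_div_dn (τ u : ℂ) (h0 : theta₄ τ 0 ≠ 0) (hu : theta₄ τ (thetaArg τ u) ≠ 0) :
    cd τ u = jacobiCn τ u / jacobiDn τ u := by
  unfold cd jacobiCn jacobiDn
  rw [div_div_div_eq]
  rw [show theta₄ τ 0 * theta₂ τ (thetaArg τ u) * (theta₃ τ 0 * theta₄ τ (thetaArg τ u)) =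
      (theta₄ τ 0 * theta₄ τ (thetaArg τ u)) * (theta₃ τ 0 * theta₂ τ (thetaArg τ u)) by ring,
    show theta₂ τ 0 * theta₄ τ (thetaArg τ u) * (theta₄ τ 0 * theta₃ τ (thetaArg τ u)) =
      (theta₄ τ 0 * theta₄ τ (thetaArg τ u)) * (theta₂ τ 0 * theta₃ τ (thetaArg τ u)) by ring]
  rw [mul_div_mul_left _ _ (mul_ne_zero h0 hu)]

/-- `u` is not a pole of `cd`. -/
def CdReg (τ u : ℂ) : Prop := theta₃ τ (thetaArg τ u) ≠ 0

/-! ### Two kinds of quotients that occur in all formulas, with their domains of definition -/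

/-- `(1 - cd u / cd w) / (1 - cd v / cd w)` -/
def cdQuot (τ u v w : ℂ) : ℂ := (1 - cd τ u / cd τ w) / (1 - cd τ v / cd τ w)

def CdQuotReg (τ u v w : ℂ) : Prop :=
  CdReg τ u ∧ CdReg τ v ∧ CdReg τ w ∧ cd τ w ≠ 0 ∧ 1 - cd τ v / cd τ w ≠ 0

/-- `(X - cd u) / (X - cd v)` -/
def linQuot (τ X u v : ℂ) : ℂ := (X - cd τ u) / (X - cd τ v)

def LinQuotReg (τ X u v : ℂ) : Prop := CdReg τ u ∧ CdReg τ v ∧ X - cd τ v ≠ 0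

/-! ### The Picard lattice and the linear action of the reflections

An element `(h, e)` stands for `h 0 • H₀ + h 1 • H₁ + ∑ i, e i • E_{i+1}`. -/

abbrev Pic : Type := (Fin 2 → ℤ) × (Fin 8 → ℤ)

/-- The intersection form: `(H_i|H_j) = 1 - δ_ij`, `(H_i|E_j) = 0`, `(E_i|E_j) = -δ_ij`. -/
def interForm (v w : Pic) : ℤ := v.1 0 * w.1 1 + v.1 1 * w.1 0 - ∑ i, v.2 i * w.2 i

def picH (i : Fin 2) : Pic := (Pi.single i 1, 0)

/-- `picE j` is the exceptional class `E_{j+1}`. -/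
def picE (j : Fin 8) : Pic := (0, Pi.single j 1)

/-- The simple roots `α₀, …, α₈`. -/
def simpleRoot : Fin 9 → Pic :=
  ![picE 6 - picE 7,
    picH 1 - picH 0,
    picH 0 - picE 0 - picE 1,
    picE 1 - picE 2,
    picE 2 - picE 3,
    picE 3 - picE 4,
    picE 4 - picE 5,
    picE 5 - picE 6,
    picE 0 - picE 1]

/-- The anti-canonical class `δ = 2 H₀ + 2 H₁ - ∑ E_i`. -/
def antiCanonical : Pic := 2 • picH 0 + 2 • picH 1 - ∑ j, picE j

/-- The reflection `s_i` on the Picard lattice (here `(α_i|α_i) = -2`, so the division is exact). -/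
def picReflection (i : Fin 9) (v : Pic) : Pic :=
  v - ((2 * interForm v (simpleRoot i)) / interForm (simpleRoot i) (simpleRoot i)) • simpleRoot i

/-- `s_{i₁ ⋯ i_m} . v = s_{i₁} . (s_{i₂} . ( ⋯ (s_{i_m} . v)))` -/
def picWord (w : List (Fin 9)) (v : Pic) : Pic := w.foldr picReflection v

/-! ### The birational action on parameters and coordinates -/

/-- The space with coordinates `(c, η, x, y)`, where `c j` is `c_{j+1}`. -/
abbrev State : Type := (Fin 8 → ℂ) × ℂ × ℂ × ℂ

def State.c (p : State) : Fin 8 → ℂ := p.1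

def State.η (p : State) : ℂ := p.2.1

def State.x (p : State) : ℂ := p.2.2.1

def State.y (p : State) : ℂ := p.2.2.2

/-- `λ = (c₁ + ⋯ + c₈) / 2` -/
def State.lam (p : State) : ℂ := (∑ j, p.c j) / 2

/-- The constant on the right of the relation that defines `s₂(y)`. -/
def s₂Const (τ c₁ c₂ η : ℂ) : ℂ :=
  cdQuot τ (η - c₂) (η - c₁) η * cdQuot τ (η + c₁) (η + c₂) η *
    cdQuot τ (2 * η - (c₁ - c₂) / 2) (2 * η + (c₁ - c₂) / 2) ((c₁ + c₂) / 2)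

/-- The relation that defines `Y = s₂(y)`. -/
def S₂Relation (τ c₁ c₂ η x y Y : ℂ) : Prop :=
  linQuot τ Y (2 * η - (c₁ - c₂) / 2) (2 * η + (c₁ - c₂) / 2) *
      linQuot τ x (η + c₁) (η + c₂) * linQuot τ y (η - c₂) (η - c₁) =
    s₂Const τ c₁ c₂ η

def s₂Num (τ c₁ c₂ η x y : ℂ) : ℂ :=
  s₂Const τ c₁ c₂ η * (x - cd τ (η + c₂)) * (y - cd τ (η - c₁))

def s₂Den (τ c₁ c₂ η x y : ℂ) : ℂ := (x - cd τ (η + c₁)) * (y - cd τ (η - c₂))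

/-- `s₂(y)`: the relation `S₂Relation` solved for `Y` (see `s₂Relation_iff`). -/
def s₂Y (τ c₁ c₂ η x y : ℂ) : ℂ :=
  (cd τ (2 * η - (c₁ - c₂) / 2) * s₂Den τ c₁ c₂ η x y -
      cd τ (2 * η + (c₁ - c₂) / 2) * s₂Num τ c₁ c₂ η x y) /
    (s₂Den τ c₁ c₂ η x y - s₂Num τ c₁ c₂ η x y)

/-- The relation that defines `s₂(y)` makes sense and has a unique finite solution. -/
def S₂Reg (τ c₁ c₂ η x y : ℂ) : Prop :=
  CdQuotReg τ (η - c₂) (η - c₁) η ∧ CdQuotReg τ (η + c₁) (η + c₂) η ∧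
  CdQuotReg τ (2 * η - (c₁ - c₂) / 2) (2 * η + (c₁ - c₂) / 2) ((c₁ + c₂) / 2) ∧
  x - cd τ (η + c₂) ≠ 0 ∧ y - cd τ (η - c₁) ≠ 0 ∧
  cd τ (2 * η - (c₁ - c₂) / 2) ≠ cd τ (2 * η + (c₁ - c₂) / 2) ∧
  s₂Den τ c₁ c₂ η x y ≠ 0 ∧ s₂Den τ c₁ c₂ η x y - s₂Num τ c₁ c₂ η x y ≠ 0

theorem s₂Relation_iff (τ c₁ c₂ η x y Y : ℂ) (h : S₂Reg τ c₁ c₂ η x y) :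
    (Y - cd τ (2 * η + (c₁ - c₂) / 2) ≠ 0 ∧ S₂Relation τ c₁ c₂ η x y Y) ↔
      Y = s₂Y τ c₁ c₂ η x y := by
  obtain ⟨-, -, -, hx, hy, hAB, hD, hDN⟩ := h
  unfold S₂Relation s₂Y linQuot
  unfold s₂Num s₂Den at *
  generalize cd τ (2 * η - (c₁ - c₂) / 2) = A at *
  generalize cd τ (2 * η + (c₁ - c₂) / 2) = B at *
  generalize s₂Const τ c₁ c₂ η = g at *
  generalize x - cd τ (η + c₂) = x₂ at *
  generalize x - cd τ (η + c₁) = x₁ at *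
  generalize y - cd τ (η - c₁) = y₁ at *
  generalize y - cd τ (η - c₂) = y₂ at *
  rw [eq_div_iff hDN]
  constructor
  · rintro ⟨hB, hR⟩
    field_simp at hR
    linear_combination hR
  · intro hY
    have hB : Y - B ≠ 0 := by
      intro h0
      have : (A - B) * (x₁ * y₂) = 0 := by
        rw [sub_eq_zero] at h0
        subst h0
        linear_combination -hY
      exact (mul_ne_zero (sub_ne_zero.mpr hAB) hD) this
    refine ⟨hB, ?_⟩
    field_simp
    linear_combination hY

/-- `s_i` on the coordinates: `step τ i p` has the coordinates
`(s_i(c), s_i(η), s_i(x), s_i(y))` evaluated at `p`. -/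
def step (τ : ℂ) (i : Fin 9) (p : State) : State :=
  match i with
  | 0 => (p.c ∘ Equiv.swap 6 7, p.η, p.x, p.y)
  | 1 => (p.c, -p.η, p.y, p.x)
  | 2 =>
    (fun j =>
        if j = 0 ∨ j = 1 then p.c j - 3 * (2 * p.η + p.c 0 + p.c 1) / 4
        else p.c j + (2 * p.η + p.c 0 + p.c 1) / 4,
      p.η - (2 * p.η + p.c 0 + p.c 1) / 4, p.x, s₂Y τ (p.c 0) (p.c 1) p.η p.x p.y)
  | 3 => (p.c ∘ Equiv.swap 1 2, p.η, p.x, p.y)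
  | 4 => (p.c ∘ Equiv.swap 2 3, p.η, p.x, p.y)
  | 5 => (p.c ∘ Equiv.swap 3 4, p.η, p.x, p.y)
  | 6 => (p.c ∘ Equiv.swap 4 5, p.η, p.x, p.y)
  | 7 => (p.c ∘ Equiv.swap 5 6, p.η, p.x, p.y)
  | 8 => (p.c ∘ Equiv.swap 0 1, p.η, p.x, p.y)

/-- `s_i` acts on a function `F` by acting on its arguments: `s_i.F = F(s_i.c, s_i.η, s_i.x, s_i.y)`. -/
def act {α : Type*} (τ : ℂ) (i : Fin 9) (F : State → α) : State → α := fun p => F (step τ i p)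

/-- `s_{i₁ ⋯ i_m} . F = s_{i₁} . (s_{i₂} . ( ⋯ (s_{i_m} . F)))` -/
def actWord {α : Type*} (τ : ℂ) (w : List (Fin 9)) (F : State → α) : State → α :=
  w.foldr (act τ) F

/-- All the reflections of the word are defined (with finite values) along the way from `p`. -/
def WordReg (τ : ℂ) : List (Fin 9) → State → Prop
  | [], _ => True
  | i :: w, p => (i = 2 → S₂Reg τ (p.c 0) (p.c 1) p.η p.x p.y) ∧ WordReg τ w (step τ i p)

/-- `R = s_{23483256457067348356452348321}` -/
def RJ2 : List (Fin 9) :=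
  [2, 3, 4, 8, 3, 2, 5, 6, 4, 5, 7, 0, 6, 7, 3, 4, 8, 3, 5, 6, 4, 5, 2, 3, 4, 8, 3, 2, 1]

/-- `T = R²` -/
def TJ2 : List (Fin 9) := RJ2 ++ RJ2

/-! ### The coefficient functions of the equations -/

def gG (τ a₁ a₂ a₃ a₄ b : ℂ) : ℂ :=
  cdQuot τ (a₄ + (a₁ + a₂) / 2) (a₃ + (a₁ + a₂) / 2) (a₂ + (a₁ + a₂) / 2) *
  cdQuot τ (b - a₄) (b - a₃) (b - a₁) *
  cdQuot τ (b + a₄ - (a₁ + a₂ + a₃ + a₄) / 2) (b + a₃ - (a₁ + a₂ + a₃ + a₄) / 2)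
    (b + a₂ + (a₁ + a₂ + a₃ + a₄) / 2) *
  cdQuot τ (a₃ + (a₁ + a₂) / 2) (a₄ + (a₁ + a₂) / 2) (2 * b + a₂ - (a₁ + a₂) / 2)

def GReg (τ a₁ a₂ a₃ a₄ b : ℂ) : Prop :=
  CdQuotReg τ (a₄ + (a₁ + a₂) / 2) (a₃ + (a₁ + a₂) / 2) (a₂ + (a₁ + a₂) / 2) ∧
  CdQuotReg τ (b - a₄) (b - a₃) (b - a₁) ∧
  CdQuotReg τ (b + a₄ - (a₁ + a₂ + a₃ + a₄) / 2) (b + a₃ - (a₁ + a₂ + a₃ + a₄) / 2)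
    (b + a₂ + (a₁ + a₂ + a₃ + a₄) / 2) ∧
  CdQuotReg τ (a₃ + (a₁ + a₂) / 2) (a₄ + (a₁ + a₂) / 2) (2 * b + a₂ - (a₁ + a₂) / 2)

def qQ (τ a₁ a₂ a₃ a₄ a₅ b X : ℂ) : ℂ :=
  (cd τ (b + a₃ - a₅ / 2) - cd τ (b + a₂ + a₅ / 2)) *
      (cd τ (b + a₁ + a₅ / 2) - cd τ (b + a₄ + a₅ / 2)) *
      (cd τ (b + a₄) * cd τ (b + a₁) + cd τ (b + a₂) * X) +
  (cd τ (b + a₃ - a₅ / 2) - cd τ (b + a₁ + a₅ / 2)) *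
      (cd τ (b + a₄ + a₅ / 2) - cd τ (b + a₂ + a₅ / 2)) *
      (cd τ (b + a₄) * cd τ (b + a₂) + cd τ (b + a₁) * X) -
  (cd τ (b + a₃ - a₅ / 2) - cd τ (b + a₄ + a₅ / 2)) *
      (cd τ (b + a₁ + a₅ / 2) - cd τ (b + a₂ + a₅ / 2)) *
      (cd τ (b + a₁) * cd τ (b + a₂) + cd τ (b + a₄) * X)

def QReg (τ a₁ a₂ a₃ a₄ a₅ b : ℂ) : Prop :=
  CdReg τ (b + a₁) ∧ CdReg τ (b + a₂) ∧ CdReg τ (b + a₄) ∧ CdReg τ (b + a₃ - a₅ / 2) ∧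
  CdReg τ (b + a₁ + a₅ / 2) ∧ CdReg τ (b + a₂ + a₅ / 2) ∧ CdReg τ (b + a₄ + a₅ / 2)

def pP (τ a₁ a₂ a₃ b X Y : ℂ) : ℂ :=
  ((cd τ (b - a₃) - cd τ (b - a₂)) * cd τ (b + a₁) +
      (cd τ (b - a₁) - cd τ (b - a₃)) * cd τ (b + a₂) +
      (cd τ (b - a₂) - cd τ (b - a₁)) * cd τ (b + a₃)) * X * Y +
  ((cd τ (b - a₂) - cd τ (b - a₃)) * cd τ (b - a₁) * cd τ (b + a₁) +
      (cd τ (b - a₃) - cd τ (b - a₁)) * cd τ (b - a₂) * cd τ (b + a₂) +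
      (cd τ (b - a₁) - cd τ (b - a₂)) * cd τ (b - a₃) * cd τ (b + a₃)) * X +
  ((cd τ (b + a₃) - cd τ (b + a₂)) * cd τ (b - a₁) * cd τ (b + a₁) +
      (cd τ (b + a₁) - cd τ (b + a₃)) * cd τ (b - a₂) * cd τ (b + a₂) +
      (cd τ (b + a₂) - cd τ (b + a₁)) * cd τ (b - a₃) * cd τ (b + a₃)) * Y +
  ((cd τ (b + a₂) * cd τ (b - a₃) - cd τ (b - a₂) * cd τ (b + a₃)) *
        cd τ (b - a₁) * cd τ (b + a₁) +
      (cd τ (b + a₃) * cd τ (b - a₁) - cd τ (b - a₃) * cd τ (b + a₁)) *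
        cd τ (b - a₂) * cd τ (b + a₂) +
      (cd τ (b + a₁) * cd τ (b - a₂) - cd τ (b - a₁) * cd τ (b + a₂)) *
        cd τ (b - a₃) * cd τ (b + a₃))

def PReg (τ a₁ a₂ a₃ b : ℂ) : Prop :=
  CdReg τ (b + a₁) ∧ CdReg τ (b + a₂) ∧ CdReg τ (b + a₃) ∧
  CdReg τ (b - a₁) ∧ CdReg τ (b - a₂) ∧ CdReg τ (b - a₃)

/-- The common shape of the numerators and denominators of the last factors of the equations:
`Q(d₅,d₆,d₃,z,s,b;X) / P(d₁,d₂,d₄,b;X,Y) -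
(X - cd(b+d₃))/(X - cd(b+d₄)) * Q(d₅,d₆,d₄,z,s,b;X) / (G(d₁,d₂,d₃,d₄,b) P(d₁,d₂,d₃,b;X,Y))`. -/
def mixN (τ d₁ d₂ d₃ d₄ d₅ d₆ z s b X Y : ℂ) : ℂ :=
  qQ τ d₅ d₆ d₃ z s b X / pP τ d₁ d₂ d₄ b X Y -
    linQuot τ X (b + d₃) (b + d₄) *
      (qQ τ d₅ d₆ d₄ z s b X / (gG τ d₁ d₂ d₃ d₄ b * pP τ d₁ d₂ d₃ b X Y))

def MixNReg (τ d₁ d₂ d₃ d₄ d₅ d₆ z s b X Y : ℂ) : Prop :=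
  QReg τ d₅ d₆ d₃ z s b ∧ QReg τ d₅ d₆ d₄ z s b ∧
  PReg τ d₁ d₂ d₄ b ∧ PReg τ d₁ d₂ d₃ b ∧ GReg τ d₁ d₂ d₃ d₄ b ∧
  pP τ d₁ d₂ d₄ b X Y ≠ 0 ∧ pP τ d₁ d₂ d₃ b X Y ≠ 0 ∧ gG τ d₁ d₂ d₃ d₄ b ≠ 0 ∧
  LinQuotReg τ X (b + d₃) (b + d₄)

/-! ### The equations, and the conditions that all their terms are defined -/

/-- First equation of the MSY system; `Y` stands for `ȳ`, `l` for `λ`. -/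
def MSYFirst (τ c₁ c₂ c₃ c₄ c₅ c₆ c₇ c₈ η l x y Y : ℂ) : Prop :=
  linQuot τ Y (η - c₈ + l) (η - c₇ + l) * linQuot τ x (η + c₇) (η + c₈) =
    cdQuot τ (η - c₈ + l) (η - c₇ + l) (3 * η + c₆ + l) *
    cdQuot τ (2 * η + (c₇ - c₈) / 2 + l) (2 * η - (c₇ - c₈) / 2 + l) (c₆ + (c₇ + c₈) / 2 - l) *
    cdQuot τ (2 * η - (c₇ - c₈) / 2 + l) (2 * η + (c₇ - c₈) / 2 + l)
      (2 * η + c₆ - (c₇ + c₈) / 2 + l) *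
    cdQuot τ (η + c₈ + (c₁ + c₂ + c₃ + c₄) / 2) (η + c₇ + (c₁ + c₂ + c₃ + c₄) / 2)
      (η + c₅ + (c₁ + c₂ + c₃ + c₄) / 2) *
    (mixN τ c₁ c₂ c₃ c₄ c₅ c₆ c₇ (c₁ + c₂ + c₃ + c₄) η x y /
      mixN τ c₁ c₂ c₃ c₄ c₅ c₆ c₈ (c₁ + c₂ + c₃ + c₄) η x y)

def MSYFirstReg (τ c₁ c₂ c₃ c₄ c₅ c₆ c₇ c₈ η l x y Y : ℂ) : Prop :=
  LinQuotReg τ Y (η - c₈ + l) (η - c₇ + l) ∧ LinQuotReg τ x (η + c₇) (η + c₈) ∧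
  CdQuotReg τ (η - c₈ + l) (η - c₇ + l) (3 * η + c₆ + l) ∧
  CdQuotReg τ (2 * η + (c₇ - c₈) / 2 + l) (2 * η - (c₇ - c₈) / 2 + l) (c₆ + (c₇ + c₈) / 2 - l) ∧
  CdQuotReg τ (2 * η - (c₇ - c₈) / 2 + l) (2 * η + (c₇ - c₈) / 2 + l)
    (2 * η + c₆ - (c₇ + c₈) / 2 + l) ∧
  CdQuotReg τ (η + c₈ + (c₁ + c₂ + c₃ + c₄) / 2) (η + c₇ + (c₁ + c₂ + c₃ + c₄) / 2)
    (η + c₅ + (c₁ + c₂ + c₃ + c₄) / 2) ∧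
  MixNReg τ c₁ c₂ c₃ c₄ c₅ c₆ c₇ (c₁ + c₂ + c₃ + c₄) η x y ∧
  MixNReg τ c₁ c₂ c₃ c₄ c₅ c₆ c₈ (c₁ + c₂ + c₃ + c₄) η x y ∧
  mixN τ c₁ c₂ c₃ c₄ c₅ c₆ c₈ (c₁ + c₂ + c₃ + c₄) η x y ≠ 0

/-- Second equation of the MSY system; `X`, `Y` stand for `x̄`, `ȳ`, and `l` for `λ`. Note that
`η + l/2 + (l/2 - c₆) = η - c₆ + l`. -/
def MSYSecond (τ c₁ c₂ c₃ c₄ c₅ c₆ c₇ c₈ η l x X Y : ℂ) : Prop :=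
  linQuot τ X (η + c₁ + l) (η + c₂ + l) * linQuot τ Y (η - c₂ + l) (η - c₁ + l) =
    cdQuot τ (η + c₁ + l) (η + c₂ + l) (3 * η - c₃ + 3 * l) *
    cdQuot τ (2 * η + (c₁ - c₂) / 2 + 2 * l) (2 * η - (c₁ - c₂) / 2 + 2 * l)
      (c₃ + (c₁ + c₂) / 2) *
    cdQuot τ (2 * η - (c₁ - c₂) / 2 + 2 * l) (2 * η + (c₁ - c₂) / 2 + 2 * l)
      (2 * η - c₃ + (c₁ + c₂) / 2 + 2 * l) *
    cdQuot τ (η - c₁ + (c₁ + c₂ + c₃ + c₄) / 2 + l) (η - c₂ + (c₁ + c₂ + c₃ + c₄) / 2 + l)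
      (η - c₄ + (c₁ + c₂ + c₃ + c₄) / 2 + l) *
    (mixN τ (l / 2 - c₈) (l / 2 - c₇) (l / 2 - c₆) (l / 2 - c₅) (l / 2 - c₄) (l / 2 - c₃)
        (l / 2 - c₂) (c₁ + c₂ + c₃ + c₄) (η + l / 2) Y x /
      mixN τ (l / 2 - c₈) (l / 2 - c₇) (l / 2 - c₆) (l / 2 - c₅) (l / 2 - c₄) (l / 2 - c₃)
        (l / 2 - c₁) (c₁ + c₂ + c₃ + c₄) (η + l / 2) Y x)

def MSYSecondReg (τ c₁ c₂ c₃ c₄ c₅ c₆ c₇ c₈ η l x X Y : ℂ) : Prop :=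
  LinQuotReg τ X (η + c₁ + l) (η + c₂ + l) ∧ LinQuotReg τ Y (η - c₂ + l) (η - c₁ + l) ∧
  CdQuotReg τ (η + c₁ + l) (η + c₂ + l) (3 * η - c₃ + 3 * l) ∧
  CdQuotReg τ (2 * η + (c₁ - c₂) / 2 + 2 * l) (2 * η - (c₁ - c₂) / 2 + 2 * l)
    (c₃ + (c₁ + c₂) / 2) ∧
  CdQuotReg τ (2 * η - (c₁ - c₂) / 2 + 2 * l) (2 * η + (c₁ - c₂) / 2 + 2 * l)
    (2 * η - c₃ + (c₁ + c₂) / 2 + 2 * l) ∧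
  CdQuotReg τ (η - c₁ + (c₁ + c₂ + c₃ + c₄) / 2 + l) (η - c₂ + (c₁ + c₂ + c₃ + c₄) / 2 + l)
    (η - c₄ + (c₁ + c₂ + c₃ + c₄) / 2 + l) ∧
  MixNReg τ (l / 2 - c₈) (l / 2 - c₇) (l / 2 - c₆) (l / 2 - c₅) (l / 2 - c₄) (l / 2 - c₃)
    (l / 2 - c₂) (c₁ + c₂ + c₃ + c₄) (η + l / 2) Y x ∧
  MixNReg τ (l / 2 - c₈) (l / 2 - c₇) (l / 2 - c₆) (l / 2 - c₅) (l / 2 - c₄) (l / 2 - c₃)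
    (l / 2 - c₁) (c₁ + c₂ + c₃ + c₄) (η + l / 2) Y x ∧
  mixN τ (l / 2 - c₈) (l / 2 - c₇) (l / 2 - c₆) (l / 2 - c₅) (l / 2 - c₄) (l / 2 - c₃)
    (l / 2 - c₁) (c₁ + c₂ + c₃ + c₄) (η + l / 2) Y x ≠ 0

/-- The projectively reduced scalar equation; `x₁`, `x₂` stand for the first and the second
iterate of `x`, and `l` for `λ`. -/
def Reduced (τ c₁ c₂ c₃ c₄ η l x x₁ x₂ : ℂ) : Prop :=
  linQuot τ x₂ (η + c₁ + l) (η + c₂ + l) * linQuot τ x₁ (η - c₂ + l) (η - c₁ + l) =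
    cdQuot τ (η + c₁ + l) (η + c₂ + l) (3 * η - c₃ + 3 * l) *
    cdQuot τ (2 * η + (c₁ - c₂) / 2 + 2 * l) (2 * η - (c₁ - c₂) / 2 + 2 * l)
      (c₃ + (c₁ + c₂) / 2) *
    cdQuot τ (2 * η - (c₁ - c₂) / 2 + 2 * l) (2 * η + (c₁ - c₂) / 2 + 2 * l)
      (2 * η - c₃ + (c₁ + c₂) / 2 + 2 * l) *
    cdQuot τ (η - c₁ + (c₁ + c₂ + c₃ + c₄) / 2 + l) (η - c₂ + (c₁ + c₂ + c₃ + c₄) / 2 + l)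
      (η - c₄ + (c₁ + c₂ + c₃ + c₄) / 2 + l) *
    (mixN τ c₁ c₂ c₃ c₄ (l / 2 - c₄) (l / 2 - c₃) (l / 2 - c₂)
        (c₁ + c₂ + c₃ + c₄) (η + l / 2) x₁ x /
      mixN τ c₁ c₂ c₃ c₄ (l / 2 - c₄) (l / 2 - c₃) (l / 2 - c₁)
        (c₁ + c₂ + c₃ + c₄) (η + l / 2) x₁ x)

def ReducedReg (τ c₁ c₂ c₃ c₄ η l x x₁ x₂ : ℂ) : Prop :=
  LinQuotReg τ x₂ (η + c₁ + l) (η + c₂ + l) ∧ LinQuotReg τ x₁ (η - c₂ + l) (η - c₁ + l) ∧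
  CdQuotReg τ (η + c₁ + l) (η + c₂ + l) (3 * η - c₃ + 3 * l) ∧
  CdQuotReg τ (2 * η + (c₁ - c₂) / 2 + 2 * l) (2 * η - (c₁ - c₂) / 2 + 2 * l)
    (c₃ + (c₁ + c₂) / 2) ∧
  CdQuotReg τ (2 * η - (c₁ - c₂) / 2 + 2 * l) (2 * η + (c₁ - c₂) / 2 + 2 * l)
    (2 * η - c₃ + (c₁ + c₂) / 2 + 2 * l) ∧
  CdQuotReg τ (η - c₁ + (c₁ + c₂ + c₃ + c₄) / 2 + l) (η - c₂ + (c₁ + c₂ + c₃ + c₄) / 2 + l)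
    (η - c₄ + (c₁ + c₂ + c₃ + c₄) / 2 + l) ∧
  MixNReg τ c₁ c₂ c₃ c₄ (l / 2 - c₄) (l / 2 - c₃) (l / 2 - c₂)
    (c₁ + c₂ + c₃ + c₄) (η + l / 2) x₁ x ∧
  MixNReg τ c₁ c₂ c₃ c₄ (l / 2 - c₄) (l / 2 - c₃) (l / 2 - c₁)
    (c₁ + c₂ + c₃ + c₄) (η + l / 2) x₁ x ∧
  mixN τ c₁ c₂ c₃ c₄ (l / 2 - c₄) (l / 2 - c₃) (l / 2 - c₁)
    (c₁ + c₂ + c₃ + c₄) (η + l / 2) x₁ x ≠ 0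

/-! ### The transformed coordinates as functions on the state space -/

/-- `x̄ = T(x)` -/
def xBar (τ : ℂ) : State → ℂ := actWord τ TJ2 State.x

/-- `ȳ = T(y)` -/
def yBar (τ : ℂ) : State → ℂ := actWord τ TJ2 State.y

/-- `R(x)` -/
def xTilde (τ : ℂ) : State → ℂ := actWord τ RJ2 State.x

/-- `R(R(x))` -/
def xTildeTilde (τ : ℂ) : State → ℂ := actWord τ RJ2 (xTilde τ)

/-- The points at which `T` is defined and all terms of the two MSY equations make sense. -/
def MSYDomain (τ : ℂ) : Set State :=
  {p | WordReg τ TJ2 p ∧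
    MSYFirstReg τ (p.c 0) (p.c 1) (p.c 2) (p.c 3) (p.c 4) (p.c 5) (p.c 6) (p.c 7)
      p.η p.lam p.x p.y (yBar τ p) ∧
    MSYSecondReg τ (p.c 0) (p.c 1) (p.c 2) (p.c 3) (p.c 4) (p.c 5) (p.c 6) (p.c 7)
      p.η p.lam p.x (xBar τ p) (yBar τ p)}

/-- The points whose parameters satisfy `c₅ + c₄ = c₆ + c₃ = c₇ + c₂ = c₈ + c₁ = λ / 2`. -/
def SpecialSet : Set State :=
  {p | p.c 4 + p.c 3 = p.lam / 2 ∧ p.c 5 + p.c 2 = p.lam / 2 ∧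
    p.c 6 + p.c 1 = p.lam / 2 ∧ p.c 7 + p.c 0 = p.lam / 2}

/-- The special points at which `R` and `R²` are defined and all terms of the reduced equation
make sense. -/
def ReducedDomain (τ : ℂ) : Set State :=
  {p | p ∈ SpecialSet ∧ WordReg τ (RJ2 ++ RJ2) p ∧
    ReducedReg τ (p.c 0) (p.c 1) (p.c 2) (p.c 3) p.η p.lam p.x (xTilde τ p) (xTildeTilde τ p)}

end EllipticPainleve

end

noncomputable section

namespace EllipticPainleve

open Complex Filter Topology

/-!
The identity `θ₂(u) θ₃(v) - θ₂(v) θ₃(u) = σ(u - v) σ(u + v)` factors `cd u - cd v`, so on a fibre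
`x = cd u` every value `cd (b + u)` can be compared through products of the odd function `σ`,
which satisfy Weierstrass' three-term relation. On such a fibre `s₂` multiplies the homogeneous
coordinates `y - cd (2η - u)` and `y - cd (2η + u)` of the pencil by products of two sigmas and
moves their centre. The word `R` consists of permutations and four such `s₂`, all on the fibre of
`x`, so `R(x)` is obtained by multiplying the four factors. Cleared of denominators, `N_d` is
affine in `Y`, and on the fibre its values at `Y = cd (2b - u)` and `Y = cd (2b + u)` are products
of sigmas. Comparing them with the product formula for `R(x)` gives the first equation off the
branch locus of `cd`, hence everywhere by continuity. The second equation is the first one at the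
point `R p`. All conditions for the equations to be meaningful are open, and they hold on a dense
subset of the fibre over generic parameters, in particular over the generic points of a line in a
fixed direction inside the special parameter subspace.
-/

/-! ### Theta functions -/

theorem hasSum_int_prod_of_add_sub {M : Type*} [AddCommMonoid M] [TopologicalSpace M]
    [ContinuousAdd M] {F : ℤ × ℤ → M} {a b : M}
    (heven : HasSum (fun p : ℤ × ℤ => F (p.1 + p.2, p.1 - p.2)) a)
    (hodd : HasSum (fun p : ℤ × ℤ => F (p.1 + p.2 + 1, p.1 - p.2)) b) : HasSum F (a + b) := by
  set φ : ℤ × ℤ → ℤ × ℤ := fun p => (p.1 + p.2, p.1 - p.2) with hφ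
  set ψ : ℤ × ℤ → ℤ × ℤ := fun p => (p.1 + p.2 + 1, p.1 - p.2) with hψ
  have hφ_inj : Function.Injective φ := by
    rintro ⟨m, n⟩ ⟨m', n'⟩ h
    simp only [hφ, Prod.mk.injEq] at h ⊢
    omega
  have hψ_inj : Function.Injective ψ := by
    rintro ⟨m, n⟩ ⟨m', n'⟩ h
    simp only [hψ, Prod.mk.injEq] at h ⊢
    omega
  have hcompl : IsCompl (Set.range φ) (Set.range ψ) := by
    refine ⟨Set.disjoint_left.2 ?_, codisjoint_iff_le_sup.2 ?_⟩
    · rintro _ ⟨⟨m, n⟩, rfl⟩ ⟨⟨m', n'⟩, h⟩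
      simp only [hφ, hψ, Prod.mk.injEq] at h
      omega
    · rintro ⟨m, n⟩ -
      rcases Int.even_or_odd' (m + n) with ⟨k, hk | hk⟩
      · exact Or.inl ⟨(k, m - k), by simp only [hφ, Prod.mk.injEq]; omega⟩
      · exact Or.inr ⟨(k, m - k - 1), by simp only [hψ, Prod.mk.injEq]; omega⟩
  exact (hφ_inj.hasSum_range_iff.2 heven).add_isCompl hcompl (hψ_inj.hasSum_range_iff.2 hodd)

theorem theta₃_neg (τ v : ℂ) : theta₃ τ (-v) = theta₃ τ v := jacobiTheta₂_neg_left v τ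

theorem theta₃_add_one (τ v : ℂ) : theta₃ τ (v + 1) = theta₃ τ v := jacobiTheta₂_add_left v τ

theorem theta₃_add_tau (τ v : ℂ) :
    theta₃ τ (v + τ) = cexp (-Real.pi * I * (τ + 2 * v)) * theta₃ τ v :=
  jacobiTheta₂_add_left' v τ

theorem theta₂_neg (τ v : ℂ) : theta₂ τ (-v) = theta₂ τ v := by
  unfold theta₂
  rw [← jacobiTheta₂_neg_left (-v + τ / 2), show -(-v + τ / 2) = v - τ / 2 by ring,
    show v + τ / 2 = (v - τ / 2) + τ by ring, jacobiTheta₂_add_left', ← mul_assoc,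
    ← Complex.exp_add]
  congr 2
  ring

theorem theta₂_add_one (τ v : ℂ) : theta₂ τ (v + 1) = -theta₂ τ v := by
  unfold theta₂
  rw [add_right_comm, jacobiTheta₂_add_left, mul_add_one, ← add_assoc, Complex.exp_add_pi_mul_I,
    neg_mul]

theorem theta₂_add_tau (τ v : ℂ) :
    theta₂ τ (v + τ) = cexp (-Real.pi * I * (τ + 2 * v)) * theta₂ τ v := by
  unfold theta₂
  rw [add_right_comm, jacobiTheta₂_add_left', ← mul_assoc, ← mul_assoc, ← Complex.exp_add,
    ← Complex.exp_add]
  congr 2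
  ring

theorem theta₃_add_half_tau (τ v : ℂ) :
    theta₃ τ (v + τ / 2) = cexp (-(Real.pi * I * τ / 4 + Real.pi * I * v)) * theta₂ τ v := by
  rw [theta₂, ← mul_assoc, ← Complex.exp_add, neg_add_cancel, Complex.exp_zero, one_mul, theta₃]

theorem theta₂_add_half_tau (τ v : ℂ) :
    theta₂ τ (v + τ / 2) = cexp (-(Real.pi * I * τ / 4 + Real.pi * I * v)) * theta₃ τ v := by
  rw [theta₂, add_assoc, add_halves, ← theta₃, theta₃_add_tau, ← mul_assoc, ← Complex.exp_add]
  congr 2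
  ring

theorem theta₂_half (τ : ℂ) : theta₂ τ (1 / 2) = 0 := by
  have h : theta₂ τ (-(1 / 2) + 1) = -theta₂ τ (1 / 2) := by rw [theta₂_add_one, theta₂_neg]
  rw [show -(1 / 2) + 1 = (1 / 2 : ℂ) by ring] at h
  exact self_eq_neg.1 h

theorem hasSum_mul_jacobiTheta₂_term (x y : ℂ) {τ : ℂ} (hτ : 0 < τ.im) :
    HasSum (fun p : ℤ × ℤ => jacobiTheta₂_term p.1 x τ * jacobiTheta₂_term p.2 y τ)
      (jacobiTheta₂ x τ * jacobiTheta₂ y τ) := by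
  have hx := hasSum_jacobiTheta₂_term x hτ
  have hy := hasSum_jacobiTheta₂_term y hτ
  exact HasSum.mul (f := fun n : ℤ => jacobiTheta₂_term n x τ)
    (g := fun n : ℤ => jacobiTheta₂_term n y τ) hx hy
    (summable_mul_of_summable_norm (f := fun n : ℤ => jacobiTheta₂_term n x τ)
      (g := fun n : ℤ => jacobiTheta₂_term n y τ) hx.summable.norm hy.summable.norm)

theorem theta₃_mul_theta₃ {τ : ℂ} (hτ : 0 < τ.im) (x y : ℂ) :
    theta₃ τ x * theta₃ τ y =
      theta₃ (2 * τ) (x + y) * theta₃ (2 * τ) (x - y) +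
        theta₂ (2 * τ) (x + y) * theta₂ (2 * τ) (x - y) := by
  have h2τ : 0 < (2 * τ).im := by simpa using hτ
  have heven : HasSum (fun p : ℤ × ℤ =>
      jacobiTheta₂_term (p.1 + p.2) x τ * jacobiTheta₂_term (p.1 - p.2) y τ)
      (theta₃ (2 * τ) (x + y) * theta₃ (2 * τ) (x - y)) := by
    refine (hasSum_mul_jacobiTheta₂_term (x + y) (x - y) h2τ).congr_fun fun p => ?_
    simp only [jacobiTheta₂_term, ← Complex.exp_add]
    push_cast
    congr 1
    ring
  have hodd : HasSum (fun p : ℤ × ℤ =>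
      jacobiTheta₂_term (p.1 + p.2 + 1) x τ * jacobiTheta₂_term (p.1 - p.2) y τ)
      (theta₂ (2 * τ) (x + y) * theta₂ (2 * τ) (x - y)) := by
    rw [theta₂, theta₂, mul_mul_mul_comm]
    refine ((hasSum_mul_jacobiTheta₂_term (x + y + 2 * τ / 2) (x - y + 2 * τ / 2)
      h2τ).mul_left _).congr_fun fun p => ?_
    simp only [jacobiTheta₂_term, ← Complex.exp_add]
    push_cast
    congr 1
    ring
  exact (hasSum_mul_jacobiTheta₂_term x y hτ).unique (hasSum_int_prod_of_add_sub heven hodd)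

theorem theta₂_mul_theta₂ {τ : ℂ} (hτ : 0 < τ.im) (x y : ℂ) :
    theta₂ τ x * theta₂ τ y =
      theta₂ (2 * τ) (x + y) * theta₃ (2 * τ) (x - y) +
        theta₃ (2 * τ) (x + y) * theta₂ (2 * τ) (x - y) := by
  have hprod := theta₃_mul_theta₃ hτ (x + τ / 2) (y + τ / 2)
  rw [show x + τ / 2 + (y + τ / 2) = x + y + 2 * τ / 2 by ring, add_sub_add_right_eq_sub,
    theta₃_add_half_tau, theta₃_add_half_tau, theta₃_add_half_tau, theta₂_add_half_tau,
    mul_mul_mul_comm, ← Complex.exp_add, mul_assoc (cexp _), mul_assoc (cexp _), ← mul_add,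
    show -(Real.pi * I * τ / 4 + Real.pi * I * x) + -(Real.pi * I * τ / 4 + Real.pi * I * y) =
      -(Real.pi * I * (2 * τ) / 4 + Real.pi * I * (x + y)) by ring] at hprod
  exact mul_left_cancel₀ (Complex.exp_ne_zero _) hprod

theorem theta₄_two_mul_zero_sq {τ : ℂ} (hτ : 0 < τ.im) :
    theta₄ (2 * τ) 0 ^ 2 = theta₄ τ 0 * theta₃ τ 0 := by
  have h := theta₃_mul_theta₃ hτ (1 / 2) 0
  simp only [add_zero, sub_zero, theta₂_half, mul_zero] at h
  simp only [theta₄, zero_add, sq]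
  exact h.symm

theorem theta₄_zero_eq_jacobiTheta (τ : ℂ) : theta₄ τ 0 = jacobiTheta (τ + 1) := by
  rw [theta₄, zero_add, jacobiTheta_eq_jacobiTheta₂]
  refine tsum_congr fun n => ?_
  simp only [jacobiTheta₂_term]
  rw [Complex.exp_eq_exp_iff_exists_int]
  obtain ⟨k, hk⟩ : ∃ k : ℤ, n - n ^ 2 = 2 * k := by
    rcases Int.even_mul_succ_self (n - 1) with ⟨k, hk⟩
    exact ⟨-k, by linear_combination -hk⟩
  have hk' : (n : ℂ) - n ^ 2 = 2 * k := by exact_mod_cast hk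
  exact ⟨k, by linear_combination Real.pi * I * hk'⟩

theorem theta₄_zero_ne_zero_of_one_le_im {τ : ℂ} (hτ : 1 ≤ τ.im) : theta₄ τ 0 ≠ 0 := by
  intro h0
  rw [theta₄_zero_eq_jacobiTheta] at h0
  have hbound := norm_jacobiTheta_sub_one_le (τ := τ + 1) (by simpa using by linarith)
  rw [h0, show (τ + 1).im = τ.im by simp, zero_sub, norm_neg, norm_one] at hbound
  have hq : Real.exp (-Real.pi * τ.im) < 1 / 3 := calc
    Real.exp (-Real.pi * τ.im) ≤ Real.exp (-3) :=
      Real.exp_le_exp.2 (by nlinarith [Real.pi_gt_three])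
    _ < 1 / 3 := by
      rw [Real.exp_neg, one_div]
      exact inv_strictAnti₀ (by norm_num)
        (by linarith [Real.add_one_lt_exp (x := 3) (by norm_num)])
  rw [div_mul_eq_mul_div, le_div_iff₀ (by linarith)] at hbound
  linarith

/- `θ₄(2τ)² = θ₄(τ) θ₃(τ)` propagates the nonvanishing from large `Im τ` to all `τ`. -/
theorem theta₄_zero_ne_zero {τ : ℂ} (hτ : 0 < τ.im) : theta₄ τ 0 ≠ 0 := by
  have ne_zero_of_pow (n : ℕ) : ∀ t : ℂ, 0 < t.im → 1 ≤ 2 ^ n * t.im → theta₄ t 0 ≠ 0 := by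
    induction n with
    | zero => exact fun t _ h => theta₄_zero_ne_zero_of_one_le_im (by simpa using h)
    | succ n ih =>
      intro t ht h h0
      have hsq := theta₄_two_mul_zero_sq ht
      rw [h0, zero_mul] at hsq
      exact ih (2 * t) (by simpa using ht) (by simpa [pow_succ, mul_assoc] using h)
        (pow_eq_zero_iff two_ne_zero |>.1 hsq)
  obtain ⟨n, hn⟩ := pow_unbounded_of_one_lt (1 / τ.im) one_lt_two
  exact ne_zero_of_pow n τ hτ ((div_lt_iff₀ hτ).1 hn).le

theorem theta₃_zero_ne_zero {τ : ℂ} (hτ : 0 < τ.im) : theta₃ τ 0 ≠ 0 := by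
  have h : theta₄ τ 0 * theta₃ τ 0 ≠ 0 := by
    rw [← theta₄_two_mul_zero_sq hτ]
    exact pow_ne_zero 2 (theta₄_zero_ne_zero (by simpa using hτ))
  exact right_ne_zero_of_mul h

theorem theta₂_zero_ne_zero {τ : ℂ} (hτ : 0 < τ.im) : theta₂ τ 0 ≠ 0 := by
  have hτ0 : τ ≠ 0 := by
    rintro rfl
    simp at hτ
  have him : 0 < (-1 / τ).im := by
    rw [neg_div, neg_im, one_div, inv_im, neg_div, neg_neg]
    exact div_pos hτ (normSq_pos.2 hτ0)
  have h4 := theta₄_zero_ne_zero him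
  rw [theta₄, zero_add] at h4
  rw [theta₂, zero_add, jacobiTheta₂_functional_equation, show τ / 2 / τ = 1 / 2 by field_simp]
  refine mul_ne_zero (Complex.exp_ne_zero _)
    (mul_ne_zero (mul_ne_zero (one_div_ne_zero ?_) (Complex.exp_ne_zero _)) h4)
  simp [hτ0]

/-- The odd theta function in `θ₂(u) θ₃(v) - θ₂(v) θ₃(u) = σ(u - v) σ(u + v)`, that is
`θ₁(v / 2 | τ / 2)` up to a constant; the factor `I` makes the sign of the product formula `+`. -/
def sigmaTheta (τ v : ℂ) : ℂ := I * theta₂ (τ / 2) ((v + 1) / 2)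

theorem sigmaTheta_neg (τ v : ℂ) : sigmaTheta τ (-v) = -sigmaTheta τ v := by
  rw [sigmaTheta, sigmaTheta, show (v + 1) / 2 = -((-v + 1) / 2) + 1 by ring, theta₂_add_one,
    theta₂_neg, mul_neg, neg_neg]

theorem theta₂_mul_theta₃_sub {τ : ℂ} (hτ : 0 < τ.im) (u v : ℂ) :
    theta₂ τ u * theta₃ τ v - theta₂ τ v * theta₃ τ u =
      sigmaTheta τ (u - v) * sigmaTheta τ (u + v) := by
  have hτ2 : 0 < (τ / 2).im := by simpa using hτ
  rw [sigmaTheta, sigmaTheta, mul_mul_mul_comm, I_mul_I, theta₂_mul_theta₂ hτ2,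
    mul_div_cancel₀ τ two_ne_zero, show (u - v + 1) / 2 + (u + v + 1) / 2 = u + 1 by ring,
    show (u - v + 1) / 2 - (u + v + 1) / 2 = -v by ring, theta₂_add_one, theta₃_add_one,
    theta₂_neg, theta₃_neg]
  ring

theorem differentiable_theta₃ {τ : ℂ} (hτ : 0 < τ.im) : Differentiable ℂ (theta₃ τ) :=
  fun v => differentiableAt_jacobiTheta₂_fst v hτ

theorem differentiable_theta₂ {τ : ℂ} (hτ : 0 < τ.im) : Differentiable ℂ (theta₂ τ) :=
  Differentiable.mul (by fun_prop)
    ((differentiable_theta₃ hτ).comp (differentiable_id.add_const (τ / 2)))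

theorem differentiable_sigmaTheta {τ : ℂ} (hτ : 0 < τ.im) : Differentiable ℂ (sigmaTheta τ) :=
  ((differentiable_theta₂ (τ := τ / 2) (by simpa using hτ)).comp
    ((differentiable_id.add_const 1).div_const 2)).const_mul I

theorem sigmaTheta_one_ne_zero {τ : ℂ} (hτ : 0 < τ.im) : sigmaTheta τ 1 ≠ 0 := by
  rw [sigmaTheta, add_self_div_two, ← zero_add (1 : ℂ), theta₂_add_one]
  exact mul_ne_zero I_ne_zero (neg_ne_zero.2 (theta₂_zero_ne_zero (by simpa using hτ)))

/-! ### Entire functions -/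

theorem eventually_ne_zero_of_entire {F : ℂ → ℂ} (hF : Differentiable ℂ F) (h0 : ∃ w, F w ≠ 0)
    (u : ℂ) : ∀ᶠ v in 𝓝[≠] u, F v ≠ 0 := by
  obtain ⟨w, hw⟩ := h0
  have hcodiscrete := AnalyticOnNhd.preimage_zero_mem_codiscrete (fun z _ => hF.analyticAt z) hw
  have hmem := disjoint_principal_right.1 (mem_codiscrete.1 hcodiscrete u)
  rwa [compl_compl] at hmem

theorem eventually_comp_line_ne_zero {F : ℂ → ℂ} (hF : Differentiable ℂ F) (h0 : ∃ w, F w ≠ 0)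
    (a : ℂ) {b : ℂ} (hb : b ≠ 0) : ∀ᶠ z in 𝓝[≠] (0 : ℂ), F (a + z * b) ≠ 0 := by
  obtain ⟨w, hw⟩ := h0
  exact eventually_ne_zero_of_entire (F := fun z => F (a + z * b)) (hF.comp (by fun_prop))
    ⟨(w - a) / b, by rwa [div_mul_cancel₀ _ hb, add_sub_cancel]⟩ 0

theorem isBounded_range_of_periodic_basis {ι E α : Type*} [Finite ι] [NormedAddCommGroup E]
    [NormedSpace ℝ E] [ProperSpace E] [PseudoMetricSpace α] (b : Module.Basis ι ℝ E) {F : E → α}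
    (hF : Continuous F) (hper : ∀ i, Function.Periodic F (b i)) :
    Bornology.IsBounded (Set.range F) := by
  have : Fintype ι := Fintype.ofFinite ι
  have hlattice : ∀ w ∈ Submodule.span ℤ (Set.range b), Function.Periodic F w := by
    intro w hw
    induction hw using Submodule.span_induction with
    | mem w hw =>
      obtain ⟨i, rfl⟩ := hw
      exact hper i
    | zero => exact fun v => by rw [add_zero]
    | add w w' _ _ hw hw' => exact hw.add_period hw'
    | smul n w _ hw => exact hw.zsmul n
  refine (((isCompact_closedBall 0 (∑ i, ‖b i‖)).image hF).isBounded).subset ?_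
  rintro _ ⟨v, rfl⟩
  refine ⟨ZSpan.fract b v, mem_closedBall_zero_iff.2 (ZSpan.norm_fract_le b v), ?_⟩
  exact (hlattice _ (ZSpan.floor b v).2).sub_eq v

/-! ### The function `cd` as a quotient of even entire functions -/

theorem theta₂_theta₃_no_common_zero {τ : ℂ} (hτ : 0 < τ.im) (u : ℂ) :
    theta₂ τ u ≠ 0 ∨ theta₃ τ u ≠ 0 := by
  by_contra! h
  have hσ := differentiable_sigmaTheta hτ
  have hplus := eventually_comp_line_ne_zero hσ ⟨1, sigmaTheta_one_ne_zero hτ⟩ u one_ne_zero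
  have hminus := eventually_comp_line_ne_zero hσ ⟨1, sigmaTheta_one_ne_zero hτ⟩ u
    (neg_ne_zero.2 one_ne_zero)
  obtain ⟨z, hz, hz'⟩ := (hplus.and hminus).exists
  have hprod := theta₂_mul_theta₃_sub hτ u z
  rw [h.1, h.2, zero_mul, mul_zero, sub_zero] at hprod
  exact mul_ne_zero hz' hz (by rw [hprod, mul_one, mul_neg_one, ← sub_eq_add_neg])

theorem linearIndependent_two_tau {τ : ℂ} (hτ : 0 < τ.im) : LinearIndependent ℝ ![2, τ] := by
  rw [LinearIndependent.pair_iff]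
  intro s t h
  have ht : t = 0 := by simpa [hτ.ne'] using congrArg im h
  subst ht
  simpa using h

theorem exists_theta₂_eq_mul_theta₃ {τ : ℂ} (hτ : 0 < τ.im) (x : ℂ) :
    ∃ v, theta₂ τ v = x * theta₃ τ v := by
  by_contra! hne
  have hden (v : ℂ) : theta₂ τ v - x * theta₃ τ v ≠ 0 := sub_ne_zero.2 (hne v)
  let F : ℂ → ℂ := fun v => theta₃ τ v / (theta₂ τ v - x * theta₃ τ v)
  have hF : Differentiable ℂ F :=
    (differentiable_theta₃ hτ).div
      ((differentiable_theta₂ hτ).sub ((differentiable_theta₃ hτ).const_mul x)) hden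
  have hper_two : Function.Periodic F 2 := fun v => by
    simp only [F, ← one_add_one_eq_two, ← add_assoc, theta₂_add_one, theta₃_add_one, neg_neg]
  have hper_tau : Function.Periodic F τ := fun v => by
    simp only [F]
    rw [theta₂_add_tau, theta₃_add_tau, mul_left_comm, ← mul_sub,
      mul_div_mul_left _ _ (Complex.exp_ne_zero _)]
  let periods : PeriodPair := ⟨2, τ, linearIndependent_two_tau hτ⟩
  have hbounded : Bornology.IsBounded (Set.range F) :=
    isBounded_range_of_periodic_basis periods.basis hF.continuous
      (Fin.forall_fin_two.2 ⟨by simpa using hper_two, by simpa using hper_tau⟩)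
  have hconst := hF.apply_eq_apply_of_bounded hbounded (0 + 1) 0
  simp only [F] at hconst
  rw [div_eq_div_iff (hden _) (hden _), theta₂_add_one, theta₃_add_one] at hconst
  have hzero : 2 * (theta₂ τ 0 * theta₃ τ 0) = 0 := by linear_combination hconst
  simp [theta₂_zero_ne_zero hτ, theta₃_zero_ne_zero hτ] at hzero

/-- A presentation `cd = f / g` by even entire functions without common zeros, such that
`f(u) g(v) - f(v) g(u)` splits as `σ(u - v) σ(u + v)` with `σ` odd and entire. All identities
between values of `cd` below are consequences of this splitting. -/
structure CdSystem (τ : ℂ) (f g σ : ℂ → ℂ) : Prop where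
  cd_eq : ∀ u, cd τ u = f u / g u
  reg_iff : ∀ u, CdReg τ u ↔ g u ≠ 0
  bracket : ∀ u v, f u * g v - f v * g u = σ (u - v) * σ (u + v)
  f_neg : ∀ u, f (-u) = f u
  g_neg : ∀ u, g (-u) = g u
  σ_neg : ∀ u, σ (-u) = -σ u
  f_diff : Differentiable ℂ f
  g_diff : Differentiable ℂ g
  σ_diff : Differentiable ℂ σ
  surj : ∀ x, ∃ u, g u ≠ 0 ∧ x * g u = f u

theorem exists_cdSystem {τ : ℂ} (hτ : 0 < τ.im) : ∃ f g σ, CdSystem τ f g σ := by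
  have h₂ := theta₂_zero_ne_zero hτ
  have h₃ := theta₃_zero_ne_zero hτ
  have hscale : (Real.pi * theta₃ τ 0 ^ 2 : ℂ) ≠ 0 :=
    mul_ne_zero (by exact_mod_cast Real.pi_ne_zero) (pow_ne_zero _ h₃)
  obtain ⟨r, hr⟩ := IsAlgClosed.exists_pow_nat_eq (theta₃ τ 0 / theta₂ τ 0) two_pos
  have harg_diff : Differentiable ℂ (thetaArg τ) := differentiable_id.div_const _
  have harg_neg (u : ℂ) : thetaArg τ (-u) = -thetaArg τ u := neg_div _ _
  have harg_sub (u v : ℂ) : thetaArg τ (u - v) = thetaArg τ u - thetaArg τ v := sub_div _ _ _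
  have harg_add (u v : ℂ) : thetaArg τ (u + v) = thetaArg τ u + thetaArg τ v := add_div _ _ _
  refine ⟨fun u => theta₃ τ 0 / theta₂ τ 0 * theta₂ τ (thetaArg τ u),
    fun u => theta₃ τ (thetaArg τ u), fun u => r * sigmaTheta τ (thetaArg τ u), ?_⟩
  exact {
    cd_eq := fun u => by rw [cd, mul_div_mul_comm, mul_div_assoc]
    reg_iff := fun u => Iff.rfl
    bracket := fun u v => by
      rw [harg_sub, harg_add, mul_mul_mul_comm, ← sq, hr, ← theta₂_mul_theta₃_sub hτ]
      ring
    f_neg := fun u => by simp only [harg_neg, theta₂_neg]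
    g_neg := fun u => by simp only [harg_neg, theta₃_neg]
    σ_neg := fun u => by simp only [harg_neg, sigmaTheta_neg, mul_neg]
    f_diff := ((differentiable_theta₂ hτ).comp harg_diff).const_mul _
    g_diff := (differentiable_theta₃ hτ).comp harg_diff
    σ_diff := ((differentiable_sigmaTheta hτ).comp harg_diff).const_mul _
    surj := fun x => by
      obtain ⟨v, hv⟩ := exists_theta₂_eq_mul_theta₃ hτ (x * (theta₂ τ 0 / theta₃ τ 0))
      refine ⟨v * (Real.pi * theta₃ τ 0 ^ 2), ?_⟩
      rw [thetaArg, mul_div_cancel_right₀ _ hscale, hv]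
      refine ⟨fun h0 => ?_, by field_simp⟩
      rcases theta₂_theta₃_no_common_zero hτ v with h | h
      · exact h (by rw [hv, h0, mul_zero])
      · exact h h0 }

section

variable {τ : ℂ} {f g σ : ℂ → ℂ} (S : CdSystem τ f g σ)
include S

theorem CdSystem.exists_f_ne_zero : ∃ u, f u ≠ 0 := by
  obtain ⟨u, hg, h⟩ := S.surj 1
  exact ⟨u, by rwa [← h, one_mul]⟩

theorem CdSystem.exists_g_ne_zero : ∃ u, g u ≠ 0 := (S.surj 0).imp fun _ h => h.1

theorem CdSystem.exists_σ_ne_zero : ∃ u, σ u ≠ 0 := by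
  obtain ⟨u, hu, hfu⟩ := S.surj 0
  obtain ⟨v, hv, hfv⟩ := S.surj 1
  have h := S.bracket v u
  rw [← hfu, ← hfv, zero_mul, zero_mul, one_mul, sub_zero] at h
  exact ⟨v - u, left_ne_zero_of_mul (h ▸ mul_ne_zero hv hu)⟩

end

/-! ### The reflection `s₂` in pencil parameters -/

/-- The form `y g(a) - f(a)`, which vanishes at `y = cd a`. -/
def cdForm (f g : ℂ → ℂ) (y a : ℂ) : ℂ := y * g a - f a

/-- One of the two products, exchanged by `c₁ ↔ c₂`, in which `s₂(y)` is linear on the fibre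
`x = cd u`. -/
def s₂Product (f g σ : ℂ → ℂ) (c₁ c₂ η u y : ℂ) : ℂ :=
  σ (u - (η + c₁)) * σ (u + (η + c₁)) * cdForm f g y (η - c₂)

/-- On the fibre `x = cd u` the value `s₂(y)` has the homogeneous coordinates
`[s₂Coord f : s₂Coord g]`. -/
def s₂Coord (f g σ h : ℂ → ℂ) (c₁ c₂ η u y : ℂ) : ℂ :=
  h (2 * η - (c₁ - c₂) / 2) * s₂Product f g σ c₁ c₂ η u y -
    h (2 * η + (c₁ - c₂) / 2) * s₂Product f g σ c₂ c₁ η u y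

namespace CdSystem

variable {τ : ℂ} {f g σ : ℂ → ℂ} (S : CdSystem τ f g σ)
include S

theorem three_term (a b c d : ℂ) :
    σ (a - b) * σ (a + b) * (σ (c - d) * σ (c + d)) -
      σ (a - c) * σ (a + c) * (σ (b - d) * σ (b + d)) +
      σ (a - d) * σ (a + d) * (σ (b - c) * σ (b + c)) = 0 := by
  simp only [← S.bracket]
  ring

theorem cd_sub_cd {u v : ℂ} (hu : CdReg τ u) (hv : CdReg τ v) :
    cd τ u - cd τ v = σ (u - v) * σ (u + v) / (g u * g v) := by
  rw [S.reg_iff] at hu hv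
  rw [S.cd_eq, S.cd_eq, div_sub_div _ _ hu hv, ← S.bracket, mul_comm (g u) (f v)]

theorem cd_neg (u : ℂ) : cd τ (-u) = cd τ u := by
  rw [S.cd_eq, S.cd_eq, S.f_neg, S.g_neg]

theorem cdReg_neg (u : ℂ) : CdReg τ (-u) ↔ CdReg τ u := by
  rw [S.reg_iff, S.reg_iff, S.g_neg]

theorem one_sub_cd_div_cd {v w : ℂ} (hv : g v ≠ 0) (hw : f w ≠ 0) :
    1 - cd τ v / cd τ w = σ (w - v) * σ (w + v) / (f w * g v) := by
  rw [S.cd_eq, S.cd_eq, ← S.bracket]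
  field_simp

theorem cdQuotReg_iff {u v w : ℂ} :
    CdQuotReg τ u v w ↔
      g u ≠ 0 ∧ g v ≠ 0 ∧ g w ≠ 0 ∧ f w ≠ 0 ∧ σ (w - v) ≠ 0 ∧ σ (w + v) ≠ 0 := by
  simp only [CdQuotReg, S.reg_iff]
  refine and_congr_right fun _ => and_congr_right fun hv => and_congr_right fun hw => ?_
  have hcd : cd τ w ≠ 0 ↔ f w ≠ 0 := by rw [S.cd_eq, div_ne_zero_iff, and_iff_left hw]
  rw [hcd]
  refine and_congr_right fun hfw => ?_
  rw [S.one_sub_cd_div_cd hv hfw, div_ne_zero_iff, and_iff_left (mul_ne_zero hfw hv),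
    mul_ne_zero_iff]

theorem cdQuot_eq {u v w : ℂ} (h : CdQuotReg τ u v w) :
    cdQuot τ u v w = σ (w - u) * σ (w + u) * g v / (σ (w - v) * σ (w + v) * g u) := by
  obtain ⟨hu, hv, -, hw, -, -⟩ := S.cdQuotReg_iff.1 h
  rw [cdQuot, S.one_sub_cd_div_cd hu hw, S.one_sub_cd_div_cd hv hw]
  field_simp

theorem sub_cd {a : ℂ} (ha : CdReg τ a) (y : ℂ) : y - cd τ a = cdForm f g y a / g a := by
  rw [S.reg_iff] at ha
  rw [S.cd_eq, cdForm]
  field_simp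

theorem cdForm_mul {x u : ℂ} (hx : x * g u = f u) (a : ℂ) :
    cdForm f g x a * g u = σ (u - a) * σ (u + a) := by
  rw [← S.bracket, cdForm]
  linear_combination g a * hx

theorem cdForm_three_term (y a b c : ℂ) :
    cdForm f g y a * (σ (b - c) * σ (b + c)) - cdForm f g y b * (σ (a - c) * σ (a + c)) +
      cdForm f g y c * (σ (a - b) * σ (a + b)) = 0 := by
  simp only [← S.bracket, cdForm]
  ring

theorem s₂Const_eq {c₁ c₂ η : ℂ}
    (h₁ : CdQuotReg τ (η - c₂) (η - c₁) η) (h₂ : CdQuotReg τ (η + c₁) (η + c₂) η)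
    (h₃ : CdQuotReg τ (2 * η - (c₁ - c₂) / 2) (2 * η + (c₁ - c₂) / 2) ((c₁ + c₂) / 2)) :
    s₂Const τ c₁ c₂ η = g (η - c₁) * g (η + c₂) * g (2 * η + (c₁ - c₂) / 2) /
      (g (η - c₂) * g (η + c₁) * g (2 * η - (c₁ - c₂) / 2)) := by
  rw [s₂Const, S.cdQuot_eq h₁, S.cdQuot_eq h₂, S.cdQuot_eq h₃]
  obtain ⟨-, -, -, -, hσ₁, hσ₁'⟩ := S.cdQuotReg_iff.1 h₁
  obtain ⟨-, -, -, -, hσ₂, hσ₂'⟩ := S.cdQuotReg_iff.1 h₂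
  obtain ⟨-, -, -, -, hσ₃, hσ₃'⟩ := S.cdQuotReg_iff.1 h₃
  rw [show η - (η - c₁) = c₁ by ring, show η + (η - c₁) = 2 * η - c₁ by ring,
    show η - (η + c₂) = -c₂ by ring, show η + (η + c₂) = 2 * η + c₂ by ring,
    show (c₁ + c₂) / 2 - (2 * η + (c₁ - c₂) / 2) = -(2 * η - c₂) by ring,
    show (c₁ + c₂) / 2 + (2 * η + (c₁ - c₂) / 2) = 2 * η + c₁ by ring] at *
  rw [show η - (η - c₂) = c₂ by ring, show η + (η - c₂) = 2 * η - c₂ by ring,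
    show η - (η + c₁) = -c₁ by ring, show η + (η + c₁) = 2 * η + c₁ by ring,
    show (c₁ + c₂) / 2 - (2 * η - (c₁ - c₂) / 2) = -(2 * η - c₁) by ring,
    show (c₁ + c₂) / 2 + (2 * η - (c₁ - c₂) / 2) = 2 * η + c₂ by ring]
  simp only [S.σ_neg, neg_ne_zero] at *
  field_simp

theorem s₂Den_eq {c₁ c₂ η x y u : ℂ} (h₁ : CdReg τ (η + c₁)) (h₂ : CdReg τ (η - c₂))
    (hu : g u ≠ 0) (hx : x * g u = f u) :
    s₂Den τ c₁ c₂ η x y =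
      s₂Product f g σ c₁ c₂ η u y / (g u * g (η + c₁) * g (η - c₂)) := by
  have hg₁ := (S.reg_iff _).1 h₁
  have hg₂ := (S.reg_iff _).1 h₂
  rw [s₂Den, S.sub_cd h₁, S.sub_cd h₂, s₂Product, ← S.cdForm_mul hx]
  field_simp

theorem s₂Num_eq {c₁ c₂ η x y u : ℂ} (h : S₂Reg τ c₁ c₂ η x y) (hu : g u ≠ 0)
    (hx : x * g u = f u) :
    s₂Num τ c₁ c₂ η x y =
      g (2 * η + (c₁ - c₂) / 2) * s₂Product f g σ c₂ c₁ η u y /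
        (g u * g (η + c₁) * g (η - c₂) * g (2 * η - (c₁ - c₂) / 2)) := by
  obtain ⟨h₁, h₂, h₃, -⟩ := h
  obtain ⟨hg₁, hg₂, -⟩ := S.cdQuotReg_iff.1 h₁
  obtain ⟨hg₃, hg₄, -⟩ := S.cdQuotReg_iff.1 h₂
  obtain ⟨hg₅, -⟩ := S.cdQuotReg_iff.1 h₃
  have hDen := S.s₂Den_eq (y := y) h₂.2.1 h₁.2.1 hu hx
  have hNum : s₂Num τ c₁ c₂ η x y = s₂Const τ c₁ c₂ η * s₂Den τ c₂ c₁ η x y := mul_assoc _ _ _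
  rw [hNum, hDen, S.s₂Const_eq h₁ h₂ h₃]
  generalize g (2 * η - (c₁ - c₂) / 2) = gA at *
  field_simp

theorem s₂Y_mul_s₂Coord {c₁ c₂ η x y u : ℂ} (h : S₂Reg τ c₁ c₂ η x y) (hu : g u ≠ 0)
    (hx : x * g u = f u) :
    s₂Coord f g σ g c₁ c₂ η u y ≠ 0 ∧
      s₂Y τ c₁ c₂ η x y * s₂Coord f g σ g c₁ c₂ η u y = s₂Coord f g σ f c₁ c₂ η u y := by
  obtain ⟨hg₁, -⟩ := S.cdQuotReg_iff.1 h.2.1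
  obtain ⟨hg₂, -⟩ := S.cdQuotReg_iff.1 h.1
  obtain ⟨hgA, hgB, -⟩ := S.cdQuotReg_iff.1 h.2.2.1
  have hDen := S.s₂Den_eq (y := y) h.2.1.1 h.1.1 hu hx
  have hNum := S.s₂Num_eq h hu hx
  set K := g u * g (η + c₁) * g (η - c₂) * g (2 * η - (c₁ - c₂) / 2) with hK
  have hK0 : K ≠ 0 := mul_ne_zero (mul_ne_zero (mul_ne_zero hu hg₁) hg₂) hgA
  have hDen' : s₂Den τ c₁ c₂ η x y =
      g (2 * η - (c₁ - c₂) / 2) * s₂Product f g σ c₁ c₂ η u y / K := by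
    rw [hDen, hK, mul_comm (g (2 * η - (c₁ - c₂) / 2)), mul_div_mul_right _ _ hgA]
  have hdiff : s₂Den τ c₁ c₂ η x y - s₂Num τ c₁ c₂ η x y = s₂Coord f g σ g c₁ c₂ η u y / K := by
    rw [hDen', hNum, ← sub_div, s₂Coord]
  have hcomb : cd τ (2 * η - (c₁ - c₂) / 2) * s₂Den τ c₁ c₂ η x y -
      cd τ (2 * η + (c₁ - c₂) / 2) * s₂Num τ c₁ c₂ η x y = s₂Coord f g σ f c₁ c₂ η u y / K := by
    rw [hDen', hNum, S.cd_eq, S.cd_eq, mul_div_assoc', mul_div_assoc', ← mul_assoc, ← mul_assoc,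
      div_mul_cancel₀ _ hgA, div_mul_cancel₀ _ hgB, ← sub_div, s₂Coord]
  have hcoord : s₂Coord f g σ g c₁ c₂ η u y ≠ 0 := by
    have hne := h.2.2.2.2.2.2.2
    rw [hdiff] at hne
    exact (div_ne_zero_iff.1 hne).1
  rw [s₂Y, hcomb, hdiff, div_div_div_cancel_right₀ hK0, div_mul_cancel₀ _ hcoord]
  exact ⟨hcoord, rfl⟩

theorem s₂Coord_mul_cdForm_sub {c₁ c₂ η Y y u : ℂ}
    (hY : Y * s₂Coord f g σ g c₁ c₂ η u y = s₂Coord f g σ f c₁ c₂ η u y) :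
    s₂Coord f g σ g c₁ c₂ η u y * cdForm f g Y (η - (c₁ + c₂) / 2 - u) =
      σ (u + (η + c₁)) * σ (u + (η + c₂)) * (σ (c₂ - c₁) * σ (2 * η - c₁ - c₂)) *
        cdForm f g y (2 * η - u) := by
  have hA := S.bracket (2 * η - (c₁ - c₂) / 2) (η - (c₁ + c₂) / 2 - u)
  have hB := S.bracket (2 * η + (c₁ - c₂) / 2) (η - (c₁ + c₂) / 2 - u)
  rw [show 2 * η - (c₁ - c₂) / 2 - (η - (c₁ + c₂) / 2 - u) = u + (η + c₂) by ring,
    show 2 * η - (c₁ - c₂) / 2 + (η - (c₁ + c₂) / 2 - u) = 3 * η - c₁ - u by ring] at hA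
  rw [show 2 * η + (c₁ - c₂) / 2 - (η - (c₁ + c₂) / 2 - u) = u + (η + c₁) by ring,
    show 2 * η + (c₁ - c₂) / 2 + (η - (c₁ + c₂) / 2 - u) = 3 * η - c₂ - u by ring] at hB
  have hY₃ := S.cdForm_three_term y (η - c₁) (η - c₂) (2 * η - u)
  rw [show η - c₂ - (2 * η - u) = u - (η + c₂) by ring,
    show η - c₂ + (2 * η - u) = 3 * η - c₂ - u by ring,
    show η - c₁ - (2 * η - u) = u - (η + c₁) by ring,
    show η - c₁ + (2 * η - u) = 3 * η - c₁ - u by ring,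
    show η - c₁ - (η - c₂) = c₂ - c₁ by ring,
    show η - c₁ + (η - c₂) = 2 * η - c₁ - c₂ by ring] at hY₃
  have hexpand : s₂Coord f g σ g c₁ c₂ η u y * cdForm f g Y (η - (c₁ + c₂) / 2 - u) =
      s₂Product f g σ c₁ c₂ η u y * (σ (u + (η + c₂)) * σ (3 * η - c₁ - u)) -
        s₂Product f g σ c₂ c₁ η u y * (σ (u + (η + c₁)) * σ (3 * η - c₂ - u)) := by
    rw [← hA, ← hB, cdForm, mul_sub, ← mul_assoc, mul_comm (s₂Coord _ _ _ _ _ _ _ _ _) Y, hY,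
      s₂Coord, s₂Coord]
    ring
  rw [hexpand, s₂Product, s₂Product]
  linear_combination -σ (u + (η + c₁)) * σ (u + (η + c₂)) * hY₃

theorem s₂Coord_neg (h : ℂ → ℂ) (c₁ c₂ η u y : ℂ) :
    s₂Coord f g σ h c₁ c₂ η (-u) y = s₂Coord f g σ h c₁ c₂ η u y := by
  have hprod (a b : ℂ) : s₂Product f g σ a b η (-u) y = s₂Product f g σ a b η u y := by
    rw [s₂Product, s₂Product, show -u - (η + a) = -(u + (η + a)) by ring,
      show -u + (η + a) = -(u - (η + a)) by ring, S.σ_neg, S.σ_neg, neg_mul_neg,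
      mul_comm (σ (u + (η + a)))]
  rw [s₂Coord, s₂Coord, hprod, hprod]

/- In the pencil parameters `y - cd (2η ∓ u)` of the fibre `x = cd u`, the reflection `s₂` is a
multiplication by products of sigma functions. -/
theorem exists_cdForm_s₂Y_eq {c₁ c₂ η x y u : ℂ} (h : S₂Reg τ c₁ c₂ η x y) (hu : g u ≠ 0)
    (hx : x * g u = f u) :
    ∃ k,
      cdForm f g (s₂Y τ c₁ c₂ η x y) (η - (c₁ + c₂) / 2 - u) =
        k * (σ (u + (η + c₁)) * σ (u + (η + c₂))) * cdForm f g y (2 * η - u) ∧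
      cdForm f g (s₂Y τ c₁ c₂ η x y) (η - (c₁ + c₂) / 2 + u) =
        k * (σ (u - (η + c₁)) * σ (u - (η + c₂))) * cdForm f g y (2 * η + u) := by
  obtain ⟨hcoord, hY⟩ := S.s₂Y_mul_s₂Coord h hu hx
  have hminus := S.s₂Coord_mul_cdForm_sub hY
  have hplus := S.s₂Coord_mul_cdForm_sub (u := -u) (c₁ := c₁) (c₂ := c₂) (η := η) (y := y)
    (by rwa [S.s₂Coord_neg, S.s₂Coord_neg])
  rw [S.s₂Coord_neg, sub_neg_eq_add, sub_neg_eq_add,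
    show -u + (η + c₁) = -(u - (η + c₁)) by ring, show -u + (η + c₂) = -(u - (η + c₂)) by ring,
    S.σ_neg, S.σ_neg, neg_mul_neg] at hplus
  refine ⟨σ (c₂ - c₁) * σ (2 * η - c₁ - c₂) / s₂Coord f g σ g c₁ c₂ η u y, ?_, ?_⟩ <;>
    rw [div_mul_eq_mul_div, div_mul_eq_mul_div, eq_div_iff hcoord]
  · linear_combination hminus
  · linear_combination hplus

end CdSystem

/-! ### The word `R` -/

/-- The point reached from `p` when the reflections of a word act one after the other. -/
def run (τ : ℂ) (w : List (Fin 9)) (p : State) : State := w.foldl (fun q i => step τ i q) p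

theorem actWord_eq_run {α : Type*} (τ : ℂ) (w : List (Fin 9)) (F : State → α) (p : State) :
    actWord τ w F p = F (run τ w p) := by
  induction w generalizing p with
  | nil => rfl
  | cons i _ ih => exact ih (step τ i p)

theorem run_append (τ : ℂ) (w w' : List (Fin 9)) (p : State) :
    run τ (w ++ w') p = run τ w' (run τ w p) := List.foldl_append

theorem wordReg_append (τ : ℂ) (w w' : List (Fin 9)) (p : State) :
    WordReg τ (w ++ w') p ↔ WordReg τ w p ∧ WordReg τ w' (run τ w p) := by
  induction w generalizing p with
  | nil => simp [WordReg, run]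
  | cons i w ih =>
    rw [List.cons_append, WordReg, WordReg, ih, and_assoc]
    rfl

theorem wordReg_of_two_notMem (τ : ℂ) {w : List (Fin 9)} (hw : 2 ∉ w) (p : State) :
    WordReg τ w p := by
  induction w generalizing p with
  | nil => trivial
  | cons i w ih =>
    rw [List.mem_cons, not_or] at hw
    exact ⟨fun h => absurd h.symm hw.1, ih hw.2 _⟩

theorem wordReg_two (τ : ℂ) (p : State) :
    WordReg τ [2] p ↔ S₂Reg τ (p.c 0) (p.c 1) p.η p.x p.y := by
  simp [WordReg]

theorem run_two (τ a₁ a₂ a₃ a₄ a₅ a₆ a₇ a₈ η x y : ℂ) :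
    run τ [2] (![a₁, a₂, a₃, a₄, a₅, a₆, a₇, a₈], η, x, y) =
      (![a₁ - 3 * ((2 * η + a₁ + a₂) / 4), a₂ - 3 * ((2 * η + a₁ + a₂) / 4),
        a₃ + (2 * η + a₁ + a₂) / 4, a₄ + (2 * η + a₁ + a₂) / 4, a₅ + (2 * η + a₁ + a₂) / 4,
        a₆ + (2 * η + a₁ + a₂) / 4, a₇ + (2 * η + a₁ + a₂) / 4, a₈ + (2 * η + a₁ + a₂) / 4],
        η - (2 * η + a₁ + a₂) / 4, x, s₂Y τ a₁ a₂ η x y) := by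
  refine Prod.ext ?_ rfl
  funext j
  simp only [run, List.foldl, step, State.c, State.η]
  fin_cases j <;> simp [mul_div_assoc]

theorem run_swap_pairs (τ a₁ a₂ a₃ a₄ a₅ a₆ a₇ a₈ η x y : ℂ) :
    run τ [3, 4, 8, 3] (![a₁, a₂, a₃, a₄, a₅, a₆, a₇, a₈], η, x, y) =
      (![a₃, a₄, a₁, a₂, a₅, a₆, a₇, a₈], η, x, y) := by
  refine Prod.ext ?_ rfl
  funext j
  fin_cases j <;> rfl

theorem run_swap_halves (τ a₁ a₂ a₃ a₄ a₅ a₆ a₇ a₈ η x y : ℂ) :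
    run τ [5, 6, 4, 5, 7, 0, 6, 7, 3, 4, 8, 3, 5, 6, 4, 5]
        (![a₁, a₂, a₃, a₄, a₅, a₆, a₇, a₈], η, x, y) =
      (![a₅, a₆, a₇, a₈, a₁, a₂, a₃, a₄], η, x, y) := by
  refine Prod.ext ?_ rfl
  funext j
  fin_cases j <;> rfl

theorem RJ2_eq : RJ2 = [2] ++ ([3, 4, 8, 3] ++ ([2] ++
    ([5, 6, 4, 5, 7, 0, 6, 7, 3, 4, 8, 3, 5, 6, 4, 5] ++
      ([2] ++ ([3, 4, 8, 3] ++ ([2] ++ [1])))))) :=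
  rfl

/-- The value of `y` after the successive transformations `s₂` in the pairs of parameters of a
list. Each `s₂` adds its own quarter sum `(2η + a + b) / 4` to the parameters outside its pair and
subtracts it from `η`; `t` is the total of these shifts so far. -/
def s₂Chain (τ η x : ℂ) : List (ℂ × ℂ) → ℂ → ℂ → ℂ
  | [], _, y => y
  | (a, b) :: l, t, y =>
    s₂Chain τ η x l (t + (2 * η + a + b) / 4) (s₂Y τ (a + t) (b + t) (η - t) x y)

/-- All the transformations `s₂` in `s₂Chain` are defined. -/
def S₂ChainReg (τ η x : ℂ) : List (ℂ × ℂ) → ℂ → ℂ → Prop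
  | [], _, _ => True
  | (a, b) :: l, t, y => S₂Reg τ (a + t) (b + t) (η - t) x y ∧
    S₂ChainReg τ η x l (t + (2 * η + a + b) / 4) (s₂Y τ (a + t) (b + t) (η - t) x y)

/-- The four pairs of parameters in which the word `R` applies `s₂`. -/
def paramPairs (c : Fin 8 → ℂ) : List (ℂ × ℂ) := [(c 0, c 1), (c 2, c 3), (c 4, c 5), (c 6, c 7)]

/-- The involution `cⱼ ↦ λ / 2 - c₉₋ⱼ` of the parameters induced by `R`. -/
def reflParam (c : Fin 8 → ℂ) : Fin 8 → ℂ := fun j => (∑ i, c i) / 2 / 2 - c (Fin.rev j)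

theorem eq_vecCons_eight (c : Fin 8 → ℂ) : c = ![c 0, c 1, c 2, c 3, c 4, c 5, c 6, c 7] := by
  funext j
  fin_cases j <;> rfl

theorem run_RJ2 (τ : ℂ) (p : State) :
    run τ RJ2 p = (reflParam p.c, p.η + p.lam / 2,
      s₂Chain τ p.η p.x (paramPairs p.c) 0 p.y, p.x) := by
  obtain ⟨c, η, x, y⟩ := p
  conv_lhs => rw [eq_vecCons_eight c]
  rw [RJ2_eq]
  simp only [run_append, run_two, run_swap_pairs, run_swap_halves]
  refine Prod.ext ?_ (Prod.ext ?_ (Prod.ext ?_ rfl))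
  · funext j
    simp only [run, List.foldl, step, State.c, reflParam, Fin.sum_univ_eight]
    fin_cases j <;> simp <;> ring
  · simp only [run, List.foldl, step, State.η, State.lam, State.c, Fin.sum_univ_eight]
    ring
  · simp only [run, List.foldl, step, State.c, State.η, State.x, State.y, s₂Chain, paramPairs]
    ring_nf

theorem wordReg_RJ2_iff (τ : ℂ) (p : State) :
    WordReg τ RJ2 p ↔ S₂ChainReg τ p.η p.x (paramPairs p.c) 0 p.y := by
  obtain ⟨c, η, x, y⟩ := p
  conv_lhs => rw [eq_vecCons_eight c]
  rw [RJ2_eq]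
  simp only [wordReg_append, run_two, run_swap_pairs, run_swap_halves, wordReg_two]
  simp only [wordReg_of_two_notMem τ (w := [3, 4, 8, 3]) (by decide),
    wordReg_of_two_notMem τ (w := [5, 6, 4, 5, 7, 0, 6, 7, 3, 4, 8, 3, 5, 6, 4, 5]) (by decide),
    wordReg_of_two_notMem τ (w := [1]) (by decide), true_and, and_true]
  simp only [State.c, State.η, State.x, State.y, S₂ChainReg, paramPairs, and_true,
    Matrix.cons_val_zero, Matrix.cons_val_one]
  ring_nf

theorem sum_reflParam (c : Fin 8 → ℂ) : ∑ j, reflParam c j = ∑ j, c j := by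
  simp only [reflParam, Finset.sum_sub_distrib, Finset.sum_const, Finset.card_univ,
    Fintype.card_fin, nsmul_eq_mul, ← Fin.revPerm_apply, Equiv.sum_comp Fin.revPerm c]
  push_cast
  ring

theorem reflParam_reflParam (c : Fin 8 → ℂ) : reflParam (reflParam c) = c := by
  funext j
  rw [reflParam, sum_reflParam, reflParam, Fin.rev_rev, sub_sub_cancel]

theorem c_run_RJ2 (τ : ℂ) (p : State) : (run τ RJ2 p).c = reflParam p.c := by
  rw [run_RJ2, State.c]

theorem η_run_RJ2 (τ : ℂ) (p : State) : (run τ RJ2 p).η = p.η + p.lam / 2 := by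
  rw [run_RJ2, State.η]

theorem x_run_RJ2 (τ : ℂ) (p : State) : (run τ RJ2 p).x = xTilde τ p :=
  (actWord_eq_run τ RJ2 State.x p).symm

theorem y_run_RJ2 (τ : ℂ) (p : State) : (run τ RJ2 p).y = p.x := by
  rw [run_RJ2, State.y]

theorem lam_run_RJ2 (τ : ℂ) (p : State) : (run τ RJ2 p).lam = p.lam := by
  rw [State.lam, c_run_RJ2, sum_reflParam, State.lam]

theorem xTilde_eq_s₂Chain (τ : ℂ) (p : State) :
    xTilde τ p = s₂Chain τ p.η p.x (paramPairs p.c) 0 p.y := by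
  rw [← x_run_RJ2, run_RJ2, State.x]

theorem run_TJ2 (τ : ℂ) (p : State) : run τ TJ2 p = run τ RJ2 (run τ RJ2 p) :=
  run_append τ RJ2 RJ2 p

theorem c_run_TJ2 (τ : ℂ) (p : State) : (run τ TJ2 p).c = p.c := by
  rw [run_TJ2, c_run_RJ2, c_run_RJ2, reflParam_reflParam]

theorem η_run_TJ2 (τ : ℂ) (p : State) : (run τ TJ2 p).η = p.η + p.lam := by
  rw [run_TJ2, η_run_RJ2, η_run_RJ2, lam_run_RJ2, add_assoc, add_halves]

theorem xBar_eq (τ : ℂ) (p : State) : xBar τ p = xTilde τ (run τ RJ2 p) := by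
  rw [xBar, actWord_eq_run, run_TJ2, x_run_RJ2]

theorem yBar_eq_xTilde (τ : ℂ) : yBar τ = xTilde τ := by
  funext p
  rw [yBar, actWord_eq_run, run_TJ2, y_run_RJ2, x_run_RJ2]

theorem xTildeTilde_eq_xBar (τ : ℂ) : xTildeTilde τ = xBar τ := by
  funext p
  rw [xTildeTilde, actWord_eq_run, xBar_eq]

namespace CdSystem

variable {τ : ℂ} {f g σ : ℂ → ℂ} (S : CdSystem τ f g σ)
include S

theorem cdForm_neg (z a : ℂ) : cdForm f g z (-a) = cdForm f g z a := by
  rw [cdForm, cdForm, S.f_neg, S.g_neg]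

/- Each `s₂` multiplies the two parameters of the pencil by its own factor and moves the centre of
the pencil from `2(η - t)` to `2(η - t')`, where `t'` is the next shift. -/
theorem exists_cdForm_s₂Chain_eq {η x y t u : ℂ} {l : List (ℂ × ℂ)}
    (h : S₂ChainReg τ η x l t y) (hu : g u ≠ 0) (hx : x * g u = f u) :
    ∃ k,
      cdForm f g (s₂Chain τ η x l t y)
          (2 * (η - (t + (l.map fun c => (2 * η + c.1 + c.2) / 4).sum)) - u) =
        k * (l.map fun c => σ (u + (η + c.1)) * σ (u + (η + c.2))).prod *
          cdForm f g y (2 * (η - t) - u) ∧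
      cdForm f g (s₂Chain τ η x l t y)
          (2 * (η - (t + (l.map fun c => (2 * η + c.1 + c.2) / 4).sum)) + u) =
        k * (l.map fun c => σ (u - (η + c.1)) * σ (u - (η + c.2))).prod *
          cdForm f g y (2 * (η - t) + u) := by
  induction l generalizing t y with
  | nil => exact ⟨1, by simp [s₂Chain], by simp [s₂Chain]⟩
  | cons c l ih =>
    obtain ⟨a, b⟩ := c
    obtain ⟨h_head, h_tail⟩ := h
    obtain ⟨k, tail_sub, tail_add⟩ := ih h_tail
    obtain ⟨k', head_sub, head_add⟩ := S.exists_cdForm_s₂Y_eq h_head hu hx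
    have centre : η - t - (a + t + (b + t)) / 2 = 2 * (η - (t + (2 * η + a + b) / 4)) := by ring
    rw [centre, show η - t + (a + t) = η + a by ring, show η - t + (b + t) = η + b by ring]
      at head_sub head_add
    rw [head_sub] at tail_sub
    rw [head_add] at tail_add
    simp only [List.map_cons, List.sum_cons, List.prod_cons, ← add_assoc, s₂Chain] at *
    exact ⟨k * k', tail_sub.trans (by ring), tail_add.trans (by ring)⟩

theorem exists_cdForm_xTilde_eq {p : State} (h : WordReg τ RJ2 p) {u : ℂ} (hu : g u ≠ 0)
    (hx : p.x * g u = f u) :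
    ∃ k,
      cdForm f g (xTilde τ p) (2 * p.η + p.lam + u) =
        k * (∏ j, σ (u + (p.η + p.c j))) * cdForm f g p.y (2 * p.η - u) ∧
      cdForm f g (xTilde τ p) (2 * p.η + p.lam - u) =
        k * (∏ j, σ (u - (p.η + p.c j))) * cdForm f g p.y (2 * p.η + u) := by
  obtain ⟨k, h_sub, h_add⟩ := S.exists_cdForm_s₂Chain_eq ((wordReg_RJ2_iff τ p).1 h) hu hx
  have centre : 2 * (p.η - (0 + ((paramPairs p.c).map fun c => (2 * p.η + c.1 + c.2) / 4).sum)) =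
      -(2 * p.η + p.lam) := by
    simp only [paramPairs, List.map_cons, List.map_nil, List.sum_cons, List.sum_nil, State.lam,
      Fin.sum_univ_eight]
    ring
  rw [centre, ← neg_add', S.cdForm_neg, ← xTilde_eq_s₂Chain, sub_zero] at h_sub
  rw [centre, neg_add_eq_sub, ← neg_sub, S.cdForm_neg, ← xTilde_eq_s₂Chain, sub_zero] at h_add
  simp only [paramPairs, List.map_cons, List.map_nil, List.prod_cons, List.prod_nil] at h_sub h_add
  simp only [Fin.prod_univ_eight]
  exact ⟨k, h_sub.trans (by ring), h_add.trans (by ring)⟩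

end CdSystem

/-! ### The coefficient functions on the pencil -/

/-- The homogenization in the last variable of `pP`, so that `pForm τ a₁ a₂ a₃ b X Y 1` is
`pP τ a₁ a₂ a₃ b X Y`, written with differences of values of `cd` as factors. -/
def pForm (τ a₁ a₂ a₃ b X F E : ℂ) : ℂ :=
  (cd τ (b + a₁) - cd τ (b + a₂)) * (X - cd τ (b + a₃)) *
      ((cd τ (b - a₁) - cd τ (b - a₃)) * (cd τ (b - a₂) * E - F)) -
    (cd τ (b + a₁) - cd τ (b + a₃)) * (X - cd τ (b + a₂)) *
      ((cd τ (b - a₁) - cd τ (b - a₂)) * (cd τ (b - a₃) * E - F))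

theorem pForm_one (τ a₁ a₂ a₃ b X Y : ℂ) :
    pForm τ a₁ a₂ a₃ b X Y 1 = pP τ a₁ a₂ a₃ b X Y := by
  rw [pForm, pP]
  ring

/- Lagrange interpolation in the last variable. -/
theorem qQ_eq (τ a₁ a₂ a₃ a₄ a₅ b X : ℂ) :
    qQ τ a₁ a₂ a₃ a₄ a₅ b X =
      (cd τ (b + a₃ - a₅ / 2) - cd τ (b + a₁ + a₅ / 2)) *
        ((cd τ (b + a₄ + a₅ / 2) - cd τ (b + a₂ + a₅ / 2)) *
        (cd τ (b + a₁) - cd τ (b + a₄)) * (X - cd τ (b + a₂))) +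
      (cd τ (b + a₃ - a₅ / 2) - cd τ (b + a₂ + a₅ / 2)) *
        ((cd τ (b + a₁ + a₅ / 2) - cd τ (b + a₄ + a₅ / 2)) *
        (cd τ (b + a₂) - cd τ (b + a₄)) * (X - cd τ (b + a₁))) := by
  rw [qQ]
  ring

/-- A coefficient of `qQ` in its Lagrange interpolation: the part that depends on the node `e`
and not on the third argument of `qQ`. -/
def lagrangeWeight (g σ : ℂ → ℂ) (e e' z s b u : ℂ) : ℂ :=
  σ (z - e') * σ (2 * b + z + e' + s) * (σ (e - z) * σ (2 * b + e + z)) *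
      (σ (u - (b + e')) * σ (u + (b + e'))) /
    (g u * (g (b + e) * g (b + e + s / 2)) * (g (b + e') * g (b + e' + s / 2)) *
      (g (b + z) * g (b + z + s / 2)))

namespace CdSystem

variable {τ : ℂ} {f g σ : ℂ → ℂ} (S : CdSystem τ f g σ)
include S

theorem sub_cd_of_mul_eq {X u a : ℂ} (hu : g u ≠ 0) (hX : X * g u = f u) (ha : CdReg τ a) :
    X - cd τ a = σ (u - a) * σ (u + a) / (g u * g a) := by
  rw [S.sub_cd ha, ← S.cdForm_mul hX, mul_comm (g u), mul_div_mul_right _ _ hu]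

theorem cd_mul_g_sub_f {a : ℂ} (ha : CdReg τ a) (v : ℂ) :
    cd τ a * g v - f v = σ (a - v) * σ (a + v) / g a := by
  rw [S.reg_iff] at ha
  rw [S.cd_eq, ← S.bracket]
  field_simp

theorem cdQuot_eq_of {u v w a b c d : ℂ} (h : CdQuotReg τ u v w) (ha : w - u = a)
    (hb : w + u = b) (hc : w - v = c) (hd : w + v = d) :
    cdQuot τ u v w = σ a * σ b * g v / (σ c * σ d * g u) ∧
      g u ≠ 0 ∧ g v ≠ 0 ∧ σ c ≠ 0 ∧ σ d ≠ 0 := by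
  subst ha hb hc hd
  obtain ⟨hu, hv, -, -, hσ, hσ'⟩ := S.cdQuotReg_iff.1 h
  exact ⟨S.cdQuot_eq h, hu, hv, hσ, hσ'⟩

theorem gG_eq {a₁ a₂ a₃ a₄ b : ℂ} (h : GReg τ a₁ a₂ a₃ a₄ b) :
    g (b - a₃) ≠ 0 ∧ g (b - a₄) ≠ 0 ∧ g (b + a₃ - (a₁ + a₂ + a₃ + a₄) / 2) ≠ 0 ∧
    g (b + a₄ - (a₁ + a₂ + a₃ + a₄) / 2) ≠ 0 ∧ σ (a₂ - a₃) ≠ 0 ∧ σ (a₃ - a₁) ≠ 0 ∧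
    gG τ a₁ a₂ a₃ a₄ b =
      σ (a₂ - a₄) * σ (a₄ - a₁) * g (b - a₃) * g (b + a₃ - (a₁ + a₂ + a₃ + a₄) / 2) /
      (σ (a₂ - a₃) * σ (a₃ - a₁) * g (b - a₄) * g (b + a₄ - (a₁ + a₂ + a₃ + a₄) / 2)) := by
  obtain ⟨h₁, h₂, h₃, h₄⟩ := h
  obtain ⟨e₁, hg₁, hg₁', hσ₁, hσ₁'⟩ := S.cdQuot_eq_of h₁ (by ring : _ = a₂ - a₄)
    (by ring : _ = a₁ + 2 * a₂ + a₄) (by ring : _ = a₂ - a₃) (by ring : _ = a₁ + 2 * a₂ + a₃)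
  obtain ⟨e₂, hg₂, hg₂', hσ₂, hσ₂'⟩ := S.cdQuot_eq_of h₂ (by ring : _ = a₄ - a₁)
    (by ring : _ = 2 * b - a₁ - a₄) (by ring : _ = a₃ - a₁) (by ring : _ = 2 * b - a₁ - a₃)
  obtain ⟨e₃, hg₃, hg₃', hσ₃, hσ₃'⟩ := S.cdQuot_eq_of h₃ (by ring : _ = a₁ + 2 * a₂ + a₃)
    (by ring : _ = 2 * b + a₂ + a₄) (by ring : _ = a₁ + 2 * a₂ + a₄)
    (by ring : _ = 2 * b + a₂ + a₃)
  obtain ⟨e₄, -, -, hσ₄, hσ₄'⟩ := S.cdQuot_eq_of h₄ (by ring : _ = 2 * b - a₁ - a₃)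
    (by ring : _ = 2 * b + a₂ + a₃) (by ring : _ = 2 * b - a₁ - a₄)
    (by ring : _ = 2 * b + a₂ + a₄)
  refine ⟨hg₂', hg₂, hg₃', hg₃, hσ₁, hσ₂, ?_⟩
  rw [gG, e₁, e₂, e₃, e₄]
  generalize b + a₃ - (a₁ + a₂ + a₃ + a₄) / 2 = r₃ at *
  generalize b + a₄ - (a₁ + a₂ + a₃ + a₄) / 2 = r₄ at *
  generalize a₃ + (a₁ + a₂) / 2 = m₃ at *
  generalize a₄ + (a₁ + a₂) / 2 = m₄ at *
  generalize a₁ + 2 * a₂ + a₃ = w₃ at *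
  generalize a₁ + 2 * a₂ + a₄ = w₄ at *
  field_simp

theorem three_term_pForm (a₁ a₂ a₃ b u : ℂ) :
    σ (2 * b + a₁ + a₃) * σ (u + (b + a₂)) * (σ (2 * b - a₁ - a₂) * σ (3 * b - a₃ - u)) -
      σ (2 * b + a₁ + a₂) * σ (u + (b + a₃)) * (σ (2 * b - a₁ - a₃) * σ (3 * b - a₂ - u)) =
      σ (4 * b) * σ (a₂ - a₃) * (σ (u - (b + a₁)) * σ (u - b + a₁ + a₂ + a₃)) := by
  have h := S.three_term (2 * b + (a₃ - a₂) / 2) (a₁ + (a₂ + a₃) / 2) (2 * b + (a₂ - a₃) / 2)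
    (u - b + (a₂ + a₃) / 2)
  rw [show 2 * b + (a₃ - a₂) / 2 - (a₁ + (a₂ + a₃) / 2) = 2 * b - a₁ - a₂ by ring,
    show 2 * b + (a₃ - a₂) / 2 + (a₁ + (a₂ + a₃) / 2) = 2 * b + a₁ + a₃ by ring,
    show 2 * b + (a₂ - a₃) / 2 - (u - b + (a₂ + a₃) / 2) = 3 * b - a₃ - u by ring,
    show 2 * b + (a₂ - a₃) / 2 + (u - b + (a₂ + a₃) / 2) = u + (b + a₂) by ring,
    show 2 * b + (a₃ - a₂) / 2 - (2 * b + (a₂ - a₃) / 2) = -(a₂ - a₃) by ring,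
    show 2 * b + (a₃ - a₂) / 2 + (2 * b + (a₂ - a₃) / 2) = 4 * b by ring,
    show a₁ + (a₂ + a₃) / 2 - (u - b + (a₂ + a₃) / 2) = -(u - (b + a₁)) by ring,
    show a₁ + (a₂ + a₃) / 2 + (u - b + (a₂ + a₃) / 2) = u - b + a₁ + a₂ + a₃ by ring,
    show 2 * b + (a₃ - a₂) / 2 - (u - b + (a₂ + a₃) / 2) = 3 * b - a₂ - u by ring,
    show 2 * b + (a₃ - a₂) / 2 + (u - b + (a₂ + a₃) / 2) = u + (b + a₃) by ring,
    show a₁ + (a₂ + a₃) / 2 - (2 * b + (a₂ - a₃) / 2) = -(2 * b - a₁ - a₃) by ring,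
    show a₁ + (a₂ + a₃) / 2 + (2 * b + (a₂ - a₃) / 2) = 2 * b + a₁ + a₂ by ring] at h
  simp only [S.σ_neg] at h
  linear_combination h

theorem pForm_fibre {a₁ a₂ a₃ b X u : ℂ} (h : PReg τ a₁ a₂ a₃ b) (hu : g u ≠ 0)
    (hX : X * g u = f u) :
    pForm τ a₁ a₂ a₃ b X (f (2 * b - u)) (g (2 * b - u)) =
      σ (4 * b) * σ (a₂ - a₁) * σ (a₃ - a₁) * σ (a₂ - a₃) *
        (σ (u - (b + a₁)) * σ (u - (b + a₂)) * σ (u - (b + a₃)) * σ (u - b + a₁ + a₂ + a₃)) /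
      (g u * (g (b + a₁) * g (b - a₁)) * (g (b + a₂) * g (b - a₂)) *
        (g (b + a₃) * g (b - a₃))) := by
  obtain ⟨hp₁, hp₂, hp₃, hm₁, hm₂, hm₃⟩ := h
  rw [pForm, S.cd_sub_cd hp₁ hp₂, S.cd_sub_cd hp₁ hp₃, S.cd_sub_cd hm₁ hm₂, S.cd_sub_cd hm₁ hm₃,
    S.sub_cd_of_mul_eq hu hX hp₂, S.sub_cd_of_mul_eq hu hX hp₃, S.cd_mul_g_sub_f hm₂,
    S.cd_mul_g_sub_f hm₃]
  rw [show b + a₁ - (b + a₂) = -(a₂ - a₁) by ring, show b + a₁ - (b + a₃) = -(a₃ - a₁) by ring,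
    show b - a₁ - (b - a₂) = a₂ - a₁ by ring, show b - a₁ - (b - a₃) = a₃ - a₁ by ring,
    show b + a₁ + (b + a₂) = 2 * b + a₁ + a₂ by ring,
    show b + a₁ + (b + a₃) = 2 * b + a₁ + a₃ by ring,
    show b - a₁ + (b - a₂) = 2 * b - a₁ - a₂ by ring,
    show b - a₁ + (b - a₃) = 2 * b - a₁ - a₃ by ring,
    show b - a₂ - (2 * b - u) = u - (b + a₂) by ring,
    show b - a₃ - (2 * b - u) = u - (b + a₃) by ring,
    show b - a₂ + (2 * b - u) = 3 * b - a₂ - u by ring,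
    show b - a₃ + (2 * b - u) = 3 * b - a₃ - u by ring, S.σ_neg, S.σ_neg]
  linear_combination σ (a₂ - a₁) * σ (a₃ - a₁) * (σ (u - (b + a₂)) * σ (u - (b + a₃))) /
    (g u * (g (b + a₁) * g (b - a₁)) * (g (b + a₂) * g (b - a₂)) * (g (b + a₃) * g (b - a₃))) *
      S.three_term_pForm a₁ a₂ a₃ b u

theorem g_mul_qQ_eq {d e e' z s b X u : ℂ} (h : QReg τ e e' d z s b) (hu : g u ≠ 0)
    (hX : X * g u = f u) :
    g (b + d - s / 2) * qQ τ e e' d z s b X =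
      σ (d - e - s) * σ (2 * b + d + e) * lagrangeWeight g σ e e' z s b u -
        σ (d - e' - s) * σ (2 * b + d + e') * lagrangeWeight g σ e' e z s b u := by
  obtain ⟨hp, hp', hpz, hr, ht, ht', htz⟩ := h
  rw [qQ_eq, S.cd_sub_cd hr ht, S.cd_sub_cd hr ht', S.cd_sub_cd htz ht', S.cd_sub_cd ht htz,
    S.cd_sub_cd hp hpz, S.cd_sub_cd hp' hpz, S.sub_cd_of_mul_eq hu hX hp,
    S.sub_cd_of_mul_eq hu hX hp', lagrangeWeight, lagrangeWeight]
  rw [S.reg_iff] at hp hp' hpz hr ht ht' htz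
  rw [show b + d - s / 2 - (b + e + s / 2) = d - e - s by ring,
    show b + d - s / 2 + (b + e + s / 2) = 2 * b + d + e by ring,
    show b + d - s / 2 - (b + e' + s / 2) = d - e' - s by ring,
    show b + d - s / 2 + (b + e' + s / 2) = 2 * b + d + e' by ring,
    show b + z + s / 2 - (b + e' + s / 2) = z - e' by ring,
    show b + z + s / 2 + (b + e' + s / 2) = 2 * b + z + e' + s by ring,
    show b + e + s / 2 - (b + z + s / 2) = -(z - e) by ring,
    show b + e + s / 2 + (b + z + s / 2) = 2 * b + z + e + s by ring,
    show b + e - (b + z) = e - z by ring, show b + e + (b + z) = 2 * b + e + z by ring,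
    show b + e' - (b + z) = e' - z by ring, show b + e' + (b + z) = 2 * b + e' + z by ring,
    S.σ_neg]
  generalize b + d - s / 2 = r at *
  generalize b + e + s / 2 = t at *
  generalize b + e' + s / 2 = t' at *
  generalize b + z + s / 2 = tz at *
  field_simp
  ring

theorem three_term_numerators {d₁ d₂ d₃ d₄ s : ℂ} (hs : s = d₁ + d₂ + d₃ + d₄) (e b u : ℂ) :
    σ (u + (b + d₄)) * σ (u - b + d₁ + d₂ + d₃) * (σ (d₃ - e - s) * σ (2 * b + d₃ + e)) -
      σ (u + (b + d₃)) * σ (u - b + d₁ + d₂ + d₄) * (σ (d₄ - e - s) * σ (2 * b + d₄ + e)) =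
      -(σ (d₃ - d₄) * σ (d₁ + d₂ - 2 * b) * (σ (u - (b + e)) * σ (u + (b + e) + s))) := by
  have h := S.three_term (b + e + s / 2) ((d₃ - d₄ - d₁ - d₂) / 2 + b) (u + s / 2)
    ((d₃ - d₄ + d₁ + d₂) / 2 - b)
  rw [show b + e + s / 2 - ((d₃ - d₄ - d₁ - d₂) / 2 + b) = -(d₃ - e - s) by rw [hs]; ring,
    show b + e + s / 2 + ((d₃ - d₄ - d₁ - d₂) / 2 + b) = 2 * b + d₃ + e by rw [hs]; ring,
    show u + s / 2 - ((d₃ - d₄ + d₁ + d₂) / 2 - b) = u + (b + d₄) by rw [hs]; ring,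
    show u + s / 2 + ((d₃ - d₄ + d₁ + d₂) / 2 - b) = u - b + d₁ + d₂ + d₃ by rw [hs]; ring,
    show b + e + s / 2 - (u + s / 2) = -(u - (b + e)) by ring,
    show b + e + s / 2 + (u + s / 2) = u + (b + e) + s by ring,
    show (d₃ - d₄ - d₁ - d₂) / 2 + b - ((d₃ - d₄ + d₁ + d₂) / 2 - b) =
      -(d₁ + d₂ - 2 * b) by ring,
    show (d₃ - d₄ - d₁ - d₂) / 2 + b + ((d₃ - d₄ + d₁ + d₂) / 2 - b) = d₃ - d₄ by ring,
    show b + e + s / 2 - ((d₃ - d₄ + d₁ + d₂) / 2 - b) = 2 * b + d₄ + e by rw [hs]; ring,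
    show b + e + s / 2 + ((d₃ - d₄ + d₁ + d₂) / 2 - b) = -(d₄ - e - s) by rw [hs]; ring,
    show (d₃ - d₄ - d₁ - d₂) / 2 + b - (u + s / 2) = -(u - b + d₁ + d₂ + d₄) by rw [hs]; ring,
    show (d₃ - d₄ - d₁ - d₂) / 2 + b + (u + s / 2) = u + (b + d₃) by rw [hs]; ring] at h
  simp only [S.σ_neg] at h
  linear_combination -h

theorem three_term_lagrangeWeight (e e' z s b u : ℂ) :
    σ (2 * b + z + e' + s) * σ (2 * b + e + z) * (σ (u + (b + e) + s) * σ (u + (b + e'))) -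
      σ (2 * b + z + e + s) * σ (2 * b + e' + z) * (σ (u + (b + e') + s) * σ (u + (b + e))) =
      σ (u - (b + z)) * σ (u + 3 * b + e + e' + z + s) * (σ s * σ (e - e')) := by
  have h := S.three_term (2 * b + z + (e + e') / 2 + s / 2) ((e' - e + s) / 2)
    (u + b + (e + e') / 2 + s / 2) ((e - e' + s) / 2)
  rw [show 2 * b + z + (e + e') / 2 + s / 2 - (e' - e + s) / 2 = 2 * b + e + z by ring,
    show 2 * b + z + (e + e') / 2 + s / 2 + (e' - e + s) / 2 = 2 * b + z + e' + s by ring,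
    show u + b + (e + e') / 2 + s / 2 - (e - e' + s) / 2 = u + (b + e') by ring,
    show u + b + (e + e') / 2 + s / 2 + (e - e' + s) / 2 = u + (b + e) + s by ring,
    show 2 * b + z + (e + e') / 2 + s / 2 - (u + b + (e + e') / 2 + s / 2) =
      -(u - (b + z)) by ring,
    show 2 * b + z + (e + e') / 2 + s / 2 + (u + b + (e + e') / 2 + s / 2) =
      u + 3 * b + e + e' + z + s by ring,
    show (e' - e + s) / 2 - (e - e' + s) / 2 = -(e - e') by ring,
    show (e' - e + s) / 2 + (e - e' + s) / 2 = s by ring,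
    show 2 * b + z + (e + e') / 2 + s / 2 - (e - e' + s) / 2 = 2 * b + e' + z by ring,
    show 2 * b + z + (e + e') / 2 + s / 2 + (e - e' + s) / 2 = 2 * b + z + e + s by ring,
    show (e' - e + s) / 2 - (u + b + (e + e') / 2 + s / 2) = -(u + (b + e)) by ring,
    show (e' - e + s) / 2 + (u + b + (e + e') / 2 + s / 2) = u + (b + e') + s by ring] at h
  simp only [S.σ_neg] at h
  linear_combination h

theorem lagrangeWeight_combination (e e' z s b u : ℂ) :
    σ (u - (b + e)) * σ (u + (b + e) + s) * lagrangeWeight g σ e e' z s b u -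
        σ (u - (b + e')) * σ (u + (b + e') + s) * lagrangeWeight g σ e' e z s b u =
      σ s * σ (e - e') * (σ (u - (b + e)) * σ (u - (b + e'))) /
        (g u * (g (b + e) * g (b + e + s / 2)) * (g (b + e') * g (b + e' + s / 2))) *
      (σ (z - e') * σ (e - z) / (g (b + z) * g (b + z + s / 2))) *
      (σ (u - (b + z)) * σ (u + 3 * b + e + e' + z + s)) := by
  have hz : σ (z - e) * σ (e' - z) = σ (z - e') * σ (e - z) := by
    rw [← neg_sub e z, ← neg_sub z e', S.σ_neg, S.σ_neg]
    ring
  rw [lagrangeWeight, lagrangeWeight]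
  set G := g (b + e) * g (b + e + s / 2)
  set G' := g (b + e') * g (b + e' + s / 2)
  set Gz := g (b + z) * g (b + z + s / 2)
  linear_combination σ (z - e') * σ (e - z) * (σ (u - (b + e)) * σ (u - (b + e'))) /
      (g u * G * G' * Gz) * S.three_term_lagrangeWeight e e' z s b u -
    σ (u - (b + e)) * σ (u - (b + e')) * (σ (u + (b + e') + s) * σ (u + (b + e))) *
      (σ (2 * b + z + e + s) * σ (2 * b + e' + z)) / (g u * G * G' * Gz) * hz

end CdSystem

/-! ### The first equation off the branch locus -/

/-- The common numerator of the two terms of `mixN`, with `pP` homogenized to `pForm`. -/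
def mixForm (τ d₁ d₂ d₃ d₄ d₅ d₆ z s b X F E : ℂ) : ℂ :=
  gG τ d₁ d₂ d₃ d₄ b * (X - cd τ (b + d₄)) * qQ τ d₅ d₆ d₃ z s b X * pForm τ d₁ d₂ d₃ b X F E -
    (X - cd τ (b + d₃)) * qQ τ d₅ d₆ d₄ z s b X * pForm τ d₁ d₂ d₄ b X F E

/-- All terms of the coefficients of `mixForm` are defined. -/
structure MixFormReg (τ d₁ d₂ d₃ d₄ d₅ d₆ z s b : ℂ) : Prop where
  q₃ : QReg τ d₅ d₆ d₃ z s b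
  q₄ : QReg τ d₅ d₆ d₄ z s b
  p₄ : PReg τ d₁ d₂ d₄ b
  p₃ : PReg τ d₁ d₂ d₃ b
  gG : GReg τ d₁ d₂ d₃ d₄ b

theorem mixFormReg_iff {τ d₁ d₂ d₃ d₄ d₅ d₆ z s b : ℂ} :
    MixFormReg τ d₁ d₂ d₃ d₄ d₅ d₆ z s b ↔ QReg τ d₅ d₆ d₃ z s b ∧ QReg τ d₅ d₆ d₄ z s b ∧
      PReg τ d₁ d₂ d₄ b ∧ PReg τ d₁ d₂ d₃ b ∧ GReg τ d₁ d₂ d₃ d₄ b :=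
  ⟨fun h => ⟨h.q₃, h.q₄, h.p₄, h.p₃, h.gG⟩, fun ⟨h₁, h₂, h₃, h₄, h₅⟩ => ⟨h₁, h₂, h₃, h₄, h₅⟩⟩

theorem MixNReg.mixFormReg {τ d₁ d₂ d₃ d₄ d₅ d₆ z s b X Y : ℂ}
    (h : MixNReg τ d₁ d₂ d₃ d₄ d₅ d₆ z s b X Y) : MixFormReg τ d₁ d₂ d₃ d₄ d₅ d₆ z s b :=
  ⟨h.1, h.2.1, h.2.2.1, h.2.2.2.1, h.2.2.2.2.1⟩

/-- The factor of `mixForm` that depends on `z` but not on the point of the pencil. -/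
def mixFactor (g σ : ℂ → ℂ) (d₅ d₆ z s b : ℂ) : ℂ :=
  σ (z - d₆) * σ (d₅ - z) / (g (b + z) * g (b + z + s / 2))

/-- The factor of `mixForm` that does not depend on `z`. -/
def mixConst (g σ : ℂ → ℂ) (d₁ d₂ d₃ d₄ d₅ d₆ s b u : ℂ) : ℂ :=
  σ (4 * b) * σ (d₂ - d₁) * σ (d₂ - d₄) * σ (d₄ - d₁) /
      (g u ^ 2 * (g (b + d₁) * g (b - d₁)) * (g (b + d₂) * g (b - d₂)) * g (b + d₃) *
        (g (b + d₄) * g (b - d₄)) * g (b + d₄ - s / 2)) *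
    (σ (d₃ - d₄) * σ (d₁ + d₂ - 2 * b) * σ s * σ (d₅ - d₆) /
      (g u * (g (b + d₅) * g (b + d₅ + s / 2)) * (g (b + d₆) * g (b + d₆ + s / 2))))

/-- The sigma product with zeros at `u = -(b + a)` for the entries `a` of a list. -/
def sigmaProd (σ : ℂ → ℂ) (b : ℂ) (as : List ℂ) (u : ℂ) : ℂ :=
  (as.map fun a => σ (u + (b + a))).prod

theorem mixForm_one_mul (τ d₁ d₂ d₃ d₄ d₅ d₆ z s b X y F E F' E' : ℂ) :
    mixForm τ d₁ d₂ d₃ d₄ d₅ d₆ z s b X y 1 * (F * E' - F' * E) =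
      mixForm τ d₁ d₂ d₃ d₄ d₅ d₆ z s b X F E * (y * E' - F') -
      mixForm τ d₁ d₂ d₃ d₄ d₅ d₆ z s b X F' E' * (y * E - F) := by
  simp only [mixForm, pForm]
  ring

theorem mixN_eq_mixForm_div {τ d₁ d₂ d₃ d₄ d₅ d₆ z s b X y : ℂ}
    (h : MixNReg τ d₁ d₂ d₃ d₄ d₅ d₆ z s b X y) :
    mixN τ d₁ d₂ d₃ d₄ d₅ d₆ z s b X y =
      mixForm τ d₁ d₂ d₃ d₄ d₅ d₆ z s b X y 1 /
        (gG τ d₁ d₂ d₃ d₄ b * (X - cd τ (b + d₄)) * pP τ d₁ d₂ d₃ b X y * pP τ d₁ d₂ d₄ b X y) := by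
  obtain ⟨-, -, -, -, -, hP₄, hP₃, hG, -, -, hX⟩ := h
  rw [mixN, mixForm, pForm_one, pForm_one, linQuot]
  field_simp

/-- The points at which `R` is defined and all terms of the first equation, with `R(x)` in place
of `ȳ`, make sense. -/
def FirstDomain (τ : ℂ) : Set State :=
  {p | WordReg τ RJ2 p ∧
    MSYFirstReg τ (p.c 0) (p.c 1) (p.c 2) (p.c 3) (p.c 4) (p.c 5) (p.c 6) (p.c 7)
      p.η p.lam p.x p.y (xTilde τ p)}

namespace CdSystem

variable {τ : ℂ} {f g σ : ℂ → ℂ} (S : CdSystem τ f g σ)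
include S

theorem qQ_combination {d₁ d₂ d₃ d₄ d₅ d₆ z s b X u : ℂ} (hs : s = d₁ + d₂ + d₃ + d₄)
    (h₃ : QReg τ d₅ d₆ d₃ z s b) (h₄ : QReg τ d₅ d₆ d₄ z s b) (hu : g u ≠ 0)
    (hX : X * g u = f u) :
    σ (u + (b + d₄)) * σ (u - b + d₁ + d₂ + d₃) * (g (b + d₃ - s / 2) * qQ τ d₅ d₆ d₃ z s b X) -
      σ (u + (b + d₃)) * σ (u - b + d₁ + d₂ + d₄) *
        (g (b + d₄ - s / 2) * qQ τ d₅ d₆ d₄ z s b X) =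
    -(σ (d₃ - d₄) * σ (d₁ + d₂ - 2 * b)) *
      (σ s * σ (d₅ - d₆) * (σ (u - (b + d₅)) * σ (u - (b + d₆))) /
        (g u * (g (b + d₅) * g (b + d₅ + s / 2)) * (g (b + d₆) * g (b + d₆ + s / 2))) *
      mixFactor g σ d₅ d₆ z s b * (σ (u - (b + z)) * σ (u + 3 * b + d₅ + d₆ + z + s))) := by
  rw [S.g_mul_qQ_eq h₃ hu hX, S.g_mul_qQ_eq h₄ hu hX, mixFactor,
    ← S.lagrangeWeight_combination d₅ d₆ z s b u]
  linear_combination lagrangeWeight g σ d₅ d₆ z s b u * S.three_term_numerators hs d₅ b u -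
    lagrangeWeight g σ d₆ d₅ z s b u * S.three_term_numerators hs d₆ b u

theorem gG_mul_pForm_fibre {a₁ a₂ a₃ a₄ b X u : ℂ} (hG : GReg τ a₁ a₂ a₃ a₄ b)
    (hP : PReg τ a₁ a₂ a₃ b) (hu : g u ≠ 0) (hX : X * g u = f u) :
    gG τ a₁ a₂ a₃ a₄ b * pForm τ a₁ a₂ a₃ b X (f (2 * b - u)) (g (2 * b - u)) =
      σ (4 * b) * σ (a₂ - a₁) * σ (a₂ - a₄) * σ (a₄ - a₁) *
        (σ (u - (b + a₁)) * σ (u - (b + a₂)) * σ (u - (b + a₃)) * σ (u - b + a₁ + a₂ + a₃)) *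
        g (b + a₃ - (a₁ + a₂ + a₃ + a₄) / 2) /
      (g u * (g (b + a₁) * g (b - a₁)) * (g (b + a₂) * g (b - a₂)) *
        (g (b + a₃) * g (b - a₄)) * g (b + a₄ - (a₁ + a₂ + a₃ + a₄) / 2)) := by
  obtain ⟨hg₃, -, -, -, hσ, hσ', hgG⟩ := S.gG_eq hG
  rw [hgG, S.pForm_fibre hP hu hX]
  calc _ = σ (a₂ - a₃) * σ (a₃ - a₁) * g (b - a₃) * (σ (4 * b) * σ (a₂ - a₁) * σ (a₂ - a₄) *
        σ (a₄ - a₁) *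
        (σ (u - (b + a₁)) * σ (u - (b + a₂)) * σ (u - (b + a₃)) * σ (u - b + a₁ + a₂ + a₃)) *
        g (b + a₃ - (a₁ + a₂ + a₃ + a₄) / 2)) / (σ (a₂ - a₃) * σ (a₃ - a₁) * g (b - a₃) *
        (g u * (g (b + a₁) * g (b - a₁)) * (g (b + a₂) * g (b - a₂)) *
        (g (b + a₃) * g (b - a₄)) * g (b + a₄ - (a₁ + a₂ + a₃ + a₄) / 2))) := by
        rw [div_mul_div_comm]
        congr 1 <;> ring
    _ = _ := mul_div_mul_left _ _ (mul_ne_zero (mul_ne_zero hσ hσ') hg₃)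

theorem mixForm_fibre_sub {d₁ d₂ d₃ d₄ d₅ d₆ z s b X u : ℂ} (hs : s = d₁ + d₂ + d₃ + d₄)
    (h : MixFormReg τ d₁ d₂ d₃ d₄ d₅ d₆ z s b) (hu : g u ≠ 0) (hX : X * g u = f u) :
    mixForm τ d₁ d₂ d₃ d₄ d₅ d₆ z s b X (f (2 * b - u)) (g (2 * b - u)) =
      mixConst g σ d₁ d₂ d₃ d₄ d₅ d₆ s b u * mixFactor g σ d₅ d₆ z s b *
        (sigmaProd σ b [d₁, d₂, d₃, d₄, d₅, d₆, z] (-u) * σ (u + (3 * b + d₅ + d₆ + z + s))) := by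
  have hcomb := S.qQ_combination hs h.q₃ h.q₄ hu hX
  obtain ⟨-, -, -, hr₄, -⟩ := S.gG_eq h.gG
  have hq₄ : qQ τ d₅ d₆ d₄ z s b X =
      g (b + d₄ - s / 2) * qQ τ d₅ d₆ d₄ z s b X / g (b + d₄ - s / 2) :=
    (mul_div_cancel_left₀ _ (hs ▸ hr₄)).symm
  have hgP := S.gG_mul_pForm_fibre h.gG h.p₃ hu hX
  rw [← hs] at hgP
  have hsplit : mixForm τ d₁ d₂ d₃ d₄ d₅ d₆ z s b X (f (2 * b - u)) (g (2 * b - u)) =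
      (X - cd τ (b + d₄)) * qQ τ d₅ d₆ d₃ z s b X *
        (gG τ d₁ d₂ d₃ d₄ b * pForm τ d₁ d₂ d₃ b X (f (2 * b - u)) (g (2 * b - u))) -
      (X - cd τ (b + d₃)) * qQ τ d₅ d₆ d₄ z s b X *
        pForm τ d₁ d₂ d₄ b X (f (2 * b - u)) (g (2 * b - u)) := by
    rw [mixForm]
    ring
  have hneg (a : ℂ) : σ (-u + a) = -σ (u - a) := by
    rw [← S.σ_neg, neg_sub, neg_add_eq_sub]
  rw [hsplit, hgP, hq₄, S.pForm_fibre h.p₄ hu hX, S.sub_cd_of_mul_eq hu hX h.p₃.2.2.1,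
    S.sub_cd_of_mul_eq hu hX h.p₄.2.2.1, mixConst,
    show u + (3 * b + d₅ + d₆ + z + s) = u + 3 * b + d₅ + d₆ + z + s by ring]
  simp only [sigmaProd, List.map_cons, List.map_nil, List.prod_cons, List.prod_nil, hneg]
  linear_combination σ (4 * b) * σ (d₂ - d₁) * σ (d₂ - d₄) * σ (d₄ - d₁) /
      (g u ^ 2 * (g (b + d₁) * g (b - d₁)) * (g (b + d₂) * g (b - d₂)) * g (b + d₃) *
        (g (b + d₄) * g (b - d₄)) * g (b + d₄ - s / 2)) *
    (σ (u - (b + d₁)) * σ (u - (b + d₂)) * σ (u - (b + d₃)) * σ (u - (b + d₄))) * hcomb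

theorem mixForm_fibre_add {d₁ d₂ d₃ d₄ d₅ d₆ z s b X u : ℂ} (hs : s = d₁ + d₂ + d₃ + d₄)
    (h : MixFormReg τ d₁ d₂ d₃ d₄ d₅ d₆ z s b) (hu : g u ≠ 0) (hX : X * g u = f u) :
    mixForm τ d₁ d₂ d₃ d₄ d₅ d₆ z s b X (f (2 * b + u)) (g (2 * b + u)) =
      -(mixConst g σ d₁ d₂ d₃ d₄ d₅ d₆ s b u * mixFactor g σ d₅ d₆ z s b *
        (sigmaProd σ b [d₁, d₂, d₃, d₄, d₅, d₆, z] u * σ (u - (3 * b + d₅ + d₆ + z + s)))) := by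
  have hsub := S.mixForm_fibre_sub (u := -u) hs h (by rwa [S.g_neg]) (by rwa [S.g_neg, S.f_neg])
  rw [sub_neg_eq_add, neg_neg,
    show -u + (3 * b + d₅ + d₆ + z + s) = -(u - (3 * b + d₅ + d₆ + z + s)) by ring,
    S.σ_neg] at hsub
  have hconst : mixConst g σ d₁ d₂ d₃ d₄ d₅ d₆ s b (-u) =
      mixConst g σ d₁ d₂ d₃ d₄ d₅ d₆ s b u := by
    rw [mixConst, mixConst, S.g_neg]
  rw [hsub, hconst]
  ring

theorem mixForm_one_fibre {d₁ d₂ d₃ d₄ d₅ d₆ z s b X u : ℂ} (hs : s = d₁ + d₂ + d₃ + d₄)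
    (h : MixFormReg τ d₁ d₂ d₃ d₄ d₅ d₆ z s b) (hu : g u ≠ 0) (hX : X * g u = f u) (y : ℂ) :
    mixForm τ d₁ d₂ d₃ d₄ d₅ d₆ z s b X y 1 * (σ (2 * u) * σ (4 * b)) =
      -(mixConst g σ d₁ d₂ d₃ d₄ d₅ d₆ s b u * mixFactor g σ d₅ d₆ z s b) *
      (sigmaProd σ b [d₁, d₂, d₃, d₄, d₅, d₆, z] u * σ (u - (3 * b + d₅ + d₆ + z + s)) *
          cdForm f g y (2 * b - u) +
        sigmaProd σ b [d₁, d₂, d₃, d₄, d₅, d₆, z] (-u) * σ (u + (3 * b + d₅ + d₆ + z + s)) *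
          cdForm f g y (2 * b + u)) := by
  have hone := mixForm_one_mul τ d₁ d₂ d₃ d₄ d₅ d₆ z s b X y (f (2 * b + u)) (g (2 * b + u))
    (f (2 * b - u)) (g (2 * b - u))
  rw [S.bracket, S.mixForm_fibre_sub hs h hu hX, S.mixForm_fibre_add hs h hu hX,
    show 2 * b + u - (2 * b - u) = 2 * u by ring,
    show 2 * b + u + (2 * b - u) = 4 * b by ring] at hone
  rw [hone, cdForm, cdForm]
  ring

/- The hypotheses on `Y` say that it is the image of `y` under the product of the four reflections
`s₂` in `R`; the three-term identity for `cdForm` then eliminates `y`. -/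
theorem mixForm_one_mul_sigma {d₁ d₂ d₃ d₄ d₅ d₆ z w s b l X u y Y k : ℂ}
    (hs : s = d₁ + d₂ + d₃ + d₄) (hl : l = (d₁ + d₂ + d₃ + d₄ + d₅ + d₆ + z + w) / 2)
    (h : MixFormReg τ d₁ d₂ d₃ d₄ d₅ d₆ z s b) (hu : g u ≠ 0) (hX : X * g u = f u)
    (hadd : cdForm f g Y (2 * b + l + u) =
      k * sigmaProd σ b [d₁, d₂, d₃, d₄, d₅, d₆, z, w] u * cdForm f g y (2 * b - u))
    (hsub : cdForm f g Y (2 * b + l - u) =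
      k * sigmaProd σ b [d₁, d₂, d₃, d₄, d₅, d₆, z, w] (-u) * cdForm f g y (2 * b + u)) :
    k * (σ (u - (b + w)) * σ (u + (b + w))) *
        (mixForm τ d₁ d₂ d₃ d₄ d₅ d₆ z s b X y 1 * (σ (2 * u) * σ (4 * b))) =
      mixConst g σ d₁ d₂ d₃ d₄ d₅ d₆ s b u * mixFactor g σ d₅ d₆ z s b *
        (cdForm f g Y (b - w + l) * (σ (2 * u) * σ (4 * b + 2 * l))) := by
  have hprod (v : ℂ) : sigmaProd σ b [d₁, d₂, d₃, d₄, d₅, d₆, z, w] v =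
      sigmaProd σ b [d₁, d₂, d₃, d₄, d₅, d₆, z] v * σ (v + (b + w)) := by
    simp only [sigmaProd, List.map_cons, List.map_nil, List.prod_cons, List.prod_nil]
    ring
  rw [hprod] at hadd hsub
  have h3 := S.cdForm_three_term Y (b - w + l) (2 * b + l - u) (2 * b + l + u)
  rw [show 2 * b + l - u - (2 * b + l + u) = -(2 * u) by ring,
    show 2 * b + l - u + (2 * b + l + u) = 4 * b + 2 * l by ring,
    show b - w + l - (2 * b + l + u) = -(u + (b + w)) by ring,
    show b - w + l + (2 * b + l + u) = u + (3 * b + d₅ + d₆ + z + s) by rw [hs, hl]; ring,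
    show b - w + l - (2 * b + l - u) = u - (b + w) by ring,
    show b - w + l + (2 * b + l - u) = -(u - (3 * b + d₅ + d₆ + z + s)) by rw [hs, hl]; ring,
    hadd, hsub, show -u + (b + w) = -(u - (b + w)) by ring, S.σ_neg, S.σ_neg, S.σ_neg,
    S.σ_neg] at h3
  rw [S.mixForm_one_fibre hs h hu hX]
  linear_combination mixConst g σ d₁ d₂ d₃ d₄ d₅ d₆ s b u * mixFactor g σ d₅ d₆ z s b * h3

theorem cdForm_mul_mixForm_cross {d₁ d₂ d₃ d₄ d₅ d₆ z w s b l X u y Y k : ℂ}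
    (hs : s = d₁ + d₂ + d₃ + d₄) (hl : l = (d₁ + d₂ + d₃ + d₄ + d₅ + d₆ + z + w) / 2)
    (hz : MixFormReg τ d₁ d₂ d₃ d₄ d₅ d₆ z s b) (hw : MixFormReg τ d₁ d₂ d₃ d₄ d₅ d₆ w s b)
    (hu : g u ≠ 0) (hX : X * g u = f u)
    (hadd : cdForm f g Y (2 * b + l + u) =
      k * sigmaProd σ b [d₁, d₂, d₃, d₄, d₅, d₆, z, w] u * cdForm f g y (2 * b - u))
    (hsub : cdForm f g Y (2 * b + l - u) =
      k * sigmaProd σ b [d₁, d₂, d₃, d₄, d₅, d₆, z, w] (-u) * cdForm f g y (2 * b + u))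
    (h₂ : σ (2 * u) ≠ 0) (h₄ : σ (4 * b) ≠ 0) (hl₄ : σ (4 * b + 2 * l) ≠ 0)
    (hY : cdForm f g Y (b - z + l) ≠ 0)
    (hform : mixForm τ d₁ d₂ d₃ d₄ d₅ d₆ w s b X y 1 ≠ 0) :
    cdForm f g Y (b - w + l) * (σ (u - (b + z)) * σ (u + (b + z))) *
        mixForm τ d₁ d₂ d₃ d₄ d₅ d₆ w s b X y 1 * mixFactor g σ d₅ d₆ z s b =
      cdForm f g Y (b - z + l) * (σ (u - (b + w)) * σ (u + (b + w))) *
        mixForm τ d₁ d₂ d₃ d₄ d₅ d₆ z s b X y 1 * mixFactor g σ d₅ d₆ w s b := by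
  have hswap (v : ℂ) : sigmaProd σ b [d₁, d₂, d₃, d₄, d₅, d₆, z, w] v =
      sigmaProd σ b [d₁, d₂, d₃, d₄, d₅, d₆, w, z] v := by
    simp only [sigmaProd, List.map_cons, List.map_nil, List.prod_cons, List.prod_nil]
    ring
  have hatz := S.mixForm_one_mul_sigma hs hl hz hu hX hadd hsub
  rw [hswap] at hadd hsub
  have hatw := S.mixForm_one_mul_sigma hs (by rw [hl]; ring) hw hu hX hadd hsub
  have hfactor :
      mixConst g σ d₁ d₂ d₃ d₄ d₅ d₆ s b u * mixFactor g σ d₅ d₆ w s b ≠ 0 := by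
    intro hzero
    have hval := S.mixForm_one_fibre hs hw hu hX y
    rw [hzero, neg_zero, zero_mul] at hval
    exact mul_ne_zero hform (mul_ne_zero h₂ h₄) hval
  have hk : k ≠ 0 := by
    rintro rfl
    rw [zero_mul, zero_mul] at hatw
    exact mul_ne_zero hfactor (mul_ne_zero hY (mul_ne_zero h₂ hl₄)) hatw.symm
  refine mul_left_cancel₀ (mul_ne_zero hk (mul_ne_zero h₂ h₄)) ?_
  linear_combination cdForm f g Y (b - w + l) * mixFactor g σ d₅ d₆ z s b * hatw -
    cdForm f g Y (b - z + l) * mixFactor g σ d₅ d₆ w s b * hatz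

theorem firstConst_eq {c₁ c₂ c₃ c₄ c₅ c₆ c₇ c₈ η l s : ℂ}
    (hs : s = c₁ + c₂ + c₃ + c₄) (hl : l = (c₁ + c₂ + c₃ + c₄ + c₅ + c₆ + c₇ + c₈) / 2)
    (h₁ : CdQuotReg τ (η - c₈ + l) (η - c₇ + l) (3 * η + c₆ + l))
    (h₂ : CdQuotReg τ (2 * η + (c₇ - c₈) / 2 + l) (2 * η - (c₇ - c₈) / 2 + l)
      (c₆ + (c₇ + c₈) / 2 - l))
    (h₃ : CdQuotReg τ (2 * η - (c₇ - c₈) / 2 + l) (2 * η + (c₇ - c₈) / 2 + l)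
      (2 * η + c₆ - (c₇ + c₈) / 2 + l))
    (h₄ : CdQuotReg τ (η + c₈ + s / 2) (η + c₇ + s / 2) (η + c₅ + s / 2)) :
    (g (η - c₈ + l) ≠ 0 ∧ g (η - c₇ + l) ≠ 0 ∧ g (η + c₈ + s / 2) ≠ 0 ∧ g (η + c₇ + s / 2) ≠ 0 ∧
      σ (c₆ - c₇) ≠ 0 ∧ σ (c₅ - c₇) ≠ 0) ∧
    cdQuot τ (η - c₈ + l) (η - c₇ + l) (3 * η + c₆ + l) *
        cdQuot τ (2 * η + (c₇ - c₈) / 2 + l) (2 * η - (c₇ - c₈) / 2 + l)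
          (c₆ + (c₇ + c₈) / 2 - l) *
        cdQuot τ (2 * η - (c₇ - c₈) / 2 + l) (2 * η + (c₇ - c₈) / 2 + l)
          (2 * η + c₆ - (c₇ + c₈) / 2 + l) *
        cdQuot τ (η + c₈ + s / 2) (η + c₇ + s / 2) (η + c₅ + s / 2) =
      σ (c₆ - c₈) * σ (c₅ - c₈) * g (η + c₇ + s / 2) * g (η - c₇ + l) /
        (σ (c₆ - c₇) * σ (c₅ - c₇) * g (η + c₈ + s / 2) * g (η - c₈ + l)) := by
  obtain ⟨e₁, hg₁, hg₁', hσ₁, hσ₁'⟩ := S.cdQuot_eq_of h₁ (by ring : _ = 2 * η + c₆ + c₈)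
    (by ring : _ = 4 * η + c₆ - c₈ + 2 * l) (by ring : _ = 2 * η + c₆ + c₇)
    (by ring : _ = 4 * η + c₆ - c₇ + 2 * l)
  obtain ⟨e₂, hg₂, hg₂', hσ₂, hσ₂'⟩ := S.cdQuot_eq_of h₂
    (by rw [hs, hl]; ring : _ = -(2 * η + c₅ + c₇ + s)) (by ring : _ = 2 * η + c₆ + c₇)
    (by rw [hs, hl]; ring : _ = -(2 * η + c₅ + c₈ + s)) (by ring : _ = 2 * η + c₆ + c₈)
  obtain ⟨e₃, -, -, hσ₃, hσ₃'⟩ := S.cdQuot_eq_of h₃ (by ring : _ = c₆ - c₈)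
    (by ring : _ = 4 * η + c₆ - c₇ + 2 * l) (by ring : _ = c₆ - c₇)
    (by ring : _ = 4 * η + c₆ - c₈ + 2 * l)
  obtain ⟨e₄, hg₄, hg₄', hσ₄, hσ₄'⟩ := S.cdQuot_eq_of h₄ (by ring : _ = c₅ - c₈)
    (by ring : _ = 2 * η + c₅ + c₈ + s) (by ring : _ = c₅ - c₇)
    (by ring : _ = 2 * η + c₅ + c₇ + s)
  refine ⟨⟨hg₁, hg₁', hg₄, hg₄', hσ₃, hσ₄⟩, ?_⟩
  rw [e₁, e₂, e₃, e₄]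
  simp only [S.σ_neg, neg_ne_zero] at *
  clear e₁ e₂ e₃ e₄ h₁ h₂ h₃ h₄
  generalize 2 * η + c₆ + c₇ = r₁ at *
  generalize 2 * η + c₆ + c₈ = r₂ at *
  generalize 4 * η + c₆ - c₇ + 2 * l = r₃ at *
  generalize 4 * η + c₆ - c₈ + 2 * l = r₄ at *
  generalize 2 * η + c₅ + c₇ + s = r₅ at *
  generalize 2 * η + c₅ + c₈ + s = r₆ at *
  generalize 2 * η - (c₇ - c₈) / 2 + l = r₇ at *
  generalize 2 * η + (c₇ - c₈) / 2 + l = r₈ at *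
  generalize η + c₇ + s / 2 = r₉ at *
  generalize η + c₈ + s / 2 = r₁₀ at *
  field_simp

theorem exists_cdForm_xTilde_eq_sigmaProd {p : State} {u : ℂ} (h : WordReg τ RJ2 p) (hu : g u ≠ 0)
    (hx : p.x * g u = f u) :
    ∃ k, cdForm f g (xTilde τ p) (2 * p.η + p.lam + u) =
        k * sigmaProd σ p.η (List.ofFn p.c) u * cdForm f g p.y (2 * p.η - u) ∧
      cdForm f g (xTilde τ p) (2 * p.η + p.lam - u) =
        k * sigmaProd σ p.η (List.ofFn p.c) (-u) * cdForm f g p.y (2 * p.η + u) := by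
  obtain ⟨k, hadd, hsub⟩ := S.exists_cdForm_xTilde_eq h hu hx
  have hneg (a : ℂ) : σ (-u + a) = -σ (u - a) := by
    rw [← S.σ_neg, neg_sub, neg_add_eq_sub]
  refine ⟨k, ?_, ?_⟩
  · rw [hadd, sigmaProd, List.map_ofFn, List.prod_ofFn]
    rfl
  · rw [hsub, sigmaProd, List.map_ofFn, List.prod_ofFn]
    simp only [Function.comp_apply, hneg, Finset.prod_neg, Finset.card_univ, Fintype.card_fin]
    norm_num

theorem msyFirst_of_σ_ne_zero {p : State} {u : ℂ} (h : p ∈ FirstDomain τ) (hu : g u ≠ 0)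
    (hx : p.x * g u = f u) (h₂ : σ (2 * u) ≠ 0) (h₄ : σ (4 * p.η) ≠ 0)
    (hl₄ : σ (4 * p.η + 2 * p.lam) ≠ 0) :
    MSYFirst τ (p.c 0) (p.c 1) (p.c 2) (p.c 3) (p.c 4) (p.c 5) (p.c 6) (p.c 7)
      p.η p.lam p.x p.y (xTilde τ p) := by
  obtain ⟨hword, ⟨hY₈, hY₇, hY⟩, ⟨hx₇, hx₈, hx₈'⟩, hq₁, hq₂, hq₃, hq₄, hN₇, hN₈, hN⟩ := h
  obtain ⟨k, hadd, hsub⟩ := S.exists_cdForm_xTilde_eq_sigmaProd hword hu hx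
  have hl : p.lam = (p.c 0 + p.c 1 + p.c 2 + p.c 3 + p.c 4 + p.c 5 + p.c 6 + p.c 7) / 2 := by
    rw [State.lam, Fin.sum_univ_eight]
  obtain ⟨⟨hg₈, hg₇, hr₈, hr₇, hσ₆, hσ₅⟩, hconst⟩ := S.firstConst_eq rfl hl hq₁ hq₂ hq₃ hq₄
  rw [mixN_eq_mixForm_div hN₈] at hN
  obtain ⟨hform, hden⟩ := div_ne_zero_iff.1 hN
  rw [S.sub_cd hY₇] at hY
  rw [S.sub_cd_of_mul_eq hu hx hx₈] at hx₈'
  have hcross := S.cdForm_mul_mixForm_cross rfl hl hN₇.mixFormReg hN₈.mixFormReg hu hx hadd hsub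
    h₂ h₄ hl₄ (div_ne_zero_iff.1 hY).1 hform
  rw [MSYFirst, hconst, mixN_eq_mixForm_div hN₇, mixN_eq_mixForm_div hN₈,
    div_div_div_cancel_right₀ hden, linQuot, linQuot, S.sub_cd hY₇, S.sub_cd hY₈,
    S.sub_cd_of_mul_eq hu hx hx₇, S.sub_cd_of_mul_eq hu hx hx₈]
  rw [mixFactor, mixFactor, ← neg_sub (p.c 5) (p.c 6), ← neg_sub (p.c 5) (p.c 7), S.σ_neg,
    S.σ_neg] at hcross
  have hY₇' := (div_ne_zero_iff.1 hY).1
  have hx₈'' := (div_ne_zero_iff.1 hx₈').1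
  rw [S.reg_iff] at hx₇ hx₈
  clear hword hadd hsub hl hconst hN₇ hN₈ hN hden hY hx₈' hq₁ hq₂ hq₃ hq₄
  generalize σ (u - (p.η + p.c 6)) * σ (u + (p.η + p.c 6)) = P₇ at *
  generalize σ (u - (p.η + p.c 7)) * σ (u + (p.η + p.c 7)) = P₈ at *
  generalize mixForm .. = N₇ at *
  generalize mixForm .. = N₈ at *
  generalize p.η + p.c 6 + (p.c 0 + p.c 1 + p.c 2 + p.c 3) / 2 = r₇ at *
  generalize p.η + p.c 7 + (p.c 0 + p.c 1 + p.c 2 + p.c 3) / 2 = r₈ at *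
  field_simp at hcross ⊢
  linear_combination -hcross

end CdSystem

/-! ### Continuity of the action and of the equations -/

theorem continuous_state_c : Continuous State.c := continuous_fst

theorem continuous_state_η : Continuous State.η := continuous_fst.comp continuous_snd

theorem continuous_state_x : Continuous State.x :=
  continuous_fst.comp (continuous_snd.comp continuous_snd)

theorem continuous_state_y : Continuous State.y :=
  continuous_snd.comp (continuous_snd.comp continuous_snd)

theorem continuous_state_lam : Continuous State.lam := by
  unfold State.lam State.c
  fun_prop

attribute [fun_prop] continuous_state_c continuous_state_η continuous_state_x continuous_state_y
  continuous_state_lam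

namespace CdSystem

variable {τ : ℂ} {f g σ : ℂ → ℂ} (S : CdSystem τ f g σ)
include S

section ContinuousAt

variable {Z : Type*} [TopologicalSpace Z] {z : Z}

theorem eventually_cdReg {u : Z → ℂ} (hu : ContinuousAt u z) (h : CdReg τ (u z)) :
    ∀ᶠ t in 𝓝 z, CdReg τ (u t) := by
  simp only [S.reg_iff] at h ⊢
  exact (S.g_diff.continuous.continuousAt.comp hu).eventually_ne h

theorem continuousAt_cd {u : Z → ℂ} (hu : ContinuousAt u z) (h : CdReg τ (u z)) :
    ContinuousAt (fun t => cd τ (u t)) z := by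
  simp only [S.reg_iff] at h
  simp only [S.cd_eq]
  exact (S.f_diff.continuous.continuousAt.comp hu).div
    (S.g_diff.continuous.continuousAt.comp hu) h

theorem eventually_linQuotReg {X u v : Z → ℂ} (hX : ContinuousAt X z) (hu : ContinuousAt u z)
    (hv : ContinuousAt v z) (h : LinQuotReg τ (X z) (u z) (v z)) :
    ∀ᶠ t in 𝓝 z, LinQuotReg τ (X t) (u t) (v t) :=
  (S.eventually_cdReg hu h.1).and <| (S.eventually_cdReg hv h.2.1).and <|
    (hX.sub (S.continuousAt_cd hv h.2.1)).eventually_ne h.2.2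

theorem continuousAt_linQuot {X u v : Z → ℂ} (hX : ContinuousAt X z) (hu : ContinuousAt u z)
    (hv : ContinuousAt v z) (h : LinQuotReg τ (X z) (u z) (v z)) :
    ContinuousAt (fun t => linQuot τ (X t) (u t) (v t)) z :=
  (hX.sub (S.continuousAt_cd hu h.1)).div (hX.sub (S.continuousAt_cd hv h.2.1)) h.2.2

theorem eventually_cdQuotReg {u v w : Z → ℂ} (hu : ContinuousAt u z) (hv : ContinuousAt v z)
    (hw : ContinuousAt w z) (h : CdQuotReg τ (u z) (v z) (w z)) :
    ∀ᶠ t in 𝓝 z, CdQuotReg τ (u t) (v t) (w t) := by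
  obtain ⟨hu', hv', hw', hw₀, hden⟩ := h
  have hcw := S.continuousAt_cd hw hw'
  exact (S.eventually_cdReg hu hu').and <| (S.eventually_cdReg hv hv').and <|
    (S.eventually_cdReg hw hw').and <| (hcw.eventually_ne hw₀).and <|
    (continuousAt_const.sub ((S.continuousAt_cd hv hv').div hcw hw₀)).eventually_ne hden

theorem continuousAt_cdQuot {u v w : Z → ℂ} (hu : ContinuousAt u z) (hv : ContinuousAt v z)
    (hw : ContinuousAt w z) (h : CdQuotReg τ (u z) (v z) (w z)) :
    ContinuousAt (fun t => cdQuot τ (u t) (v t) (w t)) z := by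
  obtain ⟨hu', hv', hw', hw₀, hden⟩ := h
  have hcw := S.continuousAt_cd hw hw'
  exact (continuousAt_const.sub ((S.continuousAt_cd hu hu').div hcw hw₀)).div
    (continuousAt_const.sub ((S.continuousAt_cd hv hv').div hcw hw₀)) hden

theorem continuousAt_s₂Den {c₁ c₂ η x y : Z → ℂ} (h₁ : ContinuousAt c₁ z) (h₂ : ContinuousAt c₂ z)
    (hη : ContinuousAt η z) (hx : ContinuousAt x z) (hy : ContinuousAt y z)
    (h : S₂Reg τ (c₁ z) (c₂ z) (η z) (x z) (y z)) :
    ContinuousAt (fun t => s₂Den τ (c₁ t) (c₂ t) (η t) (x t) (y t)) z :=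
  (hx.sub (S.continuousAt_cd (hη.add h₁) h.2.1.1)).mul
    (hy.sub (S.continuousAt_cd (hη.sub h₂) h.1.1))

theorem continuousAt_s₂Num {c₁ c₂ η x y : Z → ℂ} (h₁ : ContinuousAt c₁ z) (h₂ : ContinuousAt c₂ z)
    (hη : ContinuousAt η z) (hx : ContinuousAt x z) (hy : ContinuousAt y z)
    (h : S₂Reg τ (c₁ z) (c₂ z) (η z) (x z) (y z)) :
    ContinuousAt (fun t => s₂Num τ (c₁ t) (c₂ t) (η t) (x t) (y t)) z := by
  have hconst : ContinuousAt (fun t => s₂Const τ (c₁ t) (c₂ t) (η t)) z := by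
    obtain ⟨hq₁, hq₂, hq₃, -⟩ := h
    unfold s₂Const
    refine (ContinuousAt.mul ?_ ?_).mul ?_ <;>
      exact S.continuousAt_cdQuot (by fun_prop) (by fun_prop) (by fun_prop) (by assumption)
  exact (hconst.mul (hx.sub (S.continuousAt_cd (hη.add h₂) h.2.1.2.1))).mul
    (hy.sub (S.continuousAt_cd (hη.sub h₁) h.1.2.1))

theorem eventually_s₂Reg {c₁ c₂ η x y : Z → ℂ} (h₁ : ContinuousAt c₁ z) (h₂ : ContinuousAt c₂ z)
    (hη : ContinuousAt η z) (hx : ContinuousAt x z) (hy : ContinuousAt y z)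
    (h : S₂Reg τ (c₁ z) (c₂ z) (η z) (x z) (y z)) :
    ∀ᶠ t in 𝓝 z, S₂Reg τ (c₁ t) (c₂ t) (η t) (x t) (y t) := by
  have hDen := S.continuousAt_s₂Den h₁ h₂ hη hx hy h
  have hNum := S.continuousAt_s₂Num h₁ h₂ hη hx hy h
  obtain ⟨hq₁, hq₂, hq₃, hx₂, hy₁, hne, hDen₀, hsub₀⟩ := h
  have hA := S.continuousAt_cd (u := fun t => 2 * η t - (c₁ t - c₂ t) / 2) (by fun_prop) hq₃.1
  have hB := S.continuousAt_cd (u := fun t => 2 * η t + (c₁ t - c₂ t) / 2) (by fun_prop) hq₃.2.1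
  simp only [S₂Reg, eventually_and]
  refine ⟨?_, ?_, ?_, (hx.sub (S.continuousAt_cd (hη.add h₂) hq₂.2.1)).eventually_ne hx₂,
    (hy.sub (S.continuousAt_cd (hη.sub h₁) hq₁.2.1)).eventually_ne hy₁,
    (hA.ne_iff_eventually_ne hB).1 hne, hDen.eventually_ne hDen₀,
    (hDen.sub hNum).eventually_ne hsub₀⟩
    <;> exact S.eventually_cdQuotReg (by fun_prop) (by fun_prop) (by fun_prop) (by assumption)

theorem continuousAt_s₂Y {c₁ c₂ η x y : Z → ℂ} (h₁ : ContinuousAt c₁ z) (h₂ : ContinuousAt c₂ z)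
    (hη : ContinuousAt η z) (hx : ContinuousAt x z) (hy : ContinuousAt y z)
    (h : S₂Reg τ (c₁ z) (c₂ z) (η z) (x z) (y z)) :
    ContinuousAt (fun t => s₂Y τ (c₁ t) (c₂ t) (η t) (x t) (y t)) z := by
  have hDen := S.continuousAt_s₂Den h₁ h₂ hη hx hy h
  have hNum := S.continuousAt_s₂Num h₁ h₂ hη hx hy h
  obtain ⟨-, -, hq₃, -, -, -, -, hsub₀⟩ := h
  have hA := S.continuousAt_cd (u := fun t => 2 * η t - (c₁ t - c₂ t) / 2) (by fun_prop) hq₃.1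
  have hB := S.continuousAt_cd (u := fun t => 2 * η t + (c₁ t - c₂ t) / 2) (by fun_prop) hq₃.2.1
  exact ((hA.mul hDen).sub (hB.mul hNum)).div (hDen.sub hNum) hsub₀

theorem eventually_gReg {a₁ a₂ a₃ a₄ b : Z → ℂ} (h₁ : ContinuousAt a₁ z) (h₂ : ContinuousAt a₂ z)
    (h₃ : ContinuousAt a₃ z) (h₄ : ContinuousAt a₄ z) (hb : ContinuousAt b z)
    (h : GReg τ (a₁ z) (a₂ z) (a₃ z) (a₄ z) (b z)) :
    ∀ᶠ t in 𝓝 z, GReg τ (a₁ t) (a₂ t) (a₃ t) (a₄ t) (b t) := by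
  obtain ⟨hq₁, hq₂, hq₃, hq₄⟩ := h
  simp only [GReg, eventually_and]
  refine ⟨?_, ?_, ?_, ?_⟩ <;>
    exact S.eventually_cdQuotReg (by fun_prop) (by fun_prop) (by fun_prop) (by assumption)

theorem continuousAt_gG {a₁ a₂ a₃ a₄ b : Z → ℂ} (h₁ : ContinuousAt a₁ z) (h₂ : ContinuousAt a₂ z)
    (h₃ : ContinuousAt a₃ z) (h₄ : ContinuousAt a₄ z) (hb : ContinuousAt b z)
    (h : GReg τ (a₁ z) (a₂ z) (a₃ z) (a₄ z) (b z)) :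
    ContinuousAt (fun t => gG τ (a₁ t) (a₂ t) (a₃ t) (a₄ t) (b t)) z := by
  obtain ⟨hq₁, hq₂, hq₃, hq₄⟩ := h
  unfold gG
  refine ((ContinuousAt.mul ?_ ?_).mul ?_).mul ?_ <;>
    exact S.continuousAt_cdQuot (by fun_prop) (by fun_prop) (by fun_prop) (by assumption)

theorem eventually_qReg {a₁ a₂ a₃ a₄ a₅ b : Z → ℂ} (h₁ : ContinuousAt a₁ z)
    (h₂ : ContinuousAt a₂ z) (h₃ : ContinuousAt a₃ z) (h₄ : ContinuousAt a₄ z)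
    (h₅ : ContinuousAt a₅ z) (hb : ContinuousAt b z)
    (h : QReg τ (a₁ z) (a₂ z) (a₃ z) (a₄ z) (a₅ z) (b z)) :
    ∀ᶠ t in 𝓝 z, QReg τ (a₁ t) (a₂ t) (a₃ t) (a₄ t) (a₅ t) (b t) := by
  obtain ⟨hp₁, hp₂, hp₄, hr, ht₁, ht₂, ht₄⟩ := h
  simp only [QReg, eventually_and]
  refine ⟨?_, ?_, ?_, ?_, ?_, ?_, ?_⟩ <;>
    exact S.eventually_cdReg (by fun_prop) (by assumption)

theorem continuousAt_qQ {a₁ a₂ a₃ a₄ a₅ b X : Z → ℂ} (h₁ : ContinuousAt a₁ z)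
    (h₂ : ContinuousAt a₂ z) (h₃ : ContinuousAt a₃ z) (h₄ : ContinuousAt a₄ z)
    (h₅ : ContinuousAt a₅ z) (hb : ContinuousAt b z) (hX : ContinuousAt X z)
    (h : QReg τ (a₁ z) (a₂ z) (a₃ z) (a₄ z) (a₅ z) (b z)) :
    ContinuousAt (fun t => qQ τ (a₁ t) (a₂ t) (a₃ t) (a₄ t) (a₅ t) (b t) (X t)) z := by
  obtain ⟨hp₁, hp₂, hp₄, hr, ht₁, ht₂, ht₄⟩ := h
  have hp₁' := S.continuousAt_cd (u := fun t => b t + a₁ t) (by fun_prop) hp₁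
  have hp₂' := S.continuousAt_cd (u := fun t => b t + a₂ t) (by fun_prop) hp₂
  have hp₄' := S.continuousAt_cd (u := fun t => b t + a₄ t) (by fun_prop) hp₄
  have hr' := S.continuousAt_cd (u := fun t => b t + a₃ t - a₅ t / 2) (by fun_prop) hr
  have ht₁' := S.continuousAt_cd (u := fun t => b t + a₁ t + a₅ t / 2) (by fun_prop) ht₁
  have ht₂' := S.continuousAt_cd (u := fun t => b t + a₂ t + a₅ t / 2) (by fun_prop) ht₂
  have ht₄' := S.continuousAt_cd (u := fun t => b t + a₄ t + a₅ t / 2) (by fun_prop) ht₄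
  unfold qQ
  fun_prop

theorem eventually_pReg {a₁ a₂ a₃ b : Z → ℂ} (h₁ : ContinuousAt a₁ z) (h₂ : ContinuousAt a₂ z)
    (h₃ : ContinuousAt a₃ z) (hb : ContinuousAt b z) (h : PReg τ (a₁ z) (a₂ z) (a₃ z) (b z)) :
    ∀ᶠ t in 𝓝 z, PReg τ (a₁ t) (a₂ t) (a₃ t) (b t) := by
  obtain ⟨hp₁, hp₂, hp₃, hm₁, hm₂, hm₃⟩ := h
  simp only [PReg, eventually_and]
  refine ⟨?_, ?_, ?_, ?_, ?_, ?_⟩ <;>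
    exact S.eventually_cdReg (by fun_prop) (by assumption)

theorem continuousAt_pP {a₁ a₂ a₃ b X Y : Z → ℂ} (h₁ : ContinuousAt a₁ z)
    (h₂ : ContinuousAt a₂ z) (h₃ : ContinuousAt a₃ z) (hb : ContinuousAt b z)
    (hX : ContinuousAt X z) (hY : ContinuousAt Y z) (h : PReg τ (a₁ z) (a₂ z) (a₃ z) (b z)) :
    ContinuousAt (fun t => pP τ (a₁ t) (a₂ t) (a₃ t) (b t) (X t) (Y t)) z := by
  obtain ⟨hp₁, hp₂, hp₃, hm₁, hm₂, hm₃⟩ := h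
  have hp₁' := S.continuousAt_cd (u := fun t => b t + a₁ t) (by fun_prop) hp₁
  have hp₂' := S.continuousAt_cd (u := fun t => b t + a₂ t) (by fun_prop) hp₂
  have hp₃' := S.continuousAt_cd (u := fun t => b t + a₃ t) (by fun_prop) hp₃
  have hm₁' := S.continuousAt_cd (u := fun t => b t - a₁ t) (by fun_prop) hm₁
  have hm₂' := S.continuousAt_cd (u := fun t => b t - a₂ t) (by fun_prop) hm₂
  have hm₃' := S.continuousAt_cd (u := fun t => b t - a₃ t) (by fun_prop) hm₃
  unfold pP
  fun_prop

section MixN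

variable {d₁ d₂ d₃ d₄ d₅ d₆ w s b X Y : Z → ℂ} (h₁ : ContinuousAt d₁ z) (h₂ : ContinuousAt d₂ z)
  (h₃ : ContinuousAt d₃ z) (h₄ : ContinuousAt d₄ z) (h₅ : ContinuousAt d₅ z)
  (h₆ : ContinuousAt d₆ z) (hw : ContinuousAt w z) (hs : ContinuousAt s z) (hb : ContinuousAt b z)
  (hX : ContinuousAt X z) (hY : ContinuousAt Y z)
  (h : MixNReg τ (d₁ z) (d₂ z) (d₃ z) (d₄ z) (d₅ z) (d₆ z) (w z) (s z) (b z) (X z) (Y z))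
include h₁ h₂ h₃ h₄ h₅ h₆ hw hs hb hX hY h

theorem eventually_mixNReg :
    ∀ᶠ t in 𝓝 z,
      MixNReg τ (d₁ t) (d₂ t) (d₃ t) (d₄ t) (d₅ t) (d₆ t) (w t) (s t) (b t) (X t) (Y t) := by
  obtain ⟨hQ₃, hQ₄, hP₄, hP₃, hG, hP₄₀, hP₃₀, hG₀, hlin⟩ := h
  exact (S.eventually_qReg h₅ h₆ h₃ hw hs hb hQ₃).and <|
    (S.eventually_qReg h₅ h₆ h₄ hw hs hb hQ₄).and <|
    (S.eventually_pReg h₁ h₂ h₄ hb hP₄).and <| (S.eventually_pReg h₁ h₂ h₃ hb hP₃).and <|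
    (S.eventually_gReg h₁ h₂ h₃ h₄ hb hG).and <|
    ((S.continuousAt_pP h₁ h₂ h₄ hb hX hY hP₄).eventually_ne hP₄₀).and <|
    ((S.continuousAt_pP h₁ h₂ h₃ hb hX hY hP₃).eventually_ne hP₃₀).and <|
    ((S.continuousAt_gG h₁ h₂ h₃ h₄ hb hG).eventually_ne hG₀).and
    (S.eventually_linQuotReg hX (hb.add h₃) (hb.add h₄) hlin)

theorem continuousAt_mixN :
    ContinuousAt (fun t =>
      mixN τ (d₁ t) (d₂ t) (d₃ t) (d₄ t) (d₅ t) (d₆ t) (w t) (s t) (b t) (X t) (Y t)) z := by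
  obtain ⟨hQ₃, hQ₄, hP₄, hP₃, hG, hP₄₀, hP₃₀, hG₀, hlin⟩ := h
  have hGP := (S.continuousAt_gG h₁ h₂ h₃ h₄ hb hG).mul (S.continuousAt_pP h₁ h₂ h₃ hb hX hY hP₃)
  exact ((S.continuousAt_qQ h₅ h₆ h₃ hw hs hb hX hQ₃).div
      (S.continuousAt_pP h₁ h₂ h₄ hb hX hY hP₄) hP₄₀).sub <|
    (S.continuousAt_linQuot hX (hb.add h₃) (hb.add h₄) hlin).mul <|
    (S.continuousAt_qQ h₅ h₆ h₄ hw hs hb hX hQ₄).div hGP (mul_ne_zero hG₀ hP₃₀)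

end MixN

end ContinuousAt

theorem continuousAt_step {i : Fin 9} {p : State}
    (h : i = 2 → S₂Reg τ (p.c 0) (p.c 1) p.η p.x p.y) : ContinuousAt (step τ i) p := by
  by_cases hi : i = 2
  · subst hi
    have hx : ContinuousAt (fun q : State => (step τ 2 q).x) p := continuous_state_x.continuousAt
    have hy := S.continuousAt_s₂Y (c₁ := fun q : State => q.c 0) (c₂ := fun q : State => q.c 1)
      (η := State.η) (x := State.x) (y := State.y) (by fun_prop) (by fun_prop) (by fun_prop)
      (by fun_prop) (by fun_prop) (h rfl)
    have hc : Continuous fun q : State => (step τ 2 q).c := by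
      refine continuous_pi fun j => ?_
      by_cases hj : j = 0 ∨ j = 1 <;> simp only [step, State.c, hj, if_true, if_false] <;> fun_prop
    have hη : Continuous fun q : State => (step τ 2 q).η := by
      simp only [step, State.η, State.c]
      fun_prop
    exact hc.continuousAt.prodMk (hη.continuousAt.prodMk (hx.prodMk hy))
  · have hstep : Continuous (step τ i) := by
      fin_cases i <;> first | exact absurd rfl hi | (unfold step; fun_prop)
    exact hstep.continuousAt

theorem continuousAt_run {w : List (Fin 9)} {p : State} (h : WordReg τ w p) :
    ContinuousAt (run τ w) p := by
  induction w generalizing p with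
  | nil => exact continuousAt_id
  | cons i w ih => exact (ih h.2).comp (S.continuousAt_step h.1)

theorem eventually_wordReg {w : List (Fin 9)} {p : State} (h : WordReg τ w p) :
    ∀ᶠ q in 𝓝 p, WordReg τ w q := by
  induction w generalizing p with
  | nil => exact Eventually.of_forall fun _ => trivial
  | cons i w ih =>
    refine Eventually.and ?_ ((S.continuousAt_step h.1).eventually (ih h.2))
    simp only [eventually_imp_distrib_left]
    exact fun hi => S.eventually_s₂Reg (c₁ := fun q : State => q.c 0)
      (c₂ := fun q : State => q.c 1) (η := State.η) (x := State.x) (y := State.y) (by fun_prop)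
      (by fun_prop) (by fun_prop) (by fun_prop) (by fun_prop) (h.1 hi)

theorem continuousAt_xTilde {p : State} (h : WordReg τ RJ2 p) : ContinuousAt (xTilde τ) p := by
  have hx : xTilde τ = State.x ∘ run τ RJ2 := funext fun q => (x_run_RJ2 τ q).symm
  rw [hx]
  exact continuous_state_x.continuousAt.comp (S.continuousAt_run h)

theorem isOpen_firstDomain : IsOpen (FirstDomain τ) := by
  refine isOpen_iff_eventually.2 fun p h => (S.eventually_wordReg h.1).and ?_
  have hY := S.continuousAt_xTilde h.1
  obtain ⟨-, hl₁, hl₂, hq₁, hq₂, hq₃, hq₄, hm₇, hm₈, hm₀⟩ := h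
  simp only [MSYFirstReg, eventually_and]
  refine ⟨?_, ?_, ?_, ?_, ?_, ?_, ?_, ?_, ContinuousAt.eventually_ne ?_ hm₀⟩
  iterate 2 exact S.eventually_linQuotReg (by fun_prop) (by fun_prop) (by fun_prop) (by assumption)
  iterate 4 exact S.eventually_cdQuotReg (by fun_prop) (by fun_prop) (by fun_prop) (by assumption)
  iterate 2
    exact S.eventually_mixNReg (by fun_prop) (by fun_prop) (by fun_prop) (by fun_prop)
      (by fun_prop) (by fun_prop) (by fun_prop) (by fun_prop) (by fun_prop) (by fun_prop)
      (by fun_prop) (by assumption)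
  exact S.continuousAt_mixN (by fun_prop) (by fun_prop) (by fun_prop) (by fun_prop)
    (by fun_prop) (by fun_prop) (by fun_prop) (by fun_prop) (by fun_prop) (by fun_prop)
    (by fun_prop) (by assumption)

theorem msyFirst_of_frequently {p : State} (h : p ∈ FirstDomain τ)
    (hfreq : ∃ᶠ q in 𝓝 p, MSYFirst τ (q.c 0) (q.c 1) (q.c 2) (q.c 3) (q.c 4) (q.c 5) (q.c 6)
      (q.c 7) q.η q.lam q.x q.y (xTilde τ q)) :
    MSYFirst τ (p.c 0) (p.c 1) (p.c 2) (p.c 3) (p.c 4) (p.c 5) (p.c 6) (p.c 7) p.η p.lam p.x p.y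
      (xTilde τ p) := by
  have hY := S.continuousAt_xTilde h.1
  obtain ⟨-, hl₁, hl₂, hq₁, hq₂, hq₃, hq₄, hm₇, hm₈, hm₀⟩ := h
  by_contra hne
  refine hfreq ((ContinuousAt.ne_iff_eventually_ne ?_ ?_).1 hne)
  · refine ContinuousAt.mul ?_ ?_ <;>
      exact S.continuousAt_linQuot (by fun_prop) (by fun_prop) (by fun_prop) (by assumption)
  · refine (((ContinuousAt.mul ?_ ?_).mul ?_).mul ?_).mul (ContinuousAt.div ?_ ?_ hm₀)
    iterate 4 exact S.continuousAt_cdQuot (by fun_prop) (by fun_prop) (by fun_prop) (by assumption)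
    iterate 2
      exact S.continuousAt_mixN (by fun_prop) (by fun_prop) (by fun_prop) (by fun_prop)
        (by fun_prop) (by fun_prop) (by fun_prop) (by fun_prop) (by fun_prop) (by fun_prop)
        (by fun_prop) (by assumption)

/- Moving `u` and `η` simultaneously leaves the branch locus `σ (2 * u) = 0` of `cd` and the loci
`σ (4 * η) = 0` and `σ (4 * η + 2 * λ) = 0`. -/
theorem msyFirst {p : State} (h : p ∈ FirstDomain τ) :
    MSYFirst τ (p.c 0) (p.c 1) (p.c 2) (p.c 3) (p.c 4) (p.c 5) (p.c 6) (p.c 7) p.η p.lam p.x p.y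
      (xTilde τ p) := by
  obtain ⟨u, hu, hx⟩ := S.surj p.x
  let γ : ℂ → State := fun t => (p.c, p.η + t, cd τ (u + t), p.y)
  have hreg : CdReg τ (u + 0) := by rwa [add_zero, S.reg_iff]
  have hγ₀ : γ 0 = p := by
    have hcd : cd τ u = p.x := by rw [S.cd_eq, ← hx, mul_div_cancel_right₀ _ hu]
    simp only [γ, add_zero, hcd]
    rfl
  have hγ : Tendsto γ (𝓝[≠] 0) (𝓝 p) := by
    have hcd := S.continuousAt_cd (u := fun t : ℂ => u + t) (by fun_prop) hreg
    have hcont : ContinuousAt γ 0 := by fun_prop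
    exact (hγ₀ ▸ hcont.tendsto).mono_left nhdsWithin_le_nhds
  refine S.msyFirst_of_frequently h (hγ.frequently (Eventually.frequently ?_))
  filter_upwards [hγ.eventually (S.isOpen_firstDomain.mem_nhds h),
    (S.eventually_cdReg (u := fun t : ℂ => u + t) (by fun_prop) hreg).filter_mono
      nhdsWithin_le_nhds,
    eventually_comp_line_ne_zero S.σ_diff S.exists_σ_ne_zero (2 * u) two_ne_zero,
    eventually_comp_line_ne_zero S.σ_diff S.exists_σ_ne_zero (4 * p.η) (b := 4) (by norm_num),
    eventually_comp_line_ne_zero S.σ_diff S.exists_σ_ne_zero (4 * p.η + 2 * p.lam)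
      (b := 4) (by norm_num)]
    with t hmem hut h₂ h₄ hl₄
  rw [S.reg_iff] at hut
  refine S.msyFirst_of_σ_ne_zero hmem hut ?_ ?_ ?_ ?_
  · exact (congrArg (· * g (u + t)) (S.cd_eq _)).trans (div_mul_cancel₀ _ hut)
  · rwa [mul_add, mul_comm 2 t]
  · exact (show 4 * p.η + t * 4 = 4 * (γ t).η by simp only [γ, State.η]; ring) ▸ h₄
  · exact (show 4 * p.η + 2 * p.lam + t * 4 = 4 * (γ t).η + 2 * (γ t).lam by
      simp only [γ, State.η, State.lam, State.c]; ring) ▸ hl₄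

end CdSystem

/-! ### Dense sets of points over generic parameters -/

theorem dense_inter_ne_zero {E : Type*} [NormedAddCommGroup E] [NormedSpace ℂ E] {A : Set E}
    (hA : Dense A) {F : E → ℂ} (hF : Differentiable ℂ F) (h : ∃ q, F q ≠ 0) :
    Dense (A ∩ {q | F q ≠ 0}) := by
  refine hA.inter_of_isOpen_right (fun q₀ => ?_) (isOpen_ne_fun hF.continuous continuous_const)
  obtain ⟨q₁, hq₁⟩ := h
  have hline : Differentiable ℂ fun z : ℂ => F (q₀ + z • (q₁ - q₀)) := hF.comp (by fun_prop)
  have hlim : Tendsto (fun z : ℂ => q₀ + z • (q₁ - q₀)) (𝓝[≠] 0) (𝓝 q₀) := by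
    refine Tendsto.mono_left ?_ nhdsWithin_le_nhds
    exact Continuous.tendsto' (by fun_prop) _ _ (by simp)
  exact mem_closure_of_tendsto hlim (eventually_ne_zero_of_entire hline ⟨1, by simpa using hq₁⟩ 0)

theorem dense_inter_preimage_of_nhds_le_map {X Y : Type*} [TopologicalSpace X]
    [TopologicalSpace Y] {R : Set X} {F : X → Y} {D : Set Y} (hR : Dense R) (ho : IsOpen R)
    (hF : ∀ q ∈ R, 𝓝 (F q) ≤ map F (𝓝 q)) (hD : Dense D) : Dense (R ∩ F ⁻¹' D) := by
  refine Dense.of_closure (hR.mono fun q hq => ?_)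
  have hfreq : ∃ᶠ q' in 𝓝 q, F q' ∈ D :=
    frequently_map.1 ((mem_closure_iff_frequently.1 (hD (F q))).filter_mono (hF q hq))
  refine mem_closure_iff_frequently.2 ((hfreq.and_eventually (ho.mem_nhds hq)).mono ?_)
  exact fun _ h => ⟨h.2, h.1⟩

/-- The conditions on the parameters under which `s₂` is birational in `(x, y)`. -/
def S₂ParamReg (τ c₁ c₂ η : ℂ) : Prop :=
  CdQuotReg τ (η - c₂) (η - c₁) η ∧ CdQuotReg τ (η + c₁) (η + c₂) η ∧
  CdQuotReg τ (2 * η - (c₁ - c₂) / 2) (2 * η + (c₁ - c₂) / 2) ((c₁ + c₂) / 2) ∧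
  cd τ (2 * η - (c₁ - c₂) / 2) ≠ cd τ (2 * η + (c₁ - c₂) / 2) ∧
  cd τ (η + c₁) ≠ cd τ (η + c₂) ∧ cd τ (η - c₁) ≠ cd τ (η - c₂)

theorem dense_s₂Reg {τ c₁ c₂ η : ℂ} (h : S₂ParamReg τ c₁ c₂ η) :
    Dense {q : ℂ × ℂ | S₂Reg τ c₁ c₂ η q.1 q.2} := by
  obtain ⟨hq₁, hq₂, hq₃, hne, hp, -⟩ := h
  unfold S₂Reg s₂Num s₂Den
  generalize s₂Const τ c₁ c₂ η = K
  generalize cd τ (η + c₁) = p₁ at *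
  generalize cd τ (η + c₂) = p₂ at *
  generalize cd τ (η - c₁) = m₁ at *
  generalize cd τ (η - c₂) = m₂ at *
  have hx := dense_inter_ne_zero dense_univ (F := fun q : ℂ × ℂ => q.1 - p₂) (by fun_prop)
    ⟨(p₂ + 1, 0), by simp⟩
  have hy := dense_inter_ne_zero hx (F := fun q : ℂ × ℂ => q.2 - m₁) (by fun_prop)
    ⟨(0, m₁ + 1), by simp⟩
  have hDen := dense_inter_ne_zero hy (F := fun q : ℂ × ℂ => (q.1 - p₁) * (q.2 - m₂))
    (by fun_prop) ⟨(p₁ + 1, m₂ + 1), by simp⟩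
  have hsub := dense_inter_ne_zero hDen
    (F := fun q : ℂ × ℂ => (q.1 - p₁) * (q.2 - m₂) - K * (q.1 - p₂) * (q.2 - m₁))
    (by fun_prop) ⟨(p₂, m₂ + 1), by simpa [sub_eq_zero] using hp.symm⟩
  refine hsub.mono ?_
  rintro q ⟨⟨⟨⟨-, hx⟩, hy⟩, hDen⟩, hsub⟩
  exact ⟨hq₁, hq₂, hq₃, hx, hy, hne, hDen, hsub⟩

/-- The coefficient of `y` in the relation that defines `Y = s₂(y)`, with denominators cleared. -/
def s₂InvDen (τ c₁ c₂ η x Y : ℂ) : ℂ :=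
  (Y - cd τ (2 * η - (c₁ - c₂) / 2)) * (x - cd τ (η + c₁)) -
    s₂Const τ c₁ c₂ η * (Y - cd τ (2 * η + (c₁ - c₂) / 2)) * (x - cd τ (η + c₂))

/-- The inverse of `y ↦ s₂(y)`: the relation that defines `Y = s₂(y)` solved for `y`. -/
def s₂Inv (τ c₁ c₂ η x Y : ℂ) : ℂ :=
  ((Y - cd τ (2 * η - (c₁ - c₂) / 2)) * (x - cd τ (η + c₁)) * cd τ (η - c₂) -
    s₂Const τ c₁ c₂ η * (Y - cd τ (2 * η + (c₁ - c₂) / 2)) * (x - cd τ (η + c₂)) *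
      cd τ (η - c₁)) / s₂InvDen τ c₁ c₂ η x Y

theorem s₂Inv_eq_iff {τ c₁ c₂ η x y Y : ℂ} (h : s₂InvDen τ c₁ c₂ η x Y ≠ 0) :
    s₂Inv τ c₁ c₂ η x Y = y ↔
      (Y - cd τ (2 * η - (c₁ - c₂) / 2)) * (x - cd τ (η + c₁)) * (y - cd τ (η - c₂)) =
      s₂Const τ c₁ c₂ η *
        ((Y - cd τ (2 * η + (c₁ - c₂) / 2)) * (x - cd τ (η + c₂)) * (y - cd τ (η - c₁))) := by
  rw [s₂Inv, div_eq_iff h, s₂InvDen]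
  constructor <;> intro h <;> linear_combination -h

theorem s₂Y_eq_iff {τ c₁ c₂ η x y Y : ℂ} (h : S₂Reg τ c₁ c₂ η x y) :
    s₂Y τ c₁ c₂ η x y = Y ↔ Y - cd τ (2 * η + (c₁ - c₂) / 2) ≠ 0 ∧
      (Y - cd τ (2 * η - (c₁ - c₂) / 2)) * (x - cd τ (η + c₁)) * (y - cd τ (η - c₂)) =
      s₂Const τ c₁ c₂ η *
        ((Y - cd τ (2 * η + (c₁ - c₂) / 2)) * (x - cd τ (η + c₂)) * (y - cd τ (η - c₁))) := by
  rw [eq_comm, ← s₂Relation_iff τ c₁ c₂ η x y Y h]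
  obtain ⟨-, -, -, hx, hy, -⟩ := h
  refine and_congr_right fun hY => ?_
  rw [S₂Relation, linQuot, linQuot, linQuot, ← mul_div_mul_comm, ← mul_div_mul_comm,
    div_eq_iff (mul_ne_zero (mul_ne_zero hY hx) hy)]

/-- The conditions on the parameters under which `s₂Chain` is birational in `(x, y)`. -/
def S₂ChainParamReg (τ η : ℂ) : List (ℂ × ℂ) → ℂ → Prop
  | [], _ => True
  | (a, b) :: l, t => S₂ParamReg τ (a + t) (b + t) (η - t) ∧
    S₂ChainParamReg τ η l (t + (2 * η + a + b) / 4)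

theorem pForm_eq_mul_pP (τ a₁ a₂ a₃ b X F : ℂ) {E : ℂ} (hE : E ≠ 0) :
    pForm τ a₁ a₂ a₃ b X F E = E * pP τ a₁ a₂ a₃ b X (F / E) := by
  rw [← pForm_one, pForm, pForm]
  field_simp

theorem mixForm_eq_mul_mixForm_one (τ d₁ d₂ d₃ d₄ d₅ d₆ z s b X F : ℂ) {E : ℂ} (hE : E ≠ 0) :
    mixForm τ d₁ d₂ d₃ d₄ d₅ d₆ z s b X F E =
      E * mixForm τ d₁ d₂ d₃ d₄ d₅ d₆ z s b X (F / E) 1 := by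
  rw [mixForm, mixForm, pForm_eq_mul_pP _ _ _ _ _ _ _ hE, pForm_eq_mul_pP _ _ _ _ _ _ _ hE,
    pForm_one, pForm_one]
  ring

theorem differentiable_pP (τ a₁ a₂ a₃ b : ℂ) :
    Differentiable ℂ fun q : ℂ × ℂ => pP τ a₁ a₂ a₃ b q.1 q.2 := by
  unfold pP
  fun_prop

theorem differentiable_mixForm (τ d₁ d₂ d₃ d₄ d₅ d₆ z s b : ℂ) :
    Differentiable ℂ fun q : ℂ × ℂ => mixForm τ d₁ d₂ d₃ d₄ d₅ d₆ z s b q.1 q.2 1 := by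
  unfold mixForm pForm qQ
  fun_prop

/-- The conditions on the parameters under which `mixForm` and the polynomials `pP` in it do not
vanish identically in `(X, Y)`. -/
def MixFormGeneric (σ : ℂ → ℂ) (d₁ d₂ d₃ d₄ d₅ d₆ z s b : ℂ) : Prop :=
  σ (4 * b) ≠ 0 ∧ σ (d₂ - d₁) ≠ 0 ∧ σ (d₂ - d₄) ≠ 0 ∧ σ (d₄ - d₁) ≠ 0 ∧ σ (d₃ - d₄) ≠ 0 ∧
  σ (d₁ + d₂ - 2 * b) ≠ 0 ∧ σ s ≠ 0 ∧ σ (d₅ - d₆) ≠ 0 ∧ σ (z - d₆) ≠ 0 ∧ σ (d₅ - z) ≠ 0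

/-- The conditions on the parameters under which all terms of the first equation are defined for
generic `(x, y)`; `l` stands for `λ`. -/
def FirstParamReg (τ : ℂ) (σ : ℂ → ℂ) (c₁ c₂ c₃ c₄ c₅ c₆ c₇ c₈ η l : ℂ) : Prop :=
  CdReg τ (η + c₇) ∧ CdReg τ (η + c₈) ∧
  CdQuotReg τ (η - c₈ + l) (η - c₇ + l) (3 * η + c₆ + l) ∧
  CdQuotReg τ (2 * η + (c₇ - c₈) / 2 + l) (2 * η - (c₇ - c₈) / 2 + l) (c₆ + (c₇ + c₈) / 2 - l) ∧
  CdQuotReg τ (2 * η - (c₇ - c₈) / 2 + l) (2 * η + (c₇ - c₈) / 2 + l)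
    (2 * η + c₆ - (c₇ + c₈) / 2 + l) ∧
  CdQuotReg τ (η + c₈ + (c₁ + c₂ + c₃ + c₄) / 2) (η + c₇ + (c₁ + c₂ + c₃ + c₄) / 2)
    (η + c₅ + (c₁ + c₂ + c₃ + c₄) / 2) ∧
  MixFormReg τ c₁ c₂ c₃ c₄ c₅ c₆ c₇ (c₁ + c₂ + c₃ + c₄) η ∧
  MixFormReg τ c₁ c₂ c₃ c₄ c₅ c₆ c₈ (c₁ + c₂ + c₃ + c₄) η ∧
  MixFormGeneric σ c₁ c₂ c₃ c₄ c₅ c₆ c₈ (c₁ + c₂ + c₃ + c₄) η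

namespace CdSystem

variable {τ : ℂ} {f g σ : ℂ → ℂ} (S : CdSystem τ f g σ)
include S

theorem s₂Const_ne_zero {c₁ c₂ η : ℂ} (h₁ : CdQuotReg τ (η - c₂) (η - c₁) η)
    (h₂ : CdQuotReg τ (η + c₁) (η + c₂) η)
    (h₃ : CdQuotReg τ (2 * η - (c₁ - c₂) / 2) (2 * η + (c₁ - c₂) / 2) ((c₁ + c₂) / 2)) :
    s₂Const τ c₁ c₂ η ≠ 0 := by
  rw [S.s₂Const_eq h₁ h₂ h₃]
  obtain ⟨hm₂, hm₁, -⟩ := S.cdQuotReg_iff.1 h₁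
  obtain ⟨hp₁, hp₂, -⟩ := S.cdQuotReg_iff.1 h₂
  obtain ⟨hA, hB, -⟩ := S.cdQuotReg_iff.1 h₃
  exact div_ne_zero (mul_ne_zero (mul_ne_zero hm₁ hp₂) hB) (mul_ne_zero (mul_ne_zero hm₂ hp₁) hA)

theorem s₂InvDen_s₂Y_ne_zero {c₁ c₂ η x y : ℂ} (h : S₂Reg τ c₁ c₂ η x y)
    (hm : cd τ (η - c₁) ≠ cd τ (η - c₂)) : s₂InvDen τ c₁ c₂ η x (s₂Y τ c₁ c₂ η x y) ≠ 0 := by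
  obtain ⟨hY, hrel⟩ := (s₂Y_eq_iff h).1 rfl
  obtain ⟨hq₁, hq₂, hq₃, hx, -⟩ := h
  intro h₀
  refine mul_ne_zero (mul_ne_zero (S.s₂Const_ne_zero hq₁ hq₂ hq₃) (mul_ne_zero hY hx))
    (sub_ne_zero.2 hm) ?_
  rw [s₂InvDen] at h₀
  linear_combination hrel - (y - cd τ (η - c₂)) * h₀

theorem nhds_le_map_s₂ {c₁ c₂ η : ℂ} (hm : cd τ (η - c₁) ≠ cd τ (η - c₂)) {q : ℂ × ℂ}
    (hq : S₂Reg τ c₁ c₂ η q.1 q.2) :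
    𝓝 (q.1, s₂Y τ c₁ c₂ η q.1 q.2) ≤
      map (fun q : ℂ × ℂ => (q.1, s₂Y τ c₁ c₂ η q.1 q.2)) (𝓝 q) := by
  have hDen := S.s₂InvDen_s₂Y_ne_zero hq hm
  obtain ⟨hY, hrel⟩ := (s₂Y_eq_iff hq).1 rfl
  have hinv : Tendsto (fun r : ℂ × ℂ => (r.1, s₂Inv τ c₁ c₂ η r.1 r.2))
      (𝓝 (q.1, s₂Y τ c₁ c₂ η q.1 q.2)) (𝓝 q) := by
    have hcont : ContinuousAt (fun r : ℂ × ℂ => s₂Inv τ c₁ c₂ η r.1 r.2)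
        (q.1, s₂Y τ c₁ c₂ η q.1 q.2) := by
      refine ContinuousAt.div (by fun_prop) ?_ hDen
      unfold s₂InvDen
      fun_prop
    have h := (continuousAt_fst.prodMk hcont).tendsto
    rwa [(s₂Inv_eq_iff hDen).2 hrel] at h
  refine le_map_of_right_inverse ?_ hinv
  have hDen' : ∀ᶠ r in 𝓝 (q.1, s₂Y τ c₁ c₂ η q.1 q.2), s₂InvDen τ c₁ c₂ η r.1 r.2 ≠ 0 := by
    refine ContinuousAt.eventually_ne ?_ hDen
    unfold s₂InvDen
    fun_prop
  have hY' : ∀ᶠ r in 𝓝 (q.1, s₂Y τ c₁ c₂ η q.1 q.2), r.2 - cd τ (2 * η + (c₁ - c₂) / 2) ≠ 0 :=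
    ContinuousAt.eventually_ne (by fun_prop) hY
  have hreg := hinv.eventually (S.eventually_s₂Reg continuousAt_const continuousAt_const
    continuousAt_const continuousAt_fst continuousAt_snd hq)
  filter_upwards [hDen', hY', hreg] with r hDen hY hreg
  exact Prod.ext rfl ((s₂Y_eq_iff hreg).2 ⟨hY, (s₂Inv_eq_iff hDen).1 rfl⟩)

theorem dense_preimage_s₂ {c₁ c₂ η : ℂ} (h : S₂ParamReg τ c₁ c₂ η) {D : Set (ℂ × ℂ)}
    (hD : Dense D) :
    Dense {q : ℂ × ℂ | S₂Reg τ c₁ c₂ η q.1 q.2 ∧ (q.1, s₂Y τ c₁ c₂ η q.1 q.2) ∈ D} := by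
  refine dense_inter_preimage_of_nhds_le_map (dense_s₂Reg h)
    (isOpen_iff_mem_nhds.2 fun q hq => ?_) (fun q hq => S.nhds_le_map_s₂ h.2.2.2.2.2 hq) hD
  exact S.eventually_s₂Reg continuousAt_const continuousAt_const continuousAt_const
    continuousAt_fst continuousAt_snd hq

theorem dense_preimage_s₂Chain {η t : ℂ} {l : List (ℂ × ℂ)} (h : S₂ChainParamReg τ η l t)
    {D : Set (ℂ × ℂ)} (hD : Dense D) :
    Dense {q : ℂ × ℂ | S₂ChainReg τ η q.1 l t q.2 ∧ (q.1, s₂Chain τ η q.1 l t q.2) ∈ D} := by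
  induction l generalizing t with
  | nil => simpa [S₂ChainReg, s₂Chain] using hD
  | cons ab l ih =>
    refine (S.dense_preimage_s₂ h.1 (ih h.2)).mono ?_
    rintro q ⟨hreg, hchain, hD⟩
    exact ⟨⟨hreg, hchain⟩, hD⟩

theorem gG_ne_zero {a₁ a₂ a₃ a₄ b : ℂ} (h : GReg τ a₁ a₂ a₃ a₄ b) (h₂₄ : σ (a₂ - a₄) ≠ 0)
    (h₄₁ : σ (a₄ - a₁) ≠ 0) : gG τ a₁ a₂ a₃ a₄ b ≠ 0 := by
  obtain ⟨hg₃, hg₄, hr₃, hr₄, h₂₃, h₃₁, hG⟩ := S.gG_eq h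
  rw [hG]
  exact div_ne_zero (mul_ne_zero (mul_ne_zero (mul_ne_zero h₂₄ h₄₁) hg₃) hr₃)
    (mul_ne_zero (mul_ne_zero (mul_ne_zero h₂₃ h₃₁) hg₄) hr₄)

theorem eventually_σ_add_ne_zero (a : ℂ) : ∀ᶠ u in 𝓝[≠] (0 : ℂ), σ (u + a) ≠ 0 := by
  filter_upwards [eventually_comp_line_ne_zero S.σ_diff S.exists_σ_ne_zero a one_ne_zero] with u hu
  rwa [mul_one, add_comm] at hu

theorem eventually_sigmaProd_neg_ne_zero (b : ℂ) (as : List ℂ) :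
    ∀ᶠ u in 𝓝[≠] (0 : ℂ), sigmaProd σ b as (-u) ≠ 0 := by
  induction as with
  | nil => simp [sigmaProd]
  | cons a as ih =>
    filter_upwards [ih, S.eventually_σ_add_ne_zero (-(b + a))] with u has ha
    rw [sigmaProd, List.map_cons, List.prod_cons, ← neg_neg (b + a), ← neg_add, S.σ_neg]
    exact mul_ne_zero (neg_ne_zero.2 ha) has

theorem exists_ne_zero_of_fibre {Φ : ℂ → ℂ → ℂ → ℂ} (b : ℂ)
    (hΦ : ∀ X F E, E ≠ 0 → Φ X F E = E * Φ X (F / E) 1)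
    (h : ∀ᶠ u in 𝓝[≠] (0 : ℂ), ∀ X, g u ≠ 0 → X * g u = f u →
      Φ X (f (2 * b - u)) (g (2 * b - u)) ≠ 0) :
    ∃ q : ℂ × ℂ, Φ q.1 q.2 1 ≠ 0 := by
  have hg := eventually_comp_line_ne_zero S.g_diff S.exists_g_ne_zero 0 one_ne_zero
  have hg' := eventually_comp_line_ne_zero S.g_diff S.exists_g_ne_zero (2 * b) (b := -1)
    (by norm_num)
  simp only [zero_add, mul_one, mul_neg, ← sub_eq_add_neg] at hg hg'
  obtain ⟨u, hu, hu', hΦu⟩ := (hg.and (hg'.and h)).exists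
  refine ⟨(f u / g u, f (2 * b - u) / g (2 * b - u)), right_ne_zero_of_mul (a := g (2 * b - u)) ?_⟩
  rw [← hΦ _ _ _ hu']
  exact hΦu _ hu (div_mul_cancel₀ _ hu)

theorem exists_pP_ne_zero {a₁ a₂ a₃ b : ℂ} (h : PReg τ a₁ a₂ a₃ b) (hb : σ (4 * b) ≠ 0)
    (h₂₁ : σ (a₂ - a₁) ≠ 0) (h₃₁ : σ (a₃ - a₁) ≠ 0) (h₂₃ : σ (a₂ - a₃) ≠ 0) :
    ∃ q : ℂ × ℂ, pP τ a₁ a₂ a₃ b q.1 q.2 ≠ 0 := by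
  simp only [← pForm_one]
  refine S.exists_ne_zero_of_fibre b (fun X F E hE => ?_) ?_
  · rw [pForm_one, pForm_eq_mul_pP _ _ _ _ _ _ _ hE]
  filter_upwards [S.eventually_σ_add_ne_zero (-(b + a₁)), S.eventually_σ_add_ne_zero (-(b + a₂)),
    S.eventually_σ_add_ne_zero (-(b + a₃)), S.eventually_σ_add_ne_zero (-b + a₁ + a₂ + a₃)]
    with u h₁ h₂ h₃ h₁₂₃ X hu hX
  rw [S.pForm_fibre h hu hX]
  obtain ⟨hp₁, hp₂, hp₃, hm₁, hm₂, hm₃⟩ := h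
  rw [S.reg_iff] at hp₁ hp₂ hp₃ hm₁ hm₂ hm₃
  simp only [← add_assoc, ← sub_eq_add_neg] at h₁ h₂ h₃ h₁₂₃
  simp [*]

theorem exists_mixForm_ne_zero {d₁ d₂ d₃ d₄ d₅ d₆ z s b : ℂ} (hsum : s = d₁ + d₂ + d₃ + d₄)
    (h : MixFormReg τ d₁ d₂ d₃ d₄ d₅ d₆ z s b) (hgen : MixFormGeneric σ d₁ d₂ d₃ d₄ d₅ d₆ z s b) :
    ∃ q : ℂ × ℂ, mixForm τ d₁ d₂ d₃ d₄ d₅ d₆ z s b q.1 q.2 1 ≠ 0 := by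
  refine S.exists_ne_zero_of_fibre b
    (fun X F E hE => mixForm_eq_mul_mixForm_one _ _ _ _ _ _ _ _ _ _ _ _ hE) ?_
  filter_upwards [S.eventually_sigmaProd_neg_ne_zero b [d₁, d₂, d₃, d₄, d₅, d₆, z],
    S.eventually_σ_add_ne_zero (3 * b + d₅ + d₆ + z + s)] with u hprod hlast X hu hX
  rw [S.mixForm_fibre_sub hsum h hu hX]
  refine mul_ne_zero (mul_ne_zero ?_ ?_) (mul_ne_zero hprod hlast)
  all_goals
    obtain ⟨-, hq, hp₄, hp₃, -⟩ := h
    obtain ⟨hp₁, hp₂, hp₃, hm₁, hm₂, -⟩ := hp₃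
    obtain ⟨-, -, hp₄, -, -, hm₄⟩ := hp₄
    obtain ⟨hq₁, hq₂, hq₃, hq₄, hq₅, hq₆, hq₇⟩ := hq
    simp only [S.reg_iff] at hp₁ hp₂ hp₃ hp₄ hm₁ hm₂ hm₄ hq₁ hq₂ hq₃ hq₄ hq₅ hq₆ hq₇
    obtain ⟨hb, h₂₁, h₂₄, h₄₁, h₃₄, h₁₂, hs, h₅₆, hz₆, h₅z⟩ := hgen
    clear hsum hX
    simp [mixConst, mixFactor, *]

theorem msyFirstReg_of_firstParamReg {c₁ c₂ c₃ c₄ c₅ c₆ c₇ c₈ η l x y Y : ℂ}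
    (h : FirstParamReg τ σ c₁ c₂ c₃ c₄ c₅ c₆ c₇ c₈ η l) (hY : Y - cd τ (η - c₇ + l) ≠ 0)
    (h₈ : x - cd τ (η + c₈) ≠ 0) (h₄ : x - cd τ (η + c₄) ≠ 0) (hP₄ : pP τ c₁ c₂ c₄ η x y ≠ 0)
    (hP₃ : pP τ c₁ c₂ c₃ η x y ≠ 0)
    (hmix : mixForm τ c₁ c₂ c₃ c₄ c₅ c₆ c₈ (c₁ + c₂ + c₃ + c₄) η x y 1 ≠ 0) :
    MSYFirstReg τ c₁ c₂ c₃ c₄ c₅ c₆ c₇ c₈ η l x y Y := by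
  obtain ⟨hc₇, hc₈, hq₁, hq₂, hq₃, hq₄, hm₇, hm₈, hgen⟩ := h
  have hG : gG τ c₁ c₂ c₃ c₄ η ≠ 0 := S.gG_ne_zero hm₇.gG hgen.2.2.1 hgen.2.2.2.1
  have hmixN {z : ℂ} (h : MixFormReg τ c₁ c₂ c₃ c₄ c₅ c₆ z (c₁ + c₂ + c₃ + c₄) η) :
      MixNReg τ c₁ c₂ c₃ c₄ c₅ c₆ z (c₁ + c₂ + c₃ + c₄) η x y :=
    ⟨h.q₃, h.q₄, h.p₄, h.p₃, h.gG, hP₄, hP₃, hG, h.p₃.2.2.1, h.p₄.2.2.1, h₄⟩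
  refine ⟨⟨hq₁.1, hq₁.2.1, hY⟩, ⟨hc₇, hc₈, h₈⟩, hq₁, hq₂, hq₃, hq₄, hmixN hm₇, hmixN hm₈, ?_⟩
  rw [mixN_eq_mixForm_div (hmixN hm₈)]
  exact div_ne_zero hmix (mul_ne_zero (mul_ne_zero (mul_ne_zero hG h₄) hP₃) hP₄)

theorem dense_firstDomain {c : Fin 8 → ℂ} {η : ℂ} (h : S₂ChainParamReg τ η (paramPairs c) 0)
    (h' : FirstParamReg τ σ (c 0) (c 1) (c 2) (c 3) (c 4) (c 5) (c 6) (c 7) η ((∑ j, c j) / 2))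
    {D : Set (ℂ × ℂ)} (hD : Dense D) :
    Dense {q : ℂ × ℂ | ((c, η, q) : State) ∈ FirstDomain τ ∧
      (q.1, xTilde τ (c, η, q)) ∈ D} := by
  obtain ⟨-, -, -, -, -, -, hm₇, hm₈, hgen⟩ := id h'
  obtain ⟨hb, h₂₁, h₂₄, h₄₁, -⟩ := id hgen
  obtain ⟨-, -, -, -, h₂₃, h₃₁, -⟩ := S.gG_eq hm₇.gG
  have hY := dense_inter_ne_zero hD
    (F := fun q : ℂ × ℂ => q.2 - cd τ (η - c 6 + (∑ j, c j) / 2)) (by fun_prop)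
    ⟨(0, cd τ (η - c 6 + (∑ j, c j) / 2) + 1), by simp⟩
  have hchain := S.dense_preimage_s₂Chain h hY
  have hx₈ := dense_inter_ne_zero hchain (F := fun q : ℂ × ℂ => q.1 - cd τ (η + c 7))
    (by fun_prop) ⟨(cd τ (η + c 7) + 1, 0), by simp⟩
  have hx₄ := dense_inter_ne_zero hx₈ (F := fun q : ℂ × ℂ => q.1 - cd τ (η + c 3))
    (by fun_prop) ⟨(cd τ (η + c 3) + 1, 0), by simp⟩
  have hP₄ := dense_inter_ne_zero hx₄ (differentiable_pP _ _ _ _ _)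
    (S.exists_pP_ne_zero hm₇.p₄ hb h₂₁ h₄₁ h₂₄)
  have hP₃ := dense_inter_ne_zero hP₄ (differentiable_pP _ _ _ _ _)
    (S.exists_pP_ne_zero hm₇.p₃ hb h₂₁ h₃₁ h₂₃)
  have hmix := dense_inter_ne_zero hP₃ (differentiable_mixForm _ _ _ _ _ _ _ _ _ _)
    (S.exists_mixForm_ne_zero rfl hm₈ hgen)
  refine hmix.mono ?_
  rintro q ⟨⟨⟨⟨⟨⟨hreg, hD, hY⟩, hx₈⟩, hx₄⟩, hP₄⟩, hP₃⟩, hmix⟩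
  have hx : xTilde τ (c, η, q) = s₂Chain τ η q.1 (paramPairs c) 0 q.2 := xTilde_eq_s₂Chain ..
  rw [← hx] at hD hY
  exact ⟨⟨(wordReg_RJ2_iff ..).2 hreg,
    S.msyFirstReg_of_firstParamReg h' hY hx₈ hx₄ hP₄ hP₃ hmix⟩, hD⟩

end CdSystem

/-! ### Generic lines of parameters -/

/-- The increment of `u` from `0` to `1`; the slope of `u` if `u` is affine. -/
def lineSlope (u : ℂ → ℂ) : ℂ := u 1 - u 0

/-- Affine functions of one variable, with the slope read off from two values so that the slope of
a composite expression can be computed. -/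
def IsAffine (u : ℂ → ℂ) : Prop := ∀ z, u z = u 0 + z * lineSlope u

theorem lineSlope_add (u v : ℂ → ℂ) :
    lineSlope (fun z => u z + v z) = lineSlope u + lineSlope v := by
  simp only [lineSlope]
  ring

theorem lineSlope_sub (u v : ℂ → ℂ) :
    lineSlope (fun z => u z - v z) = lineSlope u - lineSlope v := by
  simp only [lineSlope]
  ring

namespace IsAffine

variable {u v : ℂ → ℂ}

theorem add (hu : IsAffine u) (hv : IsAffine v) : IsAffine fun z => u z + v z := fun z => by
  rw [lineSlope_add]
  linear_combination hu z + hv z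

theorem sub (hu : IsAffine u) (hv : IsAffine v) : IsAffine fun z => u z - v z := fun z => by
  rw [lineSlope_sub]
  linear_combination hu z - hv z

theorem eventually_comp_ne_zero (hu : IsAffine u) (h : lineSlope u ≠ 0) {F : ℂ → ℂ}
    (hF : Differentiable ℂ F) (h₀ : ∃ w, F w ≠ 0) : ∀ᶠ z in 𝓝[≠] (0 : ℂ), F (u z) ≠ 0 := by
  filter_upwards [eventually_comp_line_ne_zero hF h₀ (u 0) h] with z hz
  rwa [hu z]

end IsAffine

/-- A direction in the special parameter subspace along which no linear form with small coefficients
that has to be nonzero is constant: powers of `20` followed by their complements to `160000`. -/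
def genericDir : Fin 8 → ℂ := ![1, 20, 400, 8000, 152000, 159600, 159980, 159999]

theorem genericDir_rev (j : Fin 8) : genericDir (Fin.rev j) = 160000 - genericDir j := by
  fin_cases j <;> norm_num [genericDir, Fin.rev]

theorem sum_genericDir : ∑ j, genericDir j = 640000 := by
  simp only [genericDir, Fin.sum_univ_eight, Matrix.cons_val]
  norm_num

theorem sum_add_mul_genericDir (a : Fin 8 → ℂ) (z : ℂ) :
    ∑ j, (a j + z * genericDir j) = ∑ j, a j + z * 640000 := by
  rw [Finset.sum_add_distrib, ← Finset.mul_sum, sum_genericDir]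

theorem reflParam_add_mul_genericDir (a : Fin 8 → ℂ) (z : ℂ) :
    reflParam (fun j => a j + z * genericDir j) = fun j => reflParam a j + z * genericDir j := by
  funext j
  rw [reflParam, reflParam, sum_add_mul_genericDir, genericDir_rev]
  ring

namespace CdSystem

variable {τ : ℂ} {f g σ : ℂ → ℂ} (S : CdSystem τ f g σ)
include S

theorem eventually_σ_line {u : ℂ → ℂ} (hu : IsAffine u) (h : lineSlope u ≠ 0) :
    ∀ᶠ z in 𝓝[≠] (0 : ℂ), σ (u z) ≠ 0 :=
  hu.eventually_comp_ne_zero h S.σ_diff S.exists_σ_ne_zero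

theorem eventually_cdReg_line {u : ℂ → ℂ} (hu : IsAffine u) (h : lineSlope u ≠ 0) :
    ∀ᶠ z in 𝓝[≠] (0 : ℂ), CdReg τ (u z) := by
  simp only [S.reg_iff]
  exact hu.eventually_comp_ne_zero h S.g_diff S.exists_g_ne_zero

theorem eventually_cdQuotReg_line {u v w : ℂ → ℂ} (hu : IsAffine u) (hv : IsAffine v)
    (hw : IsAffine w) (hu₀ : lineSlope u ≠ 0) (hv₀ : lineSlope v ≠ 0) (hw₀ : lineSlope w ≠ 0)
    (hsub : lineSlope w - lineSlope v ≠ 0) (hadd : lineSlope w + lineSlope v ≠ 0) :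
    ∀ᶠ z in 𝓝[≠] (0 : ℂ), CdQuotReg τ (u z) (v z) (w z) := by
  rw [← lineSlope_sub] at hsub
  rw [← lineSlope_add] at hadd
  filter_upwards [hu.eventually_comp_ne_zero hu₀ S.g_diff S.exists_g_ne_zero,
    hv.eventually_comp_ne_zero hv₀ S.g_diff S.exists_g_ne_zero,
    hw.eventually_comp_ne_zero hw₀ S.g_diff S.exists_g_ne_zero,
    hw.eventually_comp_ne_zero hw₀ S.f_diff S.exists_f_ne_zero,
    S.eventually_σ_line (hw.sub hv) hsub, S.eventually_σ_line (hw.add hv) hadd]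
    with z hgu hgv hgw hfw hsub hadd
  exact S.cdQuotReg_iff.2 ⟨hgu, hgv, hgw, hfw, hsub, hadd⟩

theorem eventually_cd_ne_line {u v : ℂ → ℂ} (hu : IsAffine u) (hv : IsAffine v)
    (hu₀ : lineSlope u ≠ 0) (hv₀ : lineSlope v ≠ 0) (hsub : lineSlope u - lineSlope v ≠ 0)
    (hadd : lineSlope u + lineSlope v ≠ 0) :
    ∀ᶠ z in 𝓝[≠] (0 : ℂ), cd τ (u z) ≠ cd τ (v z) := by
  rw [← lineSlope_sub] at hsub
  rw [← lineSlope_add] at hadd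
  filter_upwards [S.eventually_cdReg_line hu hu₀, S.eventually_cdReg_line hv hv₀,
    S.eventually_σ_line (hu.sub hv) hsub, S.eventually_σ_line (hu.add hv) hadd]
    with z hgu hgv hsub hadd
  rw [← sub_ne_zero, S.cd_sub_cd hgu hgv]
  rw [S.reg_iff] at hgu hgv
  exact div_ne_zero (mul_ne_zero hsub hadd) (mul_ne_zero hgu hgv)

theorem eventually_s₂ChainParamReg_line (a : Fin 8 → ℂ) (b : ℂ) {ε : ℂ}
    (hε : ε = 3200000 ∨ ε = 3360000) :
    ∀ᶠ z in 𝓝[≠] (0 : ℂ),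
      S₂ChainParamReg τ (b + z * ε) (paramPairs fun j => a j + z * genericDir j) 0 := by
  simp only [paramPairs, S₂ChainParamReg, S₂ParamReg, genericDir, Matrix.cons_val, eventually_and,
    eventually_true]
  constructorm* _ ∧ _
  all_goals first
    | trivial
    | refine S.eventually_cdQuotReg_line ?_ ?_ ?_ ?_ ?_ ?_ ?_ ?_
    | refine S.eventually_cd_ne_line ?_ ?_ ?_ ?_ ?_ ?_
  all_goals simp only [IsAffine, lineSlope]
  all_goals first
    | (intro z; ring)
    | (rcases hε with rfl | rfl <;> ring_nf <;> norm_num)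

theorem eventually_mixFormReg_line (a : Fin 8 → ℂ) (b : ℂ) {ε : ℂ}
    (hε : ε = 3200000 ∨ ε = 3360000) {j : Fin 8} (hj : j = 6 ∨ j = 7) :
    ∀ᶠ z in 𝓝[≠] (0 : ℂ), MixFormReg τ (a 0 + z * genericDir 0) (a 1 + z * genericDir 1)
      (a 2 + z * genericDir 2) (a 3 + z * genericDir 3) (a 4 + z * genericDir 4)
      (a 5 + z * genericDir 5) (a j + z * genericDir j) (a 0 + z * genericDir 0 +
        (a 1 + z * genericDir 1) + (a 2 + z * genericDir 2) + (a 3 + z * genericDir 3))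
      (b + z * ε) := by
  have hk : genericDir j = 159980 ∨ genericDir j = 159999 := by
    rcases hj with rfl | rfl <;> simp [genericDir]
  generalize genericDir j = k at *
  simp only [mixFormReg_iff, QReg, PReg, GReg, genericDir, Matrix.cons_val, eventually_and]
  constructorm* _ ∧ _
  all_goals first
    | refine S.eventually_cdReg_line ?_ ?_
    | refine S.eventually_cdQuotReg_line ?_ ?_ ?_ ?_ ?_ ?_ ?_ ?_
  all_goals simp only [IsAffine, lineSlope]
  all_goals first
    | (intro z; ring)
    | (rcases hε with rfl | rfl <;> rcases hk with rfl | rfl <;> ring_nf <;> norm_num)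

theorem eventually_firstParamReg_line (a : Fin 8 → ℂ) (b : ℂ) {ε : ℂ}
    (hε : ε = 3200000 ∨ ε = 3360000) :
    ∀ᶠ z in 𝓝[≠] (0 : ℂ), FirstParamReg τ σ (a 0 + z * genericDir 0) (a 1 + z * genericDir 1)
      (a 2 + z * genericDir 2) (a 3 + z * genericDir 3) (a 4 + z * genericDir 4)
      (a 5 + z * genericDir 5) (a 6 + z * genericDir 6) (a 7 + z * genericDir 7) (b + z * ε)
      ((∑ j, (a j + z * genericDir j)) / 2) := by
  simp only [FirstParamReg, MixFormGeneric, sum_add_mul_genericDir, eventually_and]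
  constructorm* _ ∧ _
  all_goals first
    | exact S.eventually_mixFormReg_line a b hε (.inl rfl)
    | exact S.eventually_mixFormReg_line a b hε (.inr rfl)
    | refine S.eventually_cdReg_line ?_ ?_
    | refine S.eventually_cdQuotReg_line ?_ ?_ ?_ ?_ ?_ ?_ ?_ ?_
    | refine S.eventually_σ_line ?_ ?_
  all_goals simp only [IsAffine, lineSlope, genericDir, Matrix.cons_val]
  all_goals first
    | (intro z; ring)
    | (rcases hε with rfl | rfl <;> ring_nf <;> norm_num)

end CdSystem

/-! ### The second equation as the first equation at the image under `R` -/

namespace CdSystem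

variable {τ : ℂ} {f g σ : ℂ → ℂ} (S : CdSystem τ f g σ)
include S

theorem cdQuot_neg_right (u v w : ℂ) : cdQuot τ u v (-w) = cdQuot τ u v w := by
  rw [cdQuot, cdQuot, S.cd_neg]

theorem cdQuotReg_neg_right (u v w : ℂ) : CdQuotReg τ u v (-w) ↔ CdQuotReg τ u v w := by
  rw [CdQuotReg, CdQuotReg, S.cd_neg, S.cdReg_neg]

theorem msySecond_iff_and_msySecondReg_iff {c₁ c₂ c₃ c₄ c₅ c₆ c₇ c₈ η l x X Y : ℂ}
    (hl : l = (c₁ + c₂ + c₃ + c₄ + c₅ + c₆ + c₇ + c₈) / 2) :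
    (MSYSecond τ c₁ c₂ c₃ c₄ c₅ c₆ c₇ c₈ η l x X Y ↔
      MSYFirst τ (l / 2 - c₈) (l / 2 - c₇) (l / 2 - c₆) (l / 2 - c₅) (l / 2 - c₄) (l / 2 - c₃)
        (l / 2 - c₂) (l / 2 - c₁) (η + l / 2) l Y x X) ∧
    (MSYSecondReg τ c₁ c₂ c₃ c₄ c₅ c₆ c₇ c₈ η l x X Y ↔
      MSYFirstReg τ (l / 2 - c₈) (l / 2 - c₇) (l / 2 - c₆) (l / 2 - c₅) (l / 2 - c₄) (l / 2 - c₃)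
        (l / 2 - c₂) (l / 2 - c₁) (η + l / 2) l Y x X) := by
  rw [MSYSecond, MSYFirst, MSYSecondReg, MSYFirstReg,
    show l / 2 - c₈ + (l / 2 - c₇) + (l / 2 - c₆) + (l / 2 - c₅) = c₁ + c₂ + c₃ + c₄ by
      rw [hl]; ring,
    show η + l / 2 - (l / 2 - c₁) + l = η + c₁ + l by ring,
    show η + l / 2 - (l / 2 - c₂) + l = η + c₂ + l by ring,
    show η + l / 2 + (l / 2 - c₂) = η - c₂ + l by ring,
    show η + l / 2 + (l / 2 - c₁) = η - c₁ + l by ring,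
    show 3 * (η + l / 2) + (l / 2 - c₃) + l = 3 * η - c₃ + 3 * l by ring,
    show 2 * (η + l / 2) + (l / 2 - c₂ - (l / 2 - c₁)) / 2 + l =
      2 * η + (c₁ - c₂) / 2 + 2 * l by ring,
    show 2 * (η + l / 2) - (l / 2 - c₂ - (l / 2 - c₁)) / 2 + l =
      2 * η - (c₁ - c₂) / 2 + 2 * l by ring,
    show l / 2 - c₃ + (l / 2 - c₂ + (l / 2 - c₁)) / 2 - l = -(c₃ + (c₁ + c₂) / 2) by ring,
    show 2 * (η + l / 2) + (l / 2 - c₃) - (l / 2 - c₂ + (l / 2 - c₁)) / 2 + l =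
      2 * η - c₃ + (c₁ + c₂) / 2 + 2 * l by ring,
    show η - c₁ + l + (c₁ + c₂ + c₃ + c₄) / 2 = η - c₁ + (c₁ + c₂ + c₃ + c₄) / 2 + l by ring,
    show η - c₂ + l + (c₁ + c₂ + c₃ + c₄) / 2 = η - c₂ + (c₁ + c₂ + c₃ + c₄) / 2 + l by ring,
    show η + l / 2 + (l / 2 - c₄) + (c₁ + c₂ + c₃ + c₄) / 2 =
      η - c₄ + (c₁ + c₂ + c₃ + c₄) / 2 + l by ring,
    S.cdQuot_neg_right, S.cdQuotReg_neg_right]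
  exact ⟨Iff.rfl, Iff.rfl⟩

theorem msySecond_iff_run_RJ2 (p : State) :
    (MSYSecond τ (p.c 0) (p.c 1) (p.c 2) (p.c 3) (p.c 4) (p.c 5) (p.c 6) (p.c 7) p.η p.lam p.x
      (xBar τ p) (yBar τ p) ↔
      let q := run τ RJ2 p
      MSYFirst τ (q.c 0) (q.c 1) (q.c 2) (q.c 3) (q.c 4) (q.c 5) (q.c 6) (q.c 7) q.η q.lam q.x q.y
        (xTilde τ q)) ∧
    (MSYSecondReg τ (p.c 0) (p.c 1) (p.c 2) (p.c 3) (p.c 4) (p.c 5) (p.c 6) (p.c 7) p.η p.lam p.x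
      (xBar τ p) (yBar τ p) ↔
      let q := run τ RJ2 p
      MSYFirstReg τ (q.c 0) (q.c 1) (q.c 2) (q.c 3) (q.c 4) (q.c 5) (q.c 6) (q.c 7) q.η q.lam q.x
        q.y (xTilde τ q)) := by
  have hl : p.lam = (p.c 0 + p.c 1 + p.c 2 + p.c 3 + p.c 4 + p.c 5 + p.c 6 + p.c 7) / 2 := by
    rw [State.lam, Fin.sum_univ_eight]
  rw [(S.msySecond_iff_and_msySecondReg_iff hl).1, (S.msySecond_iff_and_msySecondReg_iff hl).2,
    xBar_eq, yBar_eq_xTilde]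
  simp only [c_run_RJ2, η_run_RJ2, lam_run_RJ2, x_run_RJ2, y_run_RJ2]
  exact ⟨Iff.rfl, Iff.rfl⟩

theorem msySecond {p : State} (h : run τ RJ2 p ∈ FirstDomain τ) :
    MSYSecond τ (p.c 0) (p.c 1) (p.c 2) (p.c 3) (p.c 4) (p.c 5) (p.c 6) (p.c 7) p.η p.lam p.x
      (xBar τ p) (yBar τ p) :=
  (S.msySecond_iff_run_RJ2 p).1.2 (S.msyFirst h)

end CdSystem

/-! ### Special parameters -/

theorem mem_specialSet_iff (p : State) : p ∈ SpecialSet ↔ reflParam p.c = p.c := by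
  have hrefl (j : Fin 8) : reflParam p.c j = p.c j ↔ p.c j + p.c (Fin.rev j) = p.lam / 2 := by
    rw [reflParam, sub_eq_iff_eq_add, eq_comm, State.lam]
  rw [funext_iff, forall_congr' hrefl]
  refine ⟨?_, fun h => ⟨h 4, h 5, h 6, h 7⟩⟩
  rintro ⟨h₄, h₅, h₆, h₇⟩ j
  rcases lt_or_ge j 4 with hj | hj
  · rw [add_comm]
    fin_cases j <;> first | assumption | exact absurd hj (by decide)
  · fin_cases j <;> first | assumption | exact absurd hj (by decide)

theorem run_RJ2_of_mem_specialSet (τ : ℂ) {p : State} (hp : p ∈ SpecialSet) :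
    run τ RJ2 p = (p.c, p.η + p.lam / 2, xTilde τ p, p.x) := by
  rw [run_RJ2, (mem_specialSet_iff p).1 hp, xTilde_eq_s₂Chain]

theorem reduced_iff_msySecond {τ : ℂ} {p : State} (hp : p ∈ SpecialSet) (x₁ x₂ : ℂ) :
    Reduced τ (p.c 0) (p.c 1) (p.c 2) (p.c 3) p.η p.lam p.x x₁ x₂ ↔
      MSYSecond τ (p.c 0) (p.c 1) (p.c 2) (p.c 3) (p.c 4) (p.c 5) (p.c 6) (p.c 7) p.η p.lam p.x
        x₂ x₁ := by
  obtain ⟨h₄, h₅, h₆, h₇⟩ := hp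
  rw [Reduced, MSYSecond, eq_sub_of_add_eq h₄, eq_sub_of_add_eq h₅, eq_sub_of_add_eq h₆,
    eq_sub_of_add_eq h₇]
  simp only [sub_sub_cancel]

theorem reducedReg_iff_msySecondReg {τ : ℂ} {p : State} (hp : p ∈ SpecialSet) (x₁ x₂ : ℂ) :
    ReducedReg τ (p.c 0) (p.c 1) (p.c 2) (p.c 3) p.η p.lam p.x x₁ x₂ ↔
      MSYSecondReg τ (p.c 0) (p.c 1) (p.c 2) (p.c 3) (p.c 4) (p.c 5) (p.c 6) (p.c 7) p.η p.lam p.x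
        x₂ x₁ := by
  obtain ⟨h₄, h₅, h₆, h₇⟩ := hp
  rw [ReducedReg, MSYSecondReg, eq_sub_of_add_eq h₄, eq_sub_of_add_eq h₅, eq_sub_of_add_eq h₆,
    eq_sub_of_add_eq h₇]
  simp only [sub_sub_cancel]

/-! ### The domains of the equations -/

/-- The points at which `R` is defined and which it maps to `FirstDomain`; these are the points at
which `T` is defined and all terms of the second equation make sense. -/
def SecondDomain (τ : ℂ) : Set State := {p | WordReg τ RJ2 p ∧ run τ RJ2 p ∈ FirstDomain τ}

theorem mem_closure_of_dense_fibres {A : Set State} {p : State} {d : Fin 8 → ℂ} {ε : ℂ}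
    (h : ∀ᶠ z in 𝓝[≠] (0 : ℂ),
      Dense {q : ℂ × ℂ | ((fun j => p.c j + z * d j, p.η + z * ε, q) : State) ∈ A}) :
    p ∈ closure A := by
  refine mem_closure_iff.2 fun V hV hpV => ?_
  have hline : Tendsto (fun z : ℂ => ((fun j => p.c j + z * d j, p.η + z * ε, p.2.2) : State))
      (𝓝 0) (𝓝 p) := Continuous.tendsto' (by fun_prop) _ _ (by simp [State.c, State.η])
  obtain ⟨z, hdense, hz⟩ :=
    (h.and ((hline.eventually_mem (hV.mem_nhds hpV)).filter_mono nhdsWithin_le_nhds)).exists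
  have hfibre : Continuous fun q : ℂ × ℂ =>
    ((fun j => p.c j + z * d j, p.η + z * ε, q) : State) := by fun_prop
  obtain ⟨q, hqV, hqA⟩ := hdense.inter_open_nonempty _ (hV.preimage hfibre) ⟨p.2.2, hz⟩
  exact ⟨_, hqV, hqA⟩

namespace CdSystem

variable {τ : ℂ} {f g σ : ℂ → ℂ} (S : CdSystem τ f g σ)
include S

theorem mem_secondDomain_iff (p : State) :
    p ∈ SecondDomain τ ↔ WordReg τ TJ2 p ∧
      MSYSecondReg τ (p.c 0) (p.c 1) (p.c 2) (p.c 3) (p.c 4) (p.c 5) (p.c 6) (p.c 7) p.η p.lam p.x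
        (xBar τ p) (yBar τ p) := by
  rw [(S.msySecond_iff_run_RJ2 p).2, TJ2, wordReg_append, and_assoc]
  exact Iff.rfl

theorem msyDomain_eq : MSYDomain τ = FirstDomain τ ∩ SecondDomain τ := by
  ext p
  rw [Set.mem_inter_iff, S.mem_secondDomain_iff]
  constructor
  · rintro ⟨hT, h₁, h₂⟩
    rw [yBar_eq_xTilde] at h₁
    exact ⟨⟨((wordReg_append ..).1 hT).1, h₁⟩, hT, h₂⟩
  · rintro ⟨⟨-, h₁⟩, hT, h₂⟩
    rw [← yBar_eq_xTilde] at h₁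
    exact ⟨hT, h₁, h₂⟩

theorem reducedDomain_eq : ReducedDomain τ = SecondDomain τ ∩ SpecialSet := by
  ext p
  rw [Set.mem_inter_iff, and_comm, S.mem_secondDomain_iff]
  refine and_congr_right fun hp => and_congr_right fun _ => ?_
  rw [reducedReg_iff_msySecondReg hp, xTildeTilde_eq_xBar, yBar_eq_xTilde]

theorem isOpen_secondDomain : IsOpen (SecondDomain τ) :=
  isOpen_iff_eventually.2 fun _ h => (S.eventually_wordReg h.1).and
    ((S.continuousAt_run h.1).eventually_mem (S.isOpen_firstDomain.mem_nhds h.2))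

theorem isOpen_msyDomain : IsOpen (MSYDomain τ) :=
  S.msyDomain_eq ▸ S.isOpen_firstDomain.inter S.isOpen_secondDomain

theorem dense_fibre_msyDomain {c c' : Fin 8 → ℂ} {η η' : ℂ} (hc' : reflParam c = c')
    (hη' : η + (∑ j, c j) / 2 / 2 = η') (hchain : S₂ChainParamReg τ η (paramPairs c) 0)
    (hfirst : FirstParamReg τ σ (c 0) (c 1) (c 2) (c 3) (c 4) (c 5) (c 6) (c 7) η ((∑ j, c j) / 2))
    (hchain' : S₂ChainParamReg τ η' (paramPairs c') 0)
    (hfirst' : FirstParamReg τ σ (c' 0) (c' 1) (c' 2) (c' 3) (c' 4) (c' 5) (c' 6) (c' 7) η'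
      ((∑ j, c' j) / 2)) :
    Dense {q : ℂ × ℂ | ((c, η, q) : State) ∈ MSYDomain τ} := by
  have hR : Dense {q : ℂ × ℂ | ((c', η', q) : State) ∈ FirstDomain τ} :=
    (S.dense_firstDomain hchain' hfirst' dense_univ).mono fun _ h => h.1
  have hswap : Dense {q : ℂ × ℂ | ((c', η', q.2, q.1) : State) ∈ FirstDomain τ} :=
    hR.preimage (Homeomorph.prodComm ℂ ℂ).isOpenMap
  refine (S.dense_firstDomain hchain hfirst hswap).mono ?_
  rintro q ⟨hq, hq'⟩
  rw [S.msyDomain_eq]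
  subst hc' hη'
  refine ⟨hq, hq.1, ?_⟩
  rw [run_RJ2, ← xTilde_eq_s₂Chain]
  exact hq'

theorem eventually_dense_fibre_msyDomain (p : State) :
    ∀ᶠ z in 𝓝[≠] (0 : ℂ), Dense {q : ℂ × ℂ |
      ((fun j => p.c j + z * genericDir j, p.η + z * 3200000, q) : State) ∈ MSYDomain τ} := by
  filter_upwards [S.eventually_s₂ChainParamReg_line p.c p.η (.inl rfl),
    S.eventually_firstParamReg_line p.c p.η (.inl rfl),
    S.eventually_s₂ChainParamReg_line (reflParam p.c) (p.η + p.lam / 2) (.inr rfl),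
    S.eventually_firstParamReg_line (reflParam p.c) (p.η + p.lam / 2) (.inr rfl)]
    with z hchain hfirst hchain' hfirst'
  refine S.dense_fibre_msyDomain (reflParam_add_mul_genericDir p.c z) ?_ hchain hfirst hchain'
    hfirst'
  rw [sum_add_mul_genericDir, State.lam]
  ring

theorem dense_msyDomain : Dense (MSYDomain τ) := fun p =>
  mem_closure_of_dense_fibres (S.eventually_dense_fibre_msyDomain p)

theorem specialSet_subset_closure_reducedDomain : SpecialSet ⊆ closure (ReducedDomain τ) := by
  intro p hp
  refine mem_closure_of_dense_fibres (d := genericDir) (ε := 3200000) ?_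
  filter_upwards [S.eventually_dense_fibre_msyDomain p] with z hz
  refine hz.mono fun q hq => ?_
  rw [S.msyDomain_eq] at hq
  refine S.reducedDomain_eq ▸ ⟨hq.2, (mem_specialSet_iff _).2 ?_⟩
  simp only [State.c, reflParam_add_mul_genericDir]
  rw [show reflParam p.1 = p.1 from (mem_specialSet_iff p).1 hp]

end CdSystem

theorem picWord_TJ2 (i : Fin 9) : picWord TJ2 (simpleRoot i) =
    if i = 1 then simpleRoot 1 - 2 • antiCanonical
    else if i = 2 then simpleRoot 2 + antiCanonical
    else simpleRoot i := by
  decide +kernel +revert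

end EllipticPainleve

end

open EllipticPainleve in
theorem mainTheorem3 (τ : ℂ) (hτ : 0 < τ.im) :
    -- the action of `T = R²` on the root lattice is a translation
    (∀ i : Fin 9, picWord TJ2 (simpleRoot i) =
      if i = 1 then simpleRoot 1 - 2 • antiCanonical
      else if i = 2 then simpleRoot 2 + antiCanonical
      else simpleRoot i) ∧
    -- the action of `T` on the parameters
    (∀ p : State, actWord τ TJ2 State.c p = p.c ∧ actWord τ TJ2 State.η p = p.η + p.lam) ∧
    -- the action of `T` on `(x, y)` is given by the two MSY equations,
    (∀ p ∈ MSYDomain τ,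
      MSYFirst τ (p.c 0) (p.c 1) (p.c 2) (p.c 3) (p.c 4) (p.c 5) (p.c 6) (p.c 7)
        p.η p.lam p.x p.y (yBar τ p) ∧
      MSYSecond τ (p.c 0) (p.c 1) (p.c 2) (p.c 3) (p.c 4) (p.c 5) (p.c 6) (p.c 7)
        p.η p.lam p.x (xBar τ p) (yBar τ p)) ∧
    -- which are meaningful at generic points
    (IsOpen (MSYDomain τ) ∧ Dense (MSYDomain τ)) ∧
    -- the action of `R` on the special parameters and on `(x, y)`
    (∀ p ∈ SpecialSet, actWord τ RJ2 id p = (p.c, p.η + p.lam / 2, xTilde τ p, p.x)) ∧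
    -- the scalar second-order equation for `x`,
    (∀ p ∈ ReducedDomain τ,
      Reduced τ (p.c 0) (p.c 1) (p.c 2) (p.c 3) p.η p.lam p.x (xTilde τ p) (xTildeTilde τ p)) ∧
    -- which is meaningful at generic special points
    ((∃ U : Set State, IsOpen U ∧ ReducedDomain τ = U ∩ SpecialSet) ∧
      SpecialSet ⊆ closure (ReducedDomain τ)) := by
  obtain ⟨f, g, σ, S⟩ := exists_cdSystem hτ
  refine ⟨picWord_TJ2, fun p => ⟨?_, ?_⟩, fun p hp => ?_,
    ⟨S.isOpen_msyDomain, S.dense_msyDomain⟩, fun p hp => ?_, fun p hp => ?_,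
    ⟨SecondDomain τ, S.isOpen_secondDomain, S.reducedDomain_eq⟩,
    S.specialSet_subset_closure_reducedDomain⟩
  · rw [actWord_eq_run, c_run_TJ2]
  · rw [actWord_eq_run, η_run_TJ2]
  · rw [S.msyDomain_eq] at hp
    exact ⟨yBar_eq_xTilde τ ▸ S.msyFirst hp.1, S.msySecond hp.2.2⟩
  · rw [actWord_eq_run, id, run_RJ2_of_mem_specialSet τ hp]
  · rw [S.reducedDomain_eq] at hp
    rw [reduced_iff_msySecond hp.2, xTildeTilde_eq_xBar, ← yBar_eq_xTilde]
    exact S.msySecond hp.1.2
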